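/- Let $m\ge 1$, $1<p<\infty$, and let $\varphi^{(1)},\varphi^{(2)},\varphi^{(3)}$ be complex-valued Schwartz functions on $\mathbb{R}^m$ with $\int\varphi^{(j)}=0$. For $r>0$ put $\varphi^{(j)}_{r}(x)=r^{-m}\varphi^{(j)}(x/r)$, and for $\mathbf r=(r_1,r_2,r_3)\in\mathbb{R}^3_+=(0,\infty)^3$ let $\varphi_{\mathbf r}=\pi_*\bigl(\varphi^{(1)}_{r_1}\otimes\varphi^{(2)}_{r_2}\otimes\varphi^{(3)}_{r_3}\bigr)$, that is, $$\varphi_{\mathbf r}(x_1,x_2)=\int_{\mathbb{R}^m}\varphi^{(1)}_{r_1}(x_1-u)\,\varphi^{(2)}_{r_2}(x_2-u)\,\varphi^{(3)}_{r_3}(u)\,du ,\qquad (x_1,x_2)\in\mathbb{R}^m\times\mathbb{R}^m=\mathbb{R}^{2m}.$$ For $f\in L^p(\mathbb{R}^{2m})$ define the three-parameter twisted Littlewood–Paley square function $$g_\varphi(f)(\mathbf x)=\Bigl(\int_{\mathbb{R}^3_+}|f*\varphi_{\mathbf r}(\mathbf x)|^2\,\frac{dr_1}{r_1}\frac{dr_2}{r_2}\frac{dr_3}{r_3}\Bigr)^{1/2}\in[0,\infty].$$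 (i) There is a constant $C$, depending only on $m$, $p$ and the $\varphi^{(j)}$, such that for every $f\in L^p(\mathbb{R}^{2m})$ one has $g_\varphi(f)\in L^p(\mathbb{R}^{2m})$ and $\|g_\varphi(f)\|_{L^p(\mathbb{R}^{2m})}\le C\,\|f\|_{L^p(\mathbb{R}^{2m})}$. (ii) Assume in addition that each $\varphi^{(j)}$ is nondegenerate: for every $\xi\in\mathbb{R}^m\setminus\{0\}$ there is $r>0$ with $\widehat{\varphi^{(j)}}(r\xi)\ne 0$. Then there is a constant $C$, depending only on $m$, $p$ and the $\varphi^{(j)}$, such that $\|f\|_{L^p(\mathbb{R}^{2m})}\le C\,\|g_\varphi(f)\|_{L^p(\mathbb{R}^{2m})}$ for every $f\in L^p(\mathbb{R}^{2m})$. In particular, for nondegenerate $\varphi^{(j)}$, $\|g_\varphi(f)\|_{L^p(\mathbb{R}^{2m})}\simeq\|f\|_{L^p(\mathbb{R}^{2m})}$ for all $f\in L^p(\mathbb{R}^{2m})$. -/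

import Mathlib

open MeasureTheory Set
open scoped ENNReal NNReal FourierTransform SchwartzMap

noncomputable section

namespace TwistedLP

/-- The Euclidean space `ℝᵐ`. -/
abbrev E (m : ℕ) : Type := EuclideanSpace ℝ (Fin m)

/-- The normalized isotropic dilate `φ_r(x) = r⁻ᵐ φ(r⁻¹ x)` of a function on `ℝᵐ`. -/
def dilate {m : ℕ} (φ : E m → ℂ) (r : ℝ) (x : E m) : ℂ :=
  (((r ^ m)⁻¹ : ℝ) : ℂ) * φ (r⁻¹ • x)

/-- The tensor product `φ₁ ⊗ φ₂ ⊗ φ₃` on `ℝᵐ × ℝᵐ × ℝᵐ`. -/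
def tensor {m : ℕ} (φ₁ φ₂ φ₃ : E m → ℂ) (x : E m × E m × E m) : ℂ :=
  φ₁ x.1 * φ₂ x.2.1 * φ₃ x.2.2

/-- The push-forward `π_* F` along `π (x₁, x₂, x₃) = (x₁ + x₃, x₂ + x₃)`: the integral of `F`
along the fibre `{(x₁ - u, x₂ - u, u) : u ∈ ℝᵐ}` over `(x₁, x₂)`. -/
def pushforward {m : ℕ} (F : E m × E m × E m → ℂ) (x : E m × E m) : ℂ :=
  ∫ u : E m, F (x.1 - u, x.2 - u, u)

/-- The three-parameter twisted dilate `φ_𝐫 = π_* (φ₁_{r₁} ⊗ φ₂_{r₂} ⊗ φ₃_{r₃})` on `ℝ²ᵐ`. -/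
def twistedDilate {m : ℕ} (φ₁ φ₂ φ₃ : E m → ℂ) (r : ℝ × ℝ × ℝ) : E m × E m → ℂ :=
  pushforward (tensor (dilate φ₁ r.1) (dilate φ₂ r.2.1) (dilate φ₃ r.2.2))

/-- The convolution `(f * k)(x) = ∫ f(y) k(x - y) dy` on `ℝ²ᵐ`. -/
def conv {m : ℕ} (f k : E m × E m → ℂ) (x : E m × E m) : ℂ :=
  ∫ y : E m × E m, f y * k (x - y)

/-- The square function
`g_φ(f)(x) = (∫_{ℝ³₊} |f * φ_𝐫 (x)|² dr₁/r₁ dr₂/r₂ dr₃/r₃)^{1/2}`, with values in `[0, ∞]`. -/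
def squareFunction {m : ℕ} (φ₁ φ₂ φ₃ : E m → ℂ) (f : E m × E m → ℂ) (x : E m × E m) : ℝ≥0∞ :=
  (∫⁻ r in Ioi (0 : ℝ) ×ˢ Ioi (0 : ℝ) ×ˢ Ioi (0 : ℝ),
    ‖conv f (twistedDilate φ₁ φ₂ φ₃ r) x‖ₑ ^ 2 / ENNReal.ofReal (r.1 * r.2.1 * r.2.2))
      ^ (1 / 2 : ℝ)

/-- Nondegeneracy of `φ`: its Fourier transform does not vanish identically on any open ray from
the origin. -/
def Nondegenerate {m : ℕ} (φ : E m → ℂ) : Prop :=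
  ∀ ξ : E m, ξ ≠ 0 → ∃ r : ℝ, 0 < r ∧ 𝓕 φ (r • ξ) ≠ 0

end TwistedLP

end

/-!
The two inequalities rest on two different ideas: weighted `L²` estimates for the upper bound, and
Calderón's reproducing formula, together with the upper bound, for the lower one. Both reduce the
three-parameter problem to one parameter, because convolution with a twisted dilate is an iterated
convolution along the two coordinate subspaces and the diagonal of `ℝᵐ × ℝᵐ`
(`conv_twistedDilate`). An estimate on `ℝᵐ` is applied on the fibres of each direction in turn.

**Upper bound.** On `ℝᵐ`, the one-parameter square function is bounded on `L²(w)` for every `A₂`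
weight `w` (`exists_lintegral_smear_le`). Write `V` and `Y` for averages of `w` and `w⁻¹`. The
Bellman function `|u|² / N(V, Y)` with `N(V, Y) = Y - 1 / (2 Y V²)` decreases under averaging, and
its drop controls the oscillation of `u` (`bellmanB_integral_le`). Averages over balls are used
twice at each of the radii `ε 2 ^ j`: telescoping the Bellman functional bounds the sum of the
oscillations at all scales (`tsum_energy_le`). Two averages at the same radius occur because the
pairing of a function `ζ` with the change of `u` under a double average is an integral of products
of oscillations of `ζ` and of `u` (`integral_mul_sub_integral_mul_avg_avg`), so that mean-zero
Lipschitz bumps are controlled by the oscillations (`IsA2.lintegral_smear_atom_le`); a Schwartz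
function of mean zero is a summable superposition of dilated bumps (`exists_bump_decomposition`).

Iterating the one-parameter estimate in the three directions gives `L²(v)` bounds for weights `v`
on `ℝᵐ × ℝᵐ` that are `A₂` along almost every fibre in each direction
(`exists_lintegral_squareFunction_le`). Such weights are supplied by the Rubio de Francia iteration
of the sum of the three directional maximal functions (`exists_isA1_majorant`), and the usual
extrapolation argument passes from `L²(v)` to `L^p`: for `p ≤ 2` the weight is a negative power of a
majorant of `|f|`, for `p > 2` it is a majorant of a power of the square function itself.

**Lower bound.** A nondegenerate `φ` has a Schwartz partner `ψ` of mean zero such that the dilates of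
`φ̂ · conj ψ̂` integrate to one against `dr / r` (`exists_isCalderonPair`). Calderón's formula on
the fibres of the three directions, followed by Cauchy–Schwarz, yields
`|∫ f ḡ| ≤ ∫ S_φ f · S_ψ g` (`enorm_integral_mul_conj_le_squareFunction`). With `g = |f|^{p-2} f`,
Hölder's inequality and the upper bound for `S_ψ` on the dual exponent give the lower bound for
bounded `f` with bounded support. The upper bound for `S_φ` makes the truncation error negligible
and so extends it to all of `L^p` (`exists_lintegral_rpow_le_squareFunction`).
-/

noncomputable section
namespace TwistedLP

/-! ### The Bellman function -/

/-- The Cauchy–Schwarz inequality for the measure with density `w`. -/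
lemma sq_integral_mul_le_weighted {S : Type*} [MeasurableSpace S] {μ : Measure S} {w q : S → ℝ}
    (hw : ∀ x, 0 ≤ w x) (h0 : Integrable w μ) (h1 : Integrable (fun x => w x * q x) μ)
    (h2 : Integrable (fun x => w x * q x ^ 2) μ) :
    (∫ x, w x * q x ∂μ) ^ 2 ≤ (∫ x, w x ∂μ) * ∫ x, w x * q x ^ 2 ∂μ := by
  have key : ∀ t : ℝ, 0 ≤ (∫ x, w x ∂μ) * (t * t) + (-2 * ∫ x, w x * q x ∂μ) * t
      + ∫ x, w x * q x ^ 2 ∂μ := by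
    intro t
    have : 0 ≤ ∫ x, w x * (q x - t) ^ 2 ∂μ :=
      integral_nonneg fun x => mul_nonneg (hw x) (sq_nonneg _)
    have e : ∫ x, w x * (q x - t) ^ 2 ∂μ = ∫ x, (w x * q x ^ 2 - (2 * t) * (w x * q x)
        + (t * t) * w x) ∂μ := by
      congr 1; ext x; ring
    have h3 : Integrable (fun x => (2 * t) * (w x * q x)) μ := h1.const_mul _
    have h4 : Integrable (fun x => w x * q x ^ 2 - (2 * t) * (w x * q x)) μ := h2.sub h3
    rw [e, integral_add h4 (h0.const_mul _), integral_sub h2 h3, integral_const_mul,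
      integral_const_mul] at this
    linarith
  have := discrim_le_zero key
  unfold discrim at this
  nlinarith

/-- For a probability density `s`, the `L¹` deviation from `1` is controlled by the Hellinger
distance. -/
lemma sq_integral_abs_sub_one_le {S : Type*} [MeasurableSpace S] {μ : Measure S}
    [IsProbabilityMeasure μ] {s : S → ℝ} (hs : ∀ x, 0 ≤ s x) (hi : Integrable s μ)
    (h1 : ∫ x, s x ∂μ = 1) :
    (∫ x, |s x - 1| ∂μ) ^ 2 ≤ 4 * ∫ x, (√(s x) - 1) ^ 2 ∂μ := by
  have hm : AEStronglyMeasurable (fun x => √(s x)) μ :=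
    Real.continuous_sqrt.comp_aestronglyMeasurable hi.1
  have hsq : ∀ x, √(s x) ^ 2 = s x := fun x => Real.sq_sqrt (hs x)
  have hn : ∀ x, 0 ≤ √(s x) := fun x => Real.sqrt_nonneg _
  have hr : Integrable (fun x => √(s x)) μ := by
    refine ((hi.add (integrable_const (1 : ℝ)))).mono' hm (ae_of_all _ fun x => ?_)
    simp only [Real.norm_eq_abs, abs_of_nonneg (hn x), Pi.add_apply]
    nlinarith [hsq x, hn x]
  have hw : Integrable (fun x => (√(s x) + 1) ^ 2) μ := by
    have : (fun x => (√(s x) + 1) ^ 2) = fun x => s x + 2 * √(s x) + 1 := by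
      ext x; nlinarith [hsq x]
    rw [this]; exact (hi.add (hr.const_mul 2)).add (integrable_const _)
  have hd : Integrable (fun x => (√(s x) - 1) ^ 2) μ := by
    have : (fun x => (√(s x) - 1) ^ 2) = fun x => s x - 2 * √(s x) + 1 := by
      ext x; nlinarith [hsq x]
    rw [this]; exact (hi.sub (hr.const_mul 2)).add (integrable_const _)
  have hp : ∀ x, 0 < √(s x) + 1 := fun x => by linarith [hn x]
  -- Cauchy–Schwarz for the factorization `s - 1 = (√s - 1) (√s + 1)`.
  have e1 : (fun x => (√(s x) + 1) ^ 2 * (|√(s x) - 1| / (√(s x) + 1))) = fun x => |s x - 1| := by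
    ext x
    have : s x - 1 = (√(s x) - 1) * (√(s x) + 1) := by nlinarith [hsq x]
    rw [this, abs_mul, abs_of_pos (hp x)]
    have := (hp x).ne'
    field_simp
  have e2 : (fun x => (√(s x) + 1) ^ 2 * (|√(s x) - 1| / (√(s x) + 1)) ^ 2)
      = fun x => (√(s x) - 1) ^ 2 := by
    ext x
    have := (hp x).ne'
    rw [div_pow, sq_abs]
    field_simp
  have := sq_integral_mul_le_weighted (μ := μ) (w := fun x => (√(s x) + 1) ^ 2)
    (q := fun x => |√(s x) - 1| / (√(s x) + 1)) (fun x => sq_nonneg _) hw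
    (by rw [e1]; exact (hi.sub (integrable_const _)).abs) (by rw [e2]; exact hd)
  rw [e1, e2] at this
  refine this.trans (mul_le_mul_of_nonneg_right ?_ (integral_nonneg fun x => sq_nonneg _))
  calc ∫ x, (√(s x) + 1) ^ 2 ∂μ ≤ ∫ x, (2 * s x + 2) ∂μ := by
        refine integral_mono hw ((hi.const_mul 2).add (integrable_const _)) fun x => ?_
        nlinarith [hsq x, sq_nonneg (√(s x) - 1)]
    _ = 4 := by
        rw [integral_add (hi.const_mul 2) (integrable_const _), integral_const_mul, h1]
        simp; norm_num

/-- A strict form of the concavity of `N(V, Y) = Y - 1 / (2 Y V²)`, in multiplicative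
coordinates. -/
lemma seven_sub_le_inv {a b : ℝ} (ha : 0 < a) (hb : 0 < b) :
    7 - 2 * a - 4 * b ≤ 1 / (a ^ 2 * b ^ 4) := by
  -- Three instances of `log x ≤ x - 1`; the logarithms cancel.
  have h1 := Real.log_le_sub_one_of_pos ha
  have h2 := Real.log_le_sub_one_of_pos hb
  have hX : 0 < 1 / (a ^ 2 * b ^ 4) := by positivity
  have h3 := Real.log_le_sub_one_of_pos hX
  rw [one_div, Real.log_inv, Real.log_mul (by positivity) (by positivity), Real.log_pow,
    Real.log_pow] at h3
  push_cast at h3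
  rw [one_div]; linarith

/-- The function `N(V, Y) = Y - 1 / (2 Y V²)`: it is concave, comparable to `Y` where `V Y ≥ 1`,
and strictly so in both variables jointly. -/
def bellmanN (V Y : ℝ) : ℝ := Y - 1 / (2 * Y * V ^ 2)

/-- The Bellman function `|u|² / N(V, Y)` of the weighted quadratic estimate. -/
def bellmanB (u : ℂ) (V Y : ℝ) : ℝ := ‖u‖ ^ 2 / bellmanN V Y

lemma inv_two_mul_le {V Y : ℝ} (hV : 0 < V) (hY : 0 < Y) (h : 1 ≤ V * Y) :
    1 / (2 * Y * V ^ 2) ≤ Y / 2 := by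
  rw [div_le_div_iff₀ (by positivity) (by norm_num)]
  nlinarith [mul_pos hV hY]

lemma half_le_bellmanN {V Y : ℝ} (hV : 0 < V) (hY : 0 < Y) (h : 1 ≤ V * Y) :
    Y / 2 ≤ bellmanN V Y := by
  have := inv_two_mul_le hV hY h
  unfold bellmanN; linarith

lemma bellmanN_le {V Y : ℝ} (hV : 0 < V) (hY : 0 < Y) : bellmanN V Y ≤ Y := by
  have : 0 < 1 / (2 * Y * V ^ 2) := by positivity
  unfold bellmanN; linarith

lemma bellmanN_pos {V Y : ℝ} (hV : 0 < V) (hY : 0 < Y) (h : 1 ≤ V * Y) : 0 < bellmanN V Y :=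
  lt_of_lt_of_le (by linarith) (half_le_bellmanN hV hY h)

/-- The expansion of `|u|² / N` around the point `(U, M)`: the tangent plane plus a nonnegative
quadratic remainder. -/
lemma norm_sq_div_eq {N M : ℝ} (hN : 0 < N) (hM : 0 < M) (u U : ℂ) :
    ‖u‖ ^ 2 / N = ‖U‖ ^ 2 / M + 2 / M * (U.re * (u.re - U.re) + U.im * (u.im - U.im))
      - ‖U‖ ^ 2 / M ^ 2 * (N - M) + N * ‖u / N - U / M‖ ^ 2 := by
  have hN' := hN.ne'
  have hM' := hM.ne'
  have e : ‖u / N - U / M‖ ^ 2 = (u.re / N - U.re / M) ^ 2 + (u.im / N - U.im / M) ^ 2 := by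
    rw [← Complex.normSq_eq_norm_sq, Complex.normSq_apply]
    simp [Complex.div_ofReal_re, Complex.div_ofReal_im]
    ring
  have e2 : ∀ z : ℂ, ‖z‖ ^ 2 = z.re ^ 2 + z.im ^ 2 := fun z => by
    rw [← Complex.normSq_eq_norm_sq, Complex.normSq_apply]; ring
  rw [e, e2, e2]
  field_simp
  ring

/-- Real arithmetic behind `sq_integral_abs_bellmanN_sub_le`. -/
lemma sq_le_of_osc_bounds {I Q Y0 Ds Dt A g0 a b : ℝ} (hI0 : 0 ≤ I)
    (hI : I ≤ Q + 3 / 2 * Y0 * Ds + Y0 * Dt) (hQ0 : 0 ≤ Q) (hQY : Q ≤ Y0) (hA1 : 1 ≤ A)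
    (hY0 : 0 < Y0) (hg0p : 0 < g0) (hgA : Y0 ≤ 2 * A ^ 2 * g0) (hs2 : Ds ^ 2 ≤ 4 * a)
    (ht2 : Dt ^ 2 ≤ 4 * b) (hDs : g0 * a ≤ Q) (hDt : g0 * (2 * b) ≤ Q) :
    I ^ 2 ≤ 69 * A ^ 2 * Y0 * Q := by
  have q1 : Y0 * Ds ^ 2 ≤ 8 * A ^ 2 * Q := by
    have h3 : g0 * Ds ^ 2 ≤ 4 * Q := by nlinarith
    calc Y0 * Ds ^ 2 ≤ 2 * A ^ 2 * g0 * Ds ^ 2 := mul_le_mul_of_nonneg_right hgA (sq_nonneg _)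
      _ = 2 * A ^ 2 * (g0 * Ds ^ 2) := by ring
      _ ≤ 2 * A ^ 2 * (4 * Q) := by gcongr
      _ = _ := by ring
  have q2 : Y0 * Dt ^ 2 ≤ 4 * A ^ 2 * Q := by
    have h3 : g0 * Dt ^ 2 ≤ 2 * Q := by nlinarith
    calc Y0 * Dt ^ 2 ≤ 2 * A ^ 2 * g0 * Dt ^ 2 := mul_le_mul_of_nonneg_right hgA (sq_nonneg _)
      _ = 2 * A ^ 2 * (g0 * Dt ^ 2) := by ring
      _ ≤ 2 * A ^ 2 * (2 * Q) := by gcongr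
      _ = _ := by ring
  have q3 : Q ^ 2 ≤ A ^ 2 * Y0 * Q := by
    have : Q ^ 2 ≤ Y0 * Q := by nlinarith
    have hA2 : 1 ≤ A ^ 2 := by nlinarith
    nlinarith [mul_nonneg hY0.le hQ0]
  calc I ^ 2 ≤ (Q + 3 / 2 * Y0 * Ds + Y0 * Dt) ^ 2 := pow_le_pow_left₀ hI0 hI 2
    _ ≤ 3 * (Q ^ 2 + (3 / 2 * Y0 * Ds) ^ 2 + (Y0 * Dt) ^ 2) := by
        nlinarith [sq_nonneg (Q - 3 / 2 * Y0 * Ds), sq_nonneg (Q - Y0 * Dt),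
          sq_nonneg (3 / 2 * Y0 * Ds - Y0 * Dt)]
    _ = 3 * (Q ^ 2 + 9 / 4 * Y0 * (Y0 * Ds ^ 2) + Y0 * (Y0 * Dt ^ 2)) := by ring
    _ ≤ 3 * (A ^ 2 * Y0 * Q + 9 / 4 * Y0 * (8 * A ^ 2 * Q) + Y0 * (4 * A ^ 2 * Q)) := by gcongr
    _ = 69 * A ^ 2 * Y0 * Q := by ring

/-- Real arithmetic behind `bellmanB_integral_le`. -/
lemma mul_sq_le_of_gap_bounds {D I1 Z V0 Y0 A P R : ℝ} (hD0 : 0 ≤ D) (hD : D ≤ I1 + Z)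
    (hI1 : I1 ^ 2 ≤ Y0 * P) (hZ : Z ^ 2 ≤ 69 * A ^ 2 * Y0 * R) (hA1 : 1 ≤ A) (hY0 : 0 < Y0)
    (hV0 : 0 < V0) (hA : V0 * Y0 ≤ A) (hP : 0 ≤ P) (hR : 0 ≤ R) :
    1 / (138 * A ^ 3) * (V0 * D ^ 2) ≤ R + P := by
  have hfin : D ^ 2 ≤ 138 * A ^ 2 * Y0 * (R + P) := by
    have h3 := pow_le_pow_left₀ hD0 hD 2
    have h4 : (I1 + Z) ^ 2 ≤ 2 * I1 ^ 2 + 2 * Z ^ 2 := by nlinarith [sq_nonneg (I1 - Z)]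
    have h5 : Y0 * P ≤ 69 * A ^ 2 * (Y0 * P) := by
      have : 1 ≤ 69 * A ^ 2 := by nlinarith
      nlinarith [mul_nonneg hY0.le hP]
    linarith
  rw [one_div, inv_mul_le_iff₀ (by positivity)]
  calc V0 * D ^ 2 ≤ V0 * (138 * A ^ 2 * Y0 * (R + P)) := by gcongr
    _ = (V0 * Y0) * (138 * A ^ 2 * (R + P)) := by ring
    _ ≤ A * (138 * A ^ 2 * (R + P)) := by gcongr
    _ = _ := by ring

section OneStep
variable {S : Type*} [MeasurableSpace S] {μ : Measure S} [IsProbabilityMeasure μ]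
  {u : S → ℂ} {V Y : S → ℝ}

/-- The mean drop of the concave function `N` under averaging controls the squared `L¹` oscillation
of `N` itself. -/
lemma sq_integral_abs_bellmanN_sub_le {A : ℝ} (hVi : Integrable V μ)
    (hYi : Integrable Y μ) (hV : ∀ x, 0 < V x) (hY : ∀ x, 0 < Y x) (hVY : ∀ x, 1 ≤ V x * Y x)
    (hV0 : 0 < ∫ x, V x ∂μ) (hY0 : 0 < ∫ x, Y x ∂μ) (h1 : 1 ≤ (∫ x, V x ∂μ) * ∫ x, Y x ∂μ)
    (hA : (∫ x, V x ∂μ) * ∫ x, Y x ∂μ ≤ A) :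
    Integrable (fun x => bellmanN (V x) (Y x)) μ ∧
    0 ≤ bellmanN (∫ x, V x ∂μ) (∫ x, Y x ∂μ) - ∫ x, bellmanN (V x) (Y x) ∂μ ∧
    (∫ x, |bellmanN (V x) (Y x) - bellmanN (∫ x, V x ∂μ) (∫ x, Y x ∂μ)| ∂μ) ^ 2 ≤
      69 * A ^ 2 * (∫ x, Y x ∂μ) *
      (bellmanN (∫ x, V x ∂μ) (∫ x, Y x ∂μ) - ∫ x, bellmanN (V x) (Y x) ∂μ) := by
  set V0 := ∫ x, V x ∂μ with hV0d
  set Y0 := ∫ x, Y x ∂μ with hY0d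
  set M := bellmanN V0 Y0 with hM
  set g : S → ℝ := fun x => 1 / (2 * Y x * V x ^ 2) with hg
  set g0 : ℝ := 1 / (2 * Y0 * V0 ^ 2) with hg0
  have hg0p : 0 < g0 := by positivity
  have hgm : AEStronglyMeasurable g μ := by
    have h := ((hYi.1.aemeasurable.const_mul 2).mul (hVi.1.aemeasurable.pow_const 2)).const_div 1
    exact h.aestronglyMeasurable
  have hgi : Integrable g μ := by
    refine (hYi.div_const 2).mono' hgm (ae_of_all _ fun x => ?_)
    have : 0 < g x := by have := hV x; have := hY x; simp only [hg]; positivity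
    rw [Real.norm_eq_abs, abs_of_pos this]
    exact inv_two_mul_le (hV x) (hY x) (hVY x)
  have hNi : Integrable (fun x => bellmanN (V x) (Y x)) μ := hYi.sub hgi
  -- Normalize the two variables to have mean one.
  set s : S → ℝ := fun x => Y x / Y0 with hs
  set t : S → ℝ := fun x => V x / V0 with ht
  have hsp : ∀ x, 0 < s x := fun x => div_pos (hY x) hY0
  have htp : ∀ x, 0 < t x := fun x => div_pos (hV x) hV0
  have hsi : Integrable s μ := hYi.div_const _
  have hti : Integrable t μ := hVi.div_const _
  have hs1 : ∫ x, s x ∂μ = 1 := by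
    simp only [hs]; rw [integral_div]; exact div_self hY0.ne'
  have ht1 : ∫ x, t x ∂μ = 1 := by
    simp only [ht]; rw [integral_div]; exact div_self hV0.ne'
  have hgst : ∀ x, g x = g0 * (1 / (s x * t x ^ 2)) := fun x => by
    have := (hV x).ne'; have := (hY x).ne'; have := hV0.ne'; have := hY0.ne'
    simp only [hg, hg0, hs, ht]; field_simp
  have hss : Integrable (fun x => (√(s x) - 1) ^ 2) μ := by
    have hr : Integrable (fun x => √(s x)) μ := by
      refine ((hsi.add (integrable_const (1 : ℝ)))).mono'
        (Real.continuous_sqrt.comp_aestronglyMeasurable hsi.1) (ae_of_all _ fun x => ?_)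
      simp only [Real.norm_eq_abs, abs_of_nonneg (Real.sqrt_nonneg _), Pi.add_apply]
      nlinarith [Real.sq_sqrt (hsp x).le, Real.sqrt_nonneg (s x)]
    have : (fun x => (√(s x) - 1) ^ 2) = fun x => s x - 2 * √(s x) + 1 := by
      ext x; nlinarith [Real.sq_sqrt (hsp x).le]
    rw [this]; exact (hsi.sub (hr.const_mul 2)).add (integrable_const _)
  have htt : Integrable (fun x => (√(t x) - 1) ^ 2) μ := by
    have hr : Integrable (fun x => √(t x)) μ := by
      refine ((hti.add (integrable_const (1 : ℝ)))).mono'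
        (Real.continuous_sqrt.comp_aestronglyMeasurable hti.1) (ae_of_all _ fun x => ?_)
      simp only [Real.norm_eq_abs, abs_of_nonneg (Real.sqrt_nonneg _), Pi.add_apply]
      nlinarith [Real.sq_sqrt (htp x).le, Real.sqrt_nonneg (t x)]
    have : (fun x => (√(t x) - 1) ^ 2) = fun x => t x - 2 * √(t x) + 1 := by
      ext x; nlinarith [Real.sq_sqrt (htp x).le]
    rw [this]; exact (hti.sub (hr.const_mul 2)).add (integrable_const _)
  -- `e` is the concavity excess of `N`, in units of `g0`.
  set e : S → ℝ := fun x => 1 / (s x * t x ^ 2) + s x + 2 * t x - 4 with he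
  have hei : Integrable (fun x => g0 * e x) μ := by
    have : (fun x => g0 * e x) = fun x => g x + g0 * s x + g0 * 2 * t x - g0 * 4 := by
      ext x; rw [hgst]; simp only [he]; ring
    rw [this]
    exact ((hgi.add (hsi.const_mul _)).add (hti.const_mul _)).sub (integrable_const _)
  have hepos : ∀ x, (√(s x) - 1) ^ 2 + 2 * (√(t x) - 1) ^ 2 ≤ e x := fun x => by
    have := seven_sub_le_inv (Real.sqrt_pos.2 (hsp x)) (Real.sqrt_pos.2 (htp x))
    have h1 := Real.sq_sqrt (hsp x).le
    have h2 := Real.sq_sqrt (htp x).le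
    have h4 : √(t x) ^ 4 = t x ^ 2 := by rw [← h2]; rw [h2]; nlinarith
    rw [h1, h4] at this
    simp only [he]; nlinarith
  set Q := M - ∫ x, bellmanN (V x) (Y x) ∂μ with hQ
  have hQe : Q = ∫ x, g0 * e x ∂μ := by
    have e1 : ∫ x, bellmanN (V x) (Y x) ∂μ = Y0 - ∫ x, g x ∂μ := integral_sub hYi hgi
    have e2 : ∫ x, g0 * e x ∂μ = ∫ x, (g x + g0 * s x + g0 * 2 * t x - g0 * 4) ∂μ := by
      congr 1; ext x; rw [hgst]; simp only [he]; ring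
    have hb : Integrable (fun x => g x + g0 * s x) μ := hgi.add (hsi.const_mul _)
    have hc : Integrable (fun x => g x + g0 * s x + g0 * 2 * t x) μ := hb.add (hti.const_mul _)
    rw [e2, integral_sub hc (integrable_const _), integral_add hb (hti.const_mul _),
      integral_add hgi (hsi.const_mul _), integral_const_mul, integral_const_mul, hs1, ht1, hQ, e1,
      hM, bellmanN, ← hg0]
    simp; ring
  have hQ0 : 0 ≤ Q := by
    rw [hQe]; exact integral_nonneg fun x => mul_nonneg hg0p.le
      (le_trans (by positivity) (hepos x))
  -- The excess `e` bounds the Hellinger distances of `s` and `t` from the constant `1`, and hence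
  -- their `L¹` deviations.
  have hDs : g0 * ∫ x, (√(s x) - 1) ^ 2 ∂μ ≤ Q := by
    rw [hQe, ← integral_const_mul]
    refine integral_mono (hss.const_mul _) hei fun x => mul_le_mul_of_nonneg_left ?_ hg0p.le
    nlinarith [hepos x, sq_nonneg (√(t x) - 1)]
  have hDt : g0 * (2 * ∫ x, (√(t x) - 1) ^ 2 ∂μ) ≤ Q := by
    rw [hQe, ← integral_const_mul, ← integral_const_mul]
    refine integral_mono ((htt.const_mul _).const_mul _) hei
      fun x => mul_le_mul_of_nonneg_left ?_ hg0p.le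
    nlinarith [hepos x, sq_nonneg (√(s x) - 1)]
  have hs2 := sq_integral_abs_sub_one_le (fun x => (hsp x).le) hsi hs1
  have ht2 := sq_integral_abs_sub_one_le (fun x => (htp x).le) hti ht1
  set Ds := ∫ x, |s x - 1| ∂μ
  set Dt := ∫ x, |t x - 1| ∂μ
  have hDs0 : 0 ≤ Ds := integral_nonneg fun x => abs_nonneg _
  have hDt0 : 0 ≤ Dt := integral_nonneg fun x => abs_nonneg _
  have hMY : M ≤ Y0 := bellmanN_le hV0 hY0
  have hNnn : 0 ≤ ∫ x, bellmanN (V x) (Y x) ∂μ :=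
    integral_nonneg fun x => (bellmanN_pos (hV x) (hY x) (hVY x)).le
  have hQY : Q ≤ Y0 := by linarith
  have hgY : g0 ≤ Y0 / 2 := inv_two_mul_le hV0 hY0 h1
  have hA1 : 1 ≤ A := h1.trans hA
  -- This is where `V Y ≤ A` for the averages enters: `g0` is not much smaller than `Y0`.
  have hgA : Y0 ≤ 2 * A ^ 2 * g0 := by
    rw [hg0, mul_one_div, le_div_iff₀ (by positivity)]
    have : (V0 * Y0) ^ 2 ≤ A ^ 2 := pow_le_pow_left₀ (by positivity) hA 2
    nlinarith
  have hI : ∫ x, |bellmanN (V x) (Y x) - M| ∂μ ≤ Q + 3 / 2 * Y0 * Ds + Y0 * Dt := by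
    have hsa : Integrable (fun x => (Y0 + g0) * |s x - 1|) μ :=
      (hsi.sub (integrable_const _)).abs.const_mul _
    have hb : Integrable (fun x => g0 * e x + (Y0 + g0) * |s x - 1|) μ := hei.add hsa
    have ht' : Integrable (fun x => 2 * g0 * |t x - 1|) μ :=
      (hti.sub (integrable_const _)).abs.const_mul _
    calc ∫ x, |bellmanN (V x) (Y x) - M| ∂μ
        ≤ ∫ x, (g0 * e x + (Y0 + g0) * |s x - 1| + 2 * g0 * |t x - 1|) ∂μ := by
          refine integral_mono (hNi.sub (integrable_const _)).abs (hb.add ht') fun x => ?_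
          have e1 : bellmanN (V x) (Y x) - M
              = (Y0 + g0) * (s x - 1) + 2 * g0 * (t x - 1) - g0 * e x := by
            have : bellmanN (V x) (Y x) = Y0 * s x - g x := by
              simp only [bellmanN, hg, hs]; field_simp
            rw [this, hM, bellmanN, hgst, ← hg0]; simp only [he]; ring
          have e0 : 0 ≤ g0 * e x := mul_nonneg hg0p.le (le_trans (by positivity) (hepos x))
          have p1 : 0 ≤ Y0 + g0 := by positivity
          simp only []
          rw [e1]
          have a1 : (Y0 + g0) * |s x - 1| = |(Y0 + g0) * (s x - 1)| := by
            rw [abs_mul, abs_of_nonneg p1]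
          have a2 : 2 * g0 * |t x - 1| = |2 * g0 * (t x - 1)| := by
            rw [abs_mul, abs_of_nonneg (by positivity : 0 ≤ 2 * g0)]
          rw [a1, a2]
          have b1 := abs_add_le ((Y0 + g0) * (s x - 1) + 2 * g0 * (t x - 1)) (-(g0 * e x))
          have b2 := abs_add_le ((Y0 + g0) * (s x - 1)) (2 * g0 * (t x - 1))
          rw [abs_neg, abs_of_nonneg e0] at b1
          rw [sub_eq_add_neg]; linarith
      _ = Q + (Y0 + g0) * Ds + 2 * g0 * Dt := by
          rw [integral_add hb ht', integral_add hei hsa, integral_const_mul (Y0 + g0),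
            integral_const_mul (2 * g0), ← hQe]
      _ ≤ _ := by nlinarith
  exact ⟨hNi, hQ0, sq_le_of_osc_bounds (integral_nonneg fun x => abs_nonneg _) hI hQ0 hQY hA1 hY0
    hg0p hgA hs2 ht2 hDs hDt⟩

/-- The one-step Bellman inequality: averaging decreases `bellmanB`, and the drop controls the
`L¹` oscillation of `u`, as soon as the averaged weights satisfy `V Y ≤ A`. No upper bound for
`V Y` before the averaging is needed. -/
theorem bellmanB_integral_le {A : ℝ} (hu : Integrable u μ) (hVi : Integrable V μ)
    (hYi : Integrable Y μ) (hV : ∀ x, 0 < V x) (hY : ∀ x, 0 < Y x) (hVY : ∀ x, 1 ≤ V x * Y x)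
    (hV0 : 0 < ∫ x, V x ∂μ) (hY0 : 0 < ∫ x, Y x ∂μ) (h1 : 1 ≤ (∫ x, V x ∂μ) * ∫ x, Y x ∂μ)
    (hA : (∫ x, V x ∂μ) * ∫ x, Y x ∂μ ≤ A)
    (hB : Integrable (fun x => bellmanB (u x) (V x) (Y x)) μ) :
    bellmanB (∫ x, u x ∂μ) (∫ x, V x ∂μ) (∫ x, Y x ∂μ) +
      1 / (138 * A ^ 3) * ((∫ x, V x ∂μ) * (∫ x, ‖u x - ∫ y, u y ∂μ‖ ∂μ) ^ 2)
      ≤ ∫ x, bellmanB (u x) (V x) (Y x) ∂μ := by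
  obtain ⟨hNi, hQ0, hosc⟩ := sq_integral_abs_bellmanN_sub_le hVi hYi hV hY hVY hV0 hY0 h1 hA
  set V0 := ∫ x, V x ∂μ with hV0d
  set Y0 := ∫ x, Y x ∂μ with hY0d
  set U := ∫ x, u x ∂μ with hU
  set M := bellmanN V0 Y0 with hM
  set N : S → ℝ := fun x => bellmanN (V x) (Y x) with hN
  have hNp : ∀ x, 0 < N x := fun x => bellmanN_pos (hV x) (hY x) (hVY x)
  have hMp : 0 < M := bellmanN_pos hV0 hY0 h1
  set Q := M - ∫ x, N x ∂μ with hQ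
  -- The part of the tangent plane that is linear in `u` has mean zero.
  set l : S → ℝ := fun x => U.re * ((u x).re - U.re) + U.im * ((u x).im - U.im) with hl
  have hure : Integrable (fun x => (u x).re) μ := hu.re
  have huim : Integrable (fun x => (u x).im) μ := hu.im
  have hli : Integrable l μ :=
    ((hure.sub (integrable_const _)).const_mul _).add ((huim.sub (integrable_const _)).const_mul _)
  have hl0 : ∫ x, l x ∂μ = 0 := by
    have r1 : ∫ x, (u x).re ∂μ = U.re := integral_re hu
    have r2 : ∫ x, (u x).im ∂μ = U.im := integral_im hu
    simp only [hl]
    have i1 : Integrable (fun x => U.re * ((u x).re - U.re)) μ :=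
      (hure.sub (integrable_const _)).const_mul _
    have i2 : Integrable (fun x => U.im * ((u x).im - U.im)) μ :=
      (huim.sub (integrable_const _)).const_mul _
    rw [integral_add i1 i2, integral_const_mul, integral_const_mul,
      integral_sub hure (integrable_const _), integral_sub huim (integrable_const _), r1, r2]
    simp
  set q : S → ℝ := fun x => ‖u x / N x - U / M‖ with hq
  have hid : ∀ x, bellmanB (u x) (V x) (Y x) = ‖U‖ ^ 2 / M + 2 / M * l x
      - ‖U‖ ^ 2 / M ^ 2 * (N x - M) + N x * q x ^ 2 := fun x => norm_sq_div_eq (hNp x) hMp _ _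
  have hA1 : 1 ≤ A := h1.trans hA
  have c1 : Integrable (fun x => ‖U‖ ^ 2 / M + 2 / M * l x) μ :=
    (integrable_const _).add (hli.const_mul _)
  have c2 : Integrable (fun x => ‖U‖ ^ 2 / M ^ 2 * (N x - M)) μ :=
    (hNi.sub (integrable_const _)).const_mul _
  have hq2 : Integrable (fun x => N x * q x ^ 2) μ := by
    have : (fun x => N x * q x ^ 2) = fun x => bellmanB (u x) (V x) (Y x)
        - ((‖U‖ ^ 2 / M + 2 / M * l x) - ‖U‖ ^ 2 / M ^ 2 * (N x - M)) := by
      ext x; rw [hid]; ring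
    rw [this]
    exact hB.sub (c1.sub c2)
  set P := ∫ x, N x * q x ^ 2 ∂μ with hP
  have hP0 : 0 ≤ P := integral_nonneg fun x => mul_nonneg (hNp x).le (sq_nonneg _)
  -- The drop of the Bellman function is the drop `Q` of `N`, with a factor, plus the quadratic
  -- remainder `P`.
  have hgap : ∫ x, bellmanB (u x) (V x) (Y x) ∂μ = ‖U‖ ^ 2 / M + ‖U‖ ^ 2 / M ^ 2 * Q + P := by
    have c3 : Integrable (fun x => ‖U‖ ^ 2 / M + 2 / M * l x - ‖U‖ ^ 2 / M ^ 2 * (N x - M)) μ :=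
      c1.sub c2
    simp_rw [hid]
    rw [integral_add c3 hq2, integral_sub c1 c2, integral_add (integrable_const _)
      (hli.const_mul _), integral_const_mul, integral_const_mul, hl0,
      integral_sub hNi (integrable_const _)]
    simp; ring
  have hq1e : ∀ x, N x * q x = ‖u x - U * (N x / M : ℝ)‖ := fun x => by
    have hne : (N x : ℂ) ≠ 0 := by exact_mod_cast (hNp x).ne'
    have hne' : (M : ℂ) ≠ 0 := by exact_mod_cast hMp.ne'
    have : u x - U * (N x / M : ℝ) = N x * (u x / N x - U / M) := by
      push_cast; field_simp
    rw [this, norm_mul, Complex.norm_real, Real.norm_eq_abs, abs_of_pos (hNp x)]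
  have hq1 : Integrable (fun x => N x * q x) μ := by
    simp_rw [hq1e]
    exact (hu.sub (((hNi.div_const M).ofReal (𝕜 := ℂ)).const_mul U)).norm
  have hCS := sq_integral_mul_le_weighted (fun x => (hNp x).le) hNi hq1 hq2
  set I1 := ∫ x, N x * q x ∂μ with hI1
  set I2 := ∫ x, |N x - M| ∂μ with hI2
  have hI10 : 0 ≤ I1 := integral_nonneg fun x => mul_nonneg (hNp x).le (norm_nonneg _)
  have hI20 : 0 ≤ I2 := integral_nonneg fun x => abs_nonneg _
  have hMY : M ≤ Y0 := bellmanN_le hV0 hY0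
  -- The oscillation splits as `u - U = (u - U N / M) + U (N - M) / M`; the first part is controlled
  -- by `P` and the second by `Q`.
  have hD : ∫ x, ‖u x - U‖ ∂μ ≤ I1 + ‖U‖ / M * I2 := by
    have i2 : Integrable (fun x => ‖U‖ / M * |N x - M|) μ :=
      (hNi.sub (integrable_const _)).abs.const_mul _
    rw [hI1, hI2, ← integral_const_mul, ← integral_add hq1 i2]
    refine integral_mono (hu.sub (integrable_const _)).norm (hq1.add i2) fun x => ?_
    have hne' : (M : ℂ) ≠ 0 := by exact_mod_cast hMp.ne'
    have e1 : u x - U = (u x - U * (N x / M : ℝ)) + U * ((N x - M) / M : ℝ) := by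
      push_cast; field_simp; ring
    have := norm_add_le (u x - U * (N x / M : ℝ)) (U * ((N x - M) / M : ℝ))
    rw [← e1, ← hq1e, norm_mul, Complex.norm_real, Real.norm_eq_abs, abs_div,
      abs_of_pos hMp] at this
    simp only []
    calc _ ≤ _ := this
      _ = _ := by ring
  have hD0 : 0 ≤ ∫ x, ‖u x - U‖ ∂μ := integral_nonneg fun x => norm_nonneg _
  have hI1' : I1 ^ 2 ≤ Y0 * P := by
    refine hCS.trans (mul_le_mul_of_nonneg_right ?_ hP0)
    linarith
  have hZ : (‖U‖ / M * I2) ^ 2 ≤ 69 * A ^ 2 * Y0 * (‖U‖ ^ 2 / M ^ 2 * Q) := by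
    rw [mul_pow, div_pow]
    calc ‖U‖ ^ 2 / M ^ 2 * I2 ^ 2 ≤ ‖U‖ ^ 2 / M ^ 2 * (69 * A ^ 2 * Y0 * Q) := by gcongr
      _ = _ := by ring
  rw [hgap, bellmanB, ← hM]
  have := mul_sq_le_of_gap_bounds hD0 hD hI1' hZ hA1 hY0 hV0 hA hP0 (by positivity)
  linarith
end OneStep

/-! ### Averages over balls -/

open Metric

variable {m : ℕ}

/-- The uniform probability measure on the ball of radius `ρ` around the origin. -/
def unifBall (m : ℕ) (ρ : ℝ) : Measure (E m) :=
  (volume (ball (0 : E m) ρ))⁻¹ • volume.restrict (ball 0 ρ)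

lemma isProbabilityMeasure_unifBall {ρ : ℝ} (hρ : 0 < ρ) :
    IsProbabilityMeasure (unifBall m ρ) := by
  refine ⟨?_⟩
  rw [unifBall, Measure.smul_apply, Measure.restrict_apply_univ, smul_eq_mul]
  exact ENNReal.inv_mul_cancel (measure_ball_pos _ _ hρ).ne' measure_ball_lt_top.ne

instance : SFinite (unifBall m ρ) := by unfold unifBall; infer_instance

lemma volume_ball_eq (x : E m) {r : ℝ} (hr : 0 < r) :
    volume (ball x r) = ENNReal.ofReal (r ^ m) * volume (ball (0 : E m) 1) := by
  rw [Measure.addHaar_ball_of_pos _ _ hr]; simp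

lemma volume_ball_mul (x y : E m) {a r : ℝ} (ha : 0 < a) (hr : 0 < r) :
    volume (ball x (a * r)) = ENNReal.ofReal (a ^ m) * volume (ball y r) := by
  rw [volume_ball_eq _ (mul_pos ha hr), volume_ball_eq _ hr, mul_pow,
    ENNReal.ofReal_mul (by positivity), mul_assoc]

lemma lintegral_unifBall (ρ : ℝ) (g : E m → ℝ≥0∞) (x : E m) :
    ∫⁻ s, g (x + s) ∂unifBall m ρ = (volume (ball (0 : E m) ρ))⁻¹ * ∫⁻ y in ball x ρ, g y := by
  rw [unifBall, lintegral_smul_measure, smul_eq_mul]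
  congr 1
  rw [← lintegral_indicator measurableSet_ball, ← lintegral_indicator measurableSet_ball,
    ← lintegral_add_left_eq_self (μ := volume) ((ball x ρ).indicator g) x]
  congr 1; ext s
  simp only [indicator, mem_ball, dist_eq_norm, add_sub_cancel_left, sub_zero]

lemma integral_unifBall_neg {F : Type*} [NormedAddCommGroup F] [NormedSpace ℝ F] (ρ : ℝ)
    (g : E m → F) : ∫ s, g (-s) ∂unifBall m ρ = ∫ s, g s ∂unifBall m ρ := by
  rw [unifBall, integral_smul_measure, integral_smul_measure]
  congr 1
  rw [← integral_indicator measurableSet_ball, ← integral_indicator measurableSet_ball,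
    ← integral_neg_eq_self]
  congr 1; ext s
  simp only [indicator, mem_ball, dist_zero_right, norm_neg, neg_neg]

lemma ae_unifBall_mem (ρ : ℝ) : ∀ᵐ s ∂unifBall m ρ, s ∈ ball (0 : E m) ρ := by
  refine Measure.ae_smul_measure (ae_restrict_mem measurableSet_ball) _

lemma lintegral_lintegral_unifBall {ρ : ℝ} (hρ : 0 < ρ) {g : E m → ℝ≥0∞} (hg : Measurable g) :
    ∫⁻ x, ∫⁻ s, g (x + s) ∂unifBall m ρ = ∫⁻ x, g x := by
  have := isProbabilityMeasure_unifBall (m := m) hρ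
  rw [lintegral_lintegral_swap (by fun_prop)]
  simp_rw [lintegral_add_right_eq_self]
  simp

/-- Averaging over balls of radius `ρ` moves mass by at most `ρ`. -/
lemma setLIntegral_lintegral_unifBall_le {ρ : ℝ} (hρ : 0 < ρ) {g : E m → ℝ≥0∞}
    (hg : Measurable g) (x : E m) (R : ℝ) :
    ∫⁻ y in ball x R, ∫⁻ s, g (y + s) ∂unifBall m ρ ≤ ∫⁻ y in ball x (R + ρ), g y := by
  have := isProbabilityMeasure_unifBall (m := m) hρ
  rw [← lintegral_indicator measurableSet_ball, ← lintegral_indicator measurableSet_ball,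
    ← lintegral_lintegral_unifBall hρ (hg.indicator measurableSet_ball)]
  refine lintegral_mono fun y => ?_
  by_cases hy : y ∈ ball x R
  · rw [indicator_of_mem hy]
    refine lintegral_mono_ae ?_
    filter_upwards [ae_unifBall_mem ρ] with s hs
    rw [indicator_of_mem]
    rw [mem_ball, dist_eq_norm] at *
    rw [sub_zero] at hs
    calc ‖y + s - x‖ = ‖(y - x) + s‖ := by congr 1; abel
      _ ≤ ‖y - x‖ + ‖s‖ := norm_add_le _ _
      _ < R + ρ := by linarith
  · rw [indicator_of_notMem hy]; exact zero_le

/-- The average of a function over balls of radius `ρ`. -/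
def avg {F : Type*} [NormedAddCommGroup F] [NormedSpace ℝ F] (ρ : ℝ) (g : E m → F) (x : E m) : F :=
  ∫ s, g (x + s) ∂unifBall m ρ

lemma measurable_avg_real {ρ : ℝ} {g : E m → ℝ} (hg : Measurable g) : Measurable (avg ρ g) := by
  have : StronglyMeasurable (fun p : E m × E m => g (p.1 + p.2)) :=
    (hg.comp (by fun_prop)).stronglyMeasurable
  exact this.integral_prod_right.measurable

lemma measurable_avg {ρ : ℝ} {g : E m → ℂ} (hg : Measurable g) : Measurable (avg ρ g) := by
  have : StronglyMeasurable (fun p : E m × E m => g (p.1 + p.2)) :=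
    (hg.comp (by fun_prop)).stronglyMeasurable
  exact this.integral_prod_right.measurable

lemma norm_avg_le {ρ : ℝ} (hρ : 0 < ρ) {g : E m → ℂ} {D : ℝ} (hD : ∀ x, ‖g x‖ ≤ D) (x : E m) :
    ‖avg ρ g x‖ ≤ D := by
  have := isProbabilityMeasure_unifBall (m := m) hρ
  simpa [avg] using norm_integral_le_of_norm_le_const (μ := unifBall m ρ)
    (ae_of_all _ fun s => hD (x + s))

/-- A strictly positive, measurable, locally integrable function. -/
structure IsWeight (g : E m → ℝ) : Prop where
  measurable : Measurable g
  pos : ∀ x, 0 < g x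
  lt_top : ∀ x R, ∫⁻ y in ball x R, ENNReal.ofReal (g y) < ∞

lemma IsWeight.lintegral_lt_top {g : E m → ℝ} (hg : IsWeight g) {ρ : ℝ} (hρ : 0 < ρ) (x : E m) :
    ∫⁻ s, ENNReal.ofReal (g (x + s)) ∂unifBall m ρ < ∞ := by
  rw [lintegral_unifBall ρ (fun y => ENNReal.ofReal (g y))]
  exact ENNReal.mul_lt_top (ENNReal.inv_lt_top.2 (measure_ball_pos _ _ hρ)) (hg.lt_top x ρ)

lemma IsWeight.integrable {g : E m → ℝ} (hg : IsWeight g) {ρ : ℝ} (hρ : 0 < ρ) (x : E m) :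
    Integrable (fun s => g (x + s)) (unifBall m ρ) := by
  refine ⟨(hg.measurable.comp (by fun_prop)).aestronglyMeasurable, ?_⟩
  rw [hasFiniteIntegral_iff_ofReal (ae_of_all _ fun s => (hg.pos _).le)]
  exact hg.lintegral_lt_top hρ x

lemma IsWeight.ofReal_avg {g : E m → ℝ} (hg : IsWeight g) {ρ : ℝ} (hρ : 0 < ρ) (x : E m) :
    ENNReal.ofReal (avg ρ g x) = ∫⁻ s, ENNReal.ofReal (g (x + s)) ∂unifBall m ρ :=
  ofReal_integral_eq_lintegral_ofReal (hg.integrable hρ x) (ae_of_all _ fun _ => (hg.pos _).le)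

lemma IsWeight.avg_pos {g : E m → ℝ} (hg : IsWeight g) {ρ : ℝ} (hρ : 0 < ρ) (x : E m) :
    0 < avg ρ g x := by
  have := isProbabilityMeasure_unifBall (m := m) hρ
  refine (integral_pos_iff_support_of_nonneg (fun s => (hg.pos _).le) (hg.integrable hρ x)).2 ?_
  have : Function.support (fun s => g (x + s)) = univ := by
    ext s; simp [(hg.pos (x + s)).ne']
  rw [this]; simp

lemma IsWeight.setLIntegral_avg_le {g : E m → ℝ} (hg : IsWeight g) {ρ : ℝ} (hρ : 0 < ρ) (x : E m)
    (R : ℝ) : ∫⁻ y in ball x R, ENNReal.ofReal (avg ρ g y)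
      ≤ ∫⁻ y in ball x (R + ρ), ENNReal.ofReal (g y) := by
  simp_rw [hg.ofReal_avg hρ]
  exact setLIntegral_lintegral_unifBall_le hρ hg.measurable.ennreal_ofReal x R

lemma IsWeight.avg {g : E m → ℝ} (hg : IsWeight g) {ρ : ℝ} (hρ : 0 < ρ) : IsWeight (avg ρ g) :=
  ⟨measurable_avg_real hg.measurable, hg.avg_pos hρ,
    fun x R => (hg.setLIntegral_avg_le hρ x R).trans_lt (hg.lt_top _ _)⟩

lemma one_le_avg_mul_avg {V Y : E m → ℝ} (hV : IsWeight V) (hY : IsWeight Y)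
    (h : ∀ x, 1 ≤ V x * Y x) {ρ : ℝ} (hρ : 0 < ρ) (x : E m) : 1 ≤ avg ρ V x * avg ρ Y x := by
  have := isProbabilityMeasure_unifBall (m := m) hρ
  have hle : ∀ y, (V y)⁻¹ ≤ Y y := fun y => by
    rw [inv_le_iff_one_le_mul₀' (hV.pos y)]; exact h y
  have hVi := hV.integrable hρ x
  have hYi := hY.integrable hρ x
  have hm : Measurable fun s => (V (x + s))⁻¹ := (hV.measurable.comp (by fun_prop)).inv
  have hinv : Integrable (fun s => (V (x + s))⁻¹) (unifBall m ρ) :=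
    hYi.mono' hm.aestronglyMeasurable
      (ae_of_all _ fun s => by
        rw [Real.norm_eq_abs, abs_of_pos (inv_pos.2 (hV.pos _))]; exact hle _)
  have e1 : (fun s => V (x + s) * (V (x + s))⁻¹) = fun _ => (1 : ℝ) := by
    ext s; exact mul_inv_cancel₀ (hV.pos _).ne'
  have e2 : (fun s => V (x + s) * (V (x + s))⁻¹ ^ 2) = fun s => (V (x + s))⁻¹ := by
    ext s; have := (hV.pos (x + s)).ne'; field_simp
  -- Cauchy–Schwarz with the weight `V`: `1 = (⨍ V V⁻¹)² ≤ ⨍ V · ⨍ V⁻¹`.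
  have := sq_integral_mul_le_weighted (μ := unifBall m ρ) (w := fun s => V (x + s))
    (q := fun s => (V (x + s))⁻¹) (fun s => (hV.pos _).le) hVi (by rw [e1]; exact integrable_const _)
    (by rw [e2]; exact hinv)
  rw [e1, e2] at this
  simp only [integral_const, probReal_univ, smul_eq_mul, mul_one, one_pow] at this
  refine this.trans (mul_le_mul_of_nonneg_left ?_ (hV.avg_pos hρ x).le)
  exact integral_mono hinv hYi fun s => hle _

/-- The mean oscillation `⨍ |u - ⨍ u|` over the ball of radius `ρ` around `x`. -/
def osc (ρ : ℝ) (u : E m → ℂ) (x : E m) : ℝ := ∫ s, ‖u (x + s) - avg ρ u x‖ ∂unifBall m ρ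

lemma measurable_osc {ρ : ℝ} {u : E m → ℂ} (hu : Measurable u) : Measurable (osc ρ u) := by
  have h : Measurable (fun p : E m × E m => ‖u (p.1 + p.2) - avg ρ u p.1‖) :=
    ((hu.comp (by fun_prop)).sub ((measurable_avg hu).comp measurable_fst)).norm
  exact h.stronglyMeasurable.integral_prod_right.measurable

lemma osc_nonneg (ρ : ℝ) (u : E m → ℂ) (x : E m) : 0 ≤ osc ρ u x :=
  integral_nonneg fun _ => norm_nonneg _

lemma integrable_unifBall {ρ : ℝ} (hρ : 0 < ρ) {u : E m → ℂ} (hu : Measurable u) {D : ℝ}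
    (hD : ∀ x, ‖u x‖ ≤ D) (x : E m) : Integrable (fun s => u (x + s)) (unifBall m ρ) := by
  have := isProbabilityMeasure_unifBall (m := m) hρ
  exact (integrable_const D).mono' (hu.comp (by fun_prop)).aestronglyMeasurable
    (ae_of_all _ fun s => hD _)

lemma measurable_bellmanB {u : E m → ℂ} {V Y : E m → ℝ} (hu : Measurable u) (hV : Measurable V)
    (hY : Measurable Y) : Measurable fun x => bellmanB (u x) (V x) (Y x) := by
  unfold bellmanB bellmanN; fun_prop

/-- The Bellman functional `∫ |u|² / N(V, Y)`. -/
def bellmanInt (u : E m → ℂ) (V Y : E m → ℝ) : ℝ≥0∞ :=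
  ∫⁻ x, ENNReal.ofReal (bellmanB (u x) (V x) (Y x))

/-- Averaging decreases the Bellman functional, and the drop controls the weighted energy of the
oscillations: the one-step inequality on every ball, integrated over the centres. -/
lemma bellmanInt_avg_add_le {u : E m → ℂ} {V Y : E m → ℝ} (hu : Measurable u) {D : ℝ}
    (hD : ∀ x, ‖u x‖ ≤ D) (hV : IsWeight V) (hY : IsWeight Y) (h : ∀ x, 1 ≤ V x * Y x) {ρ : ℝ}
    (hρ : 0 < ρ) {A : ℝ} (hA : ∀ x, avg ρ V x * avg ρ Y x ≤ A) :
    bellmanInt (avg ρ u) (avg ρ V) (avg ρ Y) +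
      ENNReal.ofReal (1 / (138 * A ^ 3)) *
        ∫⁻ x, ENNReal.ofReal (avg ρ V x) * ENNReal.ofReal (osc ρ u x) ^ 2 ≤ bellmanInt u V Y := by
  have := isProbabilityMeasure_unifBall (m := m) hρ
  have hBm := (measurable_bellmanB hu hV.measurable hY.measurable).ennreal_ofReal
  have hBa := (measurable_bellmanB (measurable_avg (ρ := ρ) hu) (measurable_avg_real (ρ := ρ)
    hV.measurable) (measurable_avg_real (ρ := ρ) hY.measurable)).ennreal_ofReal
  rw [bellmanInt, bellmanInt, ← lintegral_const_mul' _ _ ENNReal.ofReal_ne_top,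
    ← lintegral_add_left hBa, ← lintegral_lintegral_unifBall hρ hBm]
  refine lintegral_mono fun x => ?_
  -- The one-step inequality needs an integrable Bellman function; otherwise the right-hand side is
  -- infinite.
  by_cases hfin : ∫⁻ s, ENNReal.ofReal (bellmanB (u (x + s)) (V (x + s)) (Y (x + s)))
      ∂unifBall m ρ = ∞
  · simp only [hfin]; exact le_top
  have hBnn : ∀ y, 0 ≤ bellmanB (u y) (V y) (Y y) := fun y =>
    div_nonneg (sq_nonneg _) (bellmanN_pos (hV.pos y) (hY.pos y) (h y)).le
  have hBi : Integrable (fun s => bellmanB (u (x + s)) (V (x + s)) (Y (x + s))) (unifBall m ρ) := by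
    refine ⟨((measurable_bellmanB hu hV.measurable hY.measurable).comp
      (by fun_prop : Measurable fun s => x + s)).aestronglyMeasurable, ?_⟩
    rw [hasFiniteIntegral_iff_ofReal (ae_of_all _ fun s => hBnn _)]
    exact lt_top_iff_ne_top.2 hfin
  have h1 := one_le_avg_mul_avg hV hY h hρ x
  have hA1 : 1 ≤ A := h1.trans (hA x)
  have key := bellmanB_integral_le (A := A) (integrable_unifBall hρ hu hD x) (hV.integrable hρ x)
    (hY.integrable hρ x) (fun s => hV.pos _) (fun s => hY.pos _) (fun s => h _) (hV.avg_pos hρ x)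
    (hY.avg_pos hρ x) h1 (hA x) hBi
  have p1 : 0 ≤ bellmanB (avg ρ u x) (avg ρ V x) (avg ρ Y x) :=
    div_nonneg (sq_nonneg _) (bellmanN_pos (hV.avg_pos hρ x) (hY.avg_pos hρ x) h1).le
  rw [← ofReal_integral_eq_lintegral_ofReal hBi (ae_of_all _ fun s => hBnn _),
    ← ENNReal.ofReal_pow (osc_nonneg _ _ _), ← ENNReal.ofReal_mul (hV.avg_pos hρ x).le,
    ← ENNReal.ofReal_mul (by positivity), ← ENNReal.ofReal_add p1]
  · exact ENNReal.ofReal_le_ofReal key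
  · have := (hV.avg_pos hρ x).le
    positivity

lemma bellmanInt_avg_le {u : E m → ℂ} {V Y : E m → ℝ} (hu : Measurable u) {D : ℝ}
    (hD : ∀ x, ‖u x‖ ≤ D) (hV : IsWeight V) (hY : IsWeight Y) (h : ∀ x, 1 ≤ V x * Y x) {ρ : ℝ}
    (hρ : 0 < ρ) {A : ℝ} (hA : ∀ x, avg ρ V x * avg ρ Y x ≤ A) :
    bellmanInt (avg ρ u) (avg ρ V) (avg ρ Y) ≤ bellmanInt u V Y :=
  le_self_add.trans (bellmanInt_avg_add_le hu hD hV hY h hρ hA)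

/-! ### The chain of averages and its energy -/

/-- Iterated double averages at the radii `ε`, `2 ε`, `4 ε`, …: the step from `j` to `j + 1`
averages twice over balls of radius `ε 2 ^ j`. -/
def chain {F : Type*} [NormedAddCommGroup F] [NormedSpace ℝ F] (ε : ℝ) (g : E m → F) : ℕ → E m → F
  | 0 => g
  | j + 1 => avg (ε * 2 ^ j) (avg (ε * 2 ^ j) (chain ε g j))

lemma measurable_chain (ε : ℝ) {f : E m → ℂ} (hf : Measurable f) (j : ℕ) :
    Measurable (chain ε f j) := by
  induction j with
  | zero => exact hf
  | succ j ih => exact measurable_avg (measurable_avg ih)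

lemma norm_chain_le {ε : ℝ} (hε : 0 < ε) {f : E m → ℂ} {D : ℝ} (hD : ∀ x, ‖f x‖ ≤ D) (j : ℕ)
    (x : E m) : ‖chain ε f j x‖ ≤ D := by
  induction j generalizing x with
  | zero => exact hD x
  | succ j ih => exact norm_avg_le (by positivity) (norm_avg_le (by positivity) ih) x

lemma IsWeight.chain {ε : ℝ} (hε : 0 < ε) {g : E m → ℝ} (hg : IsWeight g) (j : ℕ) :
    IsWeight (chain ε g j) := by
  induction j with
  | zero => exact hg
  | succ j ih => exact (ih.avg (by positivity)).avg (by positivity)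

lemma one_le_chain_mul_chain {ε : ℝ} (hε : 0 < ε) {V Y : E m → ℝ} (hV : IsWeight V)
    (hY : IsWeight Y) (h : ∀ x, 1 ≤ V x * Y x) (j : ℕ) (x : E m) :
    1 ≤ chain ε V j x * chain ε Y j x := by
  induction j generalizing x with
  | zero => exact h x
  | succ j ih =>
    have hp : 0 < ε * 2 ^ j := by positivity
    exact one_le_avg_mul_avg ((hV.chain hε j).avg hp) ((hY.chain hε j).avg hp)
      (one_le_avg_mul_avg (hV.chain hε j) (hY.chain hε j) ih hp) hp x

/-- Altogether, the first `j` double averages move mass by at most `2 (ε 2 ^ j)`. -/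
lemma IsWeight.setLIntegral_chain_le {ε : ℝ} (hε : 0 < ε) {g : E m → ℝ} (hg : IsWeight g) (j : ℕ)
    (x : E m) (R : ℝ) : ∫⁻ y in ball x R, ENNReal.ofReal (TwistedLP.chain ε g j y)
      ≤ ∫⁻ y in ball x (R + 2 * (ε * 2 ^ j)), ENNReal.ofReal (g y) := by
  -- The total displacement is exactly `2 ε (1 + 2 + ⋯ + 2 ^ (j - 1))`.
  suffices H : ∀ R, ∫⁻ y in ball x R, ENNReal.ofReal (TwistedLP.chain ε g j y)
      ≤ ∫⁻ y in ball x (R + 2 * (ε * (2 ^ j - 1))), ENNReal.ofReal (g y) by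
    refine (H R).trans (lintegral_mono_set (ball_subset_ball ?_))
    nlinarith
  induction j with
  | zero => intro R; simp [TwistedLP.chain]
  | succ j ih =>
    intro R
    have hp : 0 < ε * 2 ^ j := by positivity
    refine (((hg.chain hε j).avg hp).setLIntegral_avg_le hp x R).trans ?_
    refine ((hg.chain hε j).setLIntegral_avg_le hp x _).trans ?_
    refine (ih _).trans (le_of_eq ?_)
    congr 3
    ring

lemma IsWeight.setLIntegral_avg_chain_le {ε : ℝ} (hε : 0 < ε) {g : E m → ℝ} (hg : IsWeight g)
    (j : ℕ) (x : E m) (R : ℝ) :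
    ∫⁻ y in ball x R, ENNReal.ofReal (TwistedLP.avg (ε * 2 ^ j) (TwistedLP.chain ε g j) y)
      ≤ ∫⁻ y in ball x (R + 3 * (ε * 2 ^ j)), ENNReal.ofReal (g y) := by
  refine ((hg.chain hε j).setLIntegral_avg_le (by positivity) x R).trans ?_
  refine (hg.setLIntegral_chain_le hε j x _).trans (le_of_eq ?_)
  congr 3
  ring

/-- A Muckenhoupt `A₂` weight with constant `K`, normalized to be finite and positive everywhere. -/
structure IsA2 (w : E m → ℝ) (K : ℝ≥0) : Prop where
  measurable : Measurable w
  pos : ∀ x, 0 < w x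
  le : ∀ (x : E m) (r : ℝ), 0 < r →
    (∫⁻ y in ball x r, ENNReal.ofReal (w y)) * (∫⁻ y in ball x r, ENNReal.ofReal (w y)⁻¹)
      ≤ K * volume (ball x r) ^ 2

lemma setLIntegral_ofReal_pos {w : E m → ℝ} (hm : Measurable w) (hw : ∀ x, 0 < w x) (x : E m)
    {r : ℝ} (hr : 0 < r) : 0 < ∫⁻ y in ball x r, ENNReal.ofReal (w y) := by
  rw [setLIntegral_pos_iff hm.ennreal_ofReal]
  have : Function.support (fun y => ENNReal.ofReal (w y)) = univ := by
    ext y; simp [hw y]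
  rw [this, univ_inter]
  exact measure_ball_pos _ _ hr

lemma IsA2.inv {w : E m → ℝ} {K : ℝ≥0} (h : IsA2 w K) : IsA2 (fun x => (w x)⁻¹) K where
  measurable := h.measurable.inv
  pos x := inv_pos.2 (h.pos x)
  le x r hr := by
    simp only [inv_inv]; rw [mul_comm]; exact h.le x r hr

lemma IsA2.isWeight {w : E m → ℝ} {K : ℝ≥0} (h : IsA2 w K) : IsWeight w := by
  refine ⟨h.measurable, h.pos, fun x R => ?_⟩
  have hr : 0 < max R 1 := by positivity
  refine (lintegral_mono_set (ball_subset_ball (le_max_left R 1))).trans_lt ?_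
  have h2 := setLIntegral_ofReal_pos h.inv.measurable h.inv.pos x hr
  have h1 := h.le x _ hr
  by_contra hc
  rw [not_lt, top_le_iff] at hc
  rw [hc, ENNReal.top_mul h2.ne', top_le_iff] at h1
  exact (ENNReal.mul_ne_top (by simp) (ENNReal.pow_ne_top measure_ball_lt_top.ne)) h1

/-- The `A₂` condition passes to ball averages of functions that arise from the weight and its
inverse by moving mass over a distance comparable to the radius. -/
lemma IsA2.avg_mul_avg_le {w : E m → ℝ} {K : ℝ≥0} (h : IsA2 w K) {ρ c : ℝ} (hρ : 0 < ρ)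
    (hc : 0 < 1 + c) {V Y : E m → ℝ} (hV : IsWeight V) (hY : IsWeight Y)
    (hVw : ∀ x R, ∫⁻ y in ball x R, ENNReal.ofReal (V y)
      ≤ ∫⁻ y in ball x (R + c * ρ), ENNReal.ofReal (w y))
    (hYw : ∀ x R, ∫⁻ y in ball x R, ENNReal.ofReal (Y y)
      ≤ ∫⁻ y in ball x (R + c * ρ), ENNReal.ofReal (w y)⁻¹) (x : E m) :
    avg ρ V x * avg ρ Y x ≤ K * ((1 + c) ^ m) ^ 2 := by
  rw [← ENNReal.ofReal_le_ofReal_iff (by positivity), ENNReal.ofReal_mul (hV.avg_pos hρ x).le,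
    hV.ofReal_avg hρ, hY.ofReal_avg hρ, lintegral_unifBall _ (fun y => ENNReal.ofReal (V y)),
    lintegral_unifBall _ (fun y => ENNReal.ofReal (Y y))]
  set v := volume (ball (0 : E m) ρ) with hv
  have hv0 : v ≠ 0 := (measure_ball_pos _ _ hρ).ne'
  have hvt : v ≠ ∞ := measure_ball_lt_top.ne
  have hA := h.le x ((1 + c) * ρ) (by positivity)
  rw [volume_ball_mul x 0 hc hρ, ← hv] at hA
  have hVw' := hVw x ρ
  have hYw' := hYw x ρ
  rw [show ρ + c * ρ = (1 + c) * ρ by ring] at hVw' hYw'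
  calc _ ≤ v⁻¹ * (∫⁻ y in ball x ((1 + c) * ρ), ENNReal.ofReal (w y)) *
        (v⁻¹ * ∫⁻ y in ball x ((1 + c) * ρ), ENNReal.ofReal (w y)⁻¹) := by gcongr
    _ = v⁻¹ * v⁻¹ * ((∫⁻ y in ball x ((1 + c) * ρ), ENNReal.ofReal (w y)) *
        ∫⁻ y in ball x ((1 + c) * ρ), ENNReal.ofReal (w y)⁻¹) := by ring
    _ ≤ v⁻¹ * v⁻¹ * (K * (ENNReal.ofReal ((1 + c) ^ m) * v) ^ 2) := by gcongr
    _ = (v⁻¹ * v) * (v⁻¹ * v) * (K * ENNReal.ofReal ((1 + c) ^ m) ^ 2) := by ring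
    _ = K * ENNReal.ofReal ((1 + c) ^ m) ^ 2 := by rw [ENNReal.inv_mul_cancel hv0 hvt]; ring
    _ = ENNReal.ofReal (K * ((1 + c) ^ m) ^ 2) := by
      rw [ENNReal.ofReal_mul (by positivity), ← ENNReal.ofReal_pow (by positivity)]
      simp

/-- Along the chain the product of the averages of `w` and `w⁻¹` stays bounded, uniformly in the
scale. -/
lemma IsA2.avg_chain_mul_le {w : E m → ℝ} {K : ℝ≥0} (h : IsA2 w K) {ε : ℝ} (hε : 0 < ε) (j : ℕ)
    (x : E m) : avg (ε * 2 ^ j) (chain ε w j) x *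
      avg (ε * 2 ^ j) (chain ε (fun y => (w y)⁻¹) j) x ≤ K * (3 ^ m) ^ 2 := by
  have := h.avg_mul_avg_le (ρ := ε * 2 ^ j) (c := 2) (by positivity) (by norm_num)
    (h.isWeight.chain hε j) (h.inv.isWeight.chain hε j) (h.isWeight.setLIntegral_chain_le hε j)
    (h.inv.isWeight.setLIntegral_chain_le hε j) x
  norm_num at this ⊢
  exact this

/-- The energy of the oscillations along the chain, measured with the averaged weight, is
controlled by the weighted norm of the function. -/
theorem tsum_energy_le {w : E m → ℝ} {K : ℝ≥0} (h : IsA2 w K) {ε : ℝ} (hε : 0 < ε) {f : E m → ℂ}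
    (hf : Measurable f) {D : ℝ} (hD : ∀ x, ‖f x‖ ≤ D) :
    ∑' j, ∫⁻ x, ENNReal.ofReal (avg (ε * 2 ^ j) (chain ε w j) x) *
        ENNReal.ofReal (osc (ε * 2 ^ j) (chain ε f j) x) ^ 2
      ≤ ENNReal.ofReal (276 * (K * (3 ^ m) ^ 2) ^ 3) * ∫⁻ x, ‖f x‖ₑ ^ 2 * ENNReal.ofReal (w x) := by
  have hw := h.isWeight
  have hw' := h.inv.isWeight
  set Y : E m → ℝ := fun y => (w y)⁻¹ with hY
  have h1 : ∀ x, 1 ≤ w x * Y x := fun x => (mul_inv_cancel₀ (h.pos x).ne').ge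
  set A : ℝ := K * (3 ^ m) ^ 2 with hA
  have hA1 : 1 ≤ A := by
    have hp : 0 < ε * 2 ^ 0 := by positivity
    exact (one_le_avg_mul_avg (hw.chain hε 0) (hw'.chain hε 0)
      (one_le_chain_mul_chain hε hw hw' h1 0) hp 0).trans (h.avg_chain_mul_le hε 0 0)
  set a : ℕ → ℝ≥0∞ := fun j => ∫⁻ x, ENNReal.ofReal (avg (ε * 2 ^ j) (chain ε w j) x) *
        ENNReal.ofReal (osc (ε * 2 ^ j) (chain ε f j) x) ^ 2 with ha
  set c := ENNReal.ofReal (1 / (138 * A ^ 3)) with hc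
  -- Each double average is two averaging steps: the first one records the energy at scale `j`, and
  -- of the second one only the monotonicity is used.
  have key : ∀ n, bellmanInt (chain ε f n) (chain ε w n) (chain ε Y n) +
      c * ∑ j ∈ Finset.range n, a j ≤ bellmanInt f w Y := by
    intro n
    induction n with
    | zero => simp [chain]
    | succ n ih =>
      have hp : 0 < ε * 2 ^ n := by positivity
      have g1 := one_le_chain_mul_chain hε hw hw' h1 n
      have s1 := bellmanInt_avg_add_le (measurable_chain ε hf n) (norm_chain_le hε hD n)
        (hw.chain hε n) (hw'.chain hε n) g1 hp (h.avg_chain_mul_le hε n)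
      have V1 := (hw.chain hε n).avg hp
      have Y1 := (hw'.chain hε n).avg hp
      have g2 := one_le_avg_mul_avg (hw.chain hε n) (hw'.chain hε n) g1 hp
      have hfull : ∀ x, avg (ε * 2 ^ n) (avg (ε * 2 ^ n) (chain ε w n)) x *
          avg (ε * 2 ^ n) (avg (ε * 2 ^ n) (chain ε Y n)) x ≤ K * ((1 + 3) ^ m) ^ 2 :=
        h.avg_mul_avg_le hp (by norm_num) V1 Y1 (hw.setLIntegral_avg_chain_le hε n)
          (hw'.setLIntegral_avg_chain_le hε n)
      have s2 := bellmanInt_avg_le (measurable_avg (measurable_chain ε hf n))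
        (norm_avg_le hp (norm_chain_le hε hD n)) V1 Y1 g2 hp hfull
      rw [Finset.sum_range_succ, mul_add]
      calc _ ≤ bellmanInt (avg (ε * 2 ^ n) (chain ε f n)) (avg (ε * 2 ^ n) (chain ε w n))
              (avg (ε * 2 ^ n) (chain ε Y n)) + (c * ∑ j ∈ Finset.range n, a j + c * a n) := by
            gcongr; exact s2
        _ = (bellmanInt (avg (ε * 2 ^ n) (chain ε f n)) (avg (ε * 2 ^ n) (chain ε w n))
              (avg (ε * 2 ^ n) (chain ε Y n)) + c * a n) + c * ∑ j ∈ Finset.range n, a j := by ring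
        _ ≤ bellmanInt (chain ε f n) (chain ε w n) (chain ε Y n) +
              c * ∑ j ∈ Finset.range n, a j := by gcongr
        _ ≤ _ := ih
  -- At the start `N ≥ Y / 2 = 1 / (2 w)`.
  have hB0 : bellmanInt f w Y ≤ 2 * ∫⁻ x, ‖f x‖ₑ ^ 2 * ENNReal.ofReal (w x) := by
    rw [← lintegral_const_mul' _ _ (by simp)]
    refine lintegral_mono fun x => ?_
    have hN := half_le_bellmanN (h.pos x) (h.inv.pos x) (h1 x)
    have hp : 0 < (w x)⁻¹ := inv_pos.2 (h.pos x)
    have : bellmanB (f x) (w x) (Y x) ≤ 2 * (‖f x‖ ^ 2 * w x) := by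
      calc _ ≤ ‖f x‖ ^ 2 / (Y x / 2) := by
            unfold bellmanB; gcongr
        _ = _ := by simp only [hY]; field_simp
    refine (ENNReal.ofReal_le_ofReal this).trans (le_of_eq ?_)
    rw [ENNReal.ofReal_mul (by norm_num), ENNReal.ofReal_mul (by positivity),
      ENNReal.ofReal_pow (norm_nonneg _), ofReal_norm]
    simp
  have hcinv : ENNReal.ofReal (276 * A ^ 3) = c⁻¹ * 2 := by
    rw [hc, ← ENNReal.ofReal_inv_of_pos (by positivity), ← ENNReal.ofReal_ofNat,
      ← ENNReal.ofReal_mul (by positivity)]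
    congr 1; field_simp; norm_num
  have hc0 : c ≠ 0 := by rw [hc]; exact (ENNReal.ofReal_pos.2 (by positivity)).ne'
  rw [hcinv, mul_assoc, ENNReal.tsum_eq_iSup_nat]
  refine iSup_le fun n => ?_
  rw [← ENNReal.mul_le_iff_le_inv hc0 ENNReal.ofReal_ne_top]
  exact le_add_self.trans ((key n).trans hB0)

/-! ### Oscillation bounds for mean-zero bumps -/

lemma integrable_prod_add {ρ : ℝ} (hρ : 0 < ρ) {g : E m → ℂ} (hg : Integrable g) :
    Integrable (fun p : E m × E m => g (p.1 + p.2)) ((unifBall m ρ).prod volume) := by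
  have := isProbabilityMeasure_unifBall (m := m) hρ
  have h1 : Integrable (fun p : E m × E m => g p.2) ((unifBall m ρ).prod volume) := hg.comp_snd _
  exact (measurePreserving_prod_add (unifBall m ρ) (volume : Measure (E m))).integrable_comp_of_integrable h1

lemma integrable_avg {ρ : ℝ} (hρ : 0 < ρ) {g : E m → ℂ} (hg : Integrable g) :
    Integrable (avg ρ g) := by
  have := (integrable_prod_add hρ hg).integral_prod_right
  simpa only [add_comm] using! this

lemma integral_avg {ρ : ℝ} (hρ : 0 < ρ) {g : E m → ℂ} (hg : Integrable g) :
    ∫ z, avg ρ g z = ∫ z, g z := by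
  have := isProbabilityMeasure_unifBall (m := m) hρ
  have h := integral_integral_swap (f := fun s z => g (s + z)) (integrable_prod_add hρ hg)
  simp_rw [integral_add_left_eq_self] at h
  simp only [avg, add_comm _] at h ⊢
  rw [← h]; simp

/-- Averaging over balls is self-adjoint. -/
lemma integral_mul_avg {ρ : ℝ} (hρ : 0 < ρ) {ζ h : E m → ℂ} (hζ : Integrable ζ)
    (hh : Measurable h) {D : ℝ} (hD : ∀ x, ‖h x‖ ≤ D) :
    ∫ z, avg ρ ζ z * h z = ∫ z, ζ z * avg ρ h z := by
  have := isProbabilityMeasure_unifBall (m := m) hρ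
  have hi : Integrable (fun p : E m × E m => ζ (p.1 + p.2) * h p.2)
      ((unifBall m ρ).prod volume) :=
    (integrable_prod_add hρ hζ).mul_bdd (hh.comp measurable_snd).aestronglyMeasurable
      (ae_of_all _ fun p => hD p.2)
  have e1 : ∀ z, avg ρ ζ z * h z = ∫ s, ζ (s + z) * h z ∂unifBall m ρ := fun z => by
    rw [integral_mul_const, avg]; simp only [add_comm]
  have e2 : ∀ z, ζ z * avg ρ h z = ∫ s, ζ z * h (z - s) ∂unifBall m ρ := fun z => by
    rw [integral_const_mul, avg, ← integral_unifBall_neg]; simp only [sub_eq_add_neg]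
  have hi2 : Integrable (fun p : E m × E m => ζ p.2 * h (p.2 - p.1))
      ((unifBall m ρ).prod volume) :=
    (hζ.comp_snd (unifBall m ρ)).mul_bdd (hh.comp (by fun_prop)).aestronglyMeasurable
      (ae_of_all _ fun p => hD _)
  simp_rw [e1, e2]
  rw [← integral_integral_swap (f := fun s z => ζ (s + z) * h z) hi,
    ← integral_integral_swap (f := fun s z => ζ z * h (z - s)) hi2]
  congr 1; ext s
  rw [← integral_add_left_eq_self (fun z => ζ z * h (z - s)) s]
  simp

/-- A bump of mean zero, supported in the ball of radius `r` around `x`, bounded by `a` and with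
Lipschitz constant `a / r`. -/
structure IsBump (ζ : E m → ℂ) (x : E m) (a r : ℝ) : Prop where
  norm_sub_le : ∀ y z, ‖ζ y - ζ z‖ ≤ a / r * ‖y - z‖
  norm_le : ∀ y, ‖ζ y‖ ≤ a
  eq_zero : ∀ y, r ≤ ‖y - x‖ → ζ y = 0
  integral_eq_zero : ∫ y, ζ y = 0

lemma IsBump.continuous {ζ : E m → ℂ} {x : E m} {a r : ℝ} (h : IsBump ζ x a r) : Continuous ζ := by
  refine (LipschitzWith.of_dist_le_mul (K := (a / r).toNNReal) fun y z => ?_).continuous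
  rw [dist_eq_norm, dist_eq_norm]
  exact (h.norm_sub_le y z).trans (mul_le_mul_of_nonneg_right (Real.le_coe_toNNReal _)
    (norm_nonneg _))

lemma IsBump.integrable {ζ : E m → ℂ} {x : E m} {a r : ℝ} (h : IsBump ζ x a r) :
    Integrable ζ := by
  refine h.continuous.integrable_of_hasCompactSupport ?_
  refine HasCompactSupport.intro (isCompact_closedBall x r) fun y hy => h.eq_zero y ?_
  rw [mem_closedBall, dist_eq_norm, not_le] at hy
  exact hy.le

/-- The change of `∫ ζ u` under a double average of `u` is the integral of the local covariances of
`ζ` and `u`. -/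
lemma integral_mul_sub_integral_mul_avg_avg {ζ u : E m → ℂ} {ρ : ℝ} (hρ : 0 < ρ)
    (hζ : Integrable ζ) (hζc : Continuous ζ) (hu : Measurable u) {D : ℝ} (hD : ∀ x, ‖u x‖ ≤ D) {a : ℝ}
    (ha : ∀ y, ‖ζ y‖ ≤ a) :
    (∫ y, ζ y * u y) - ∫ y, ζ y * avg ρ (avg ρ u) y =
      ∫ z, ∫ s, (ζ (z + s) - ζ z) * (u (z + s) - avg ρ u z) ∂unifBall m ρ := by
  have := isProbabilityMeasure_unifBall (m := m) hρ
  have hζu : Integrable (fun y => ζ y * u y) :=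
    hζ.mul_bdd hu.aestronglyMeasurable (ae_of_all _ hD)
  have hDa := norm_avg_le hρ hD
  -- The local covariance is `⨍ ζ u - ⨍ ζ ⨍ u`, and one average of `u` can be moved onto `ζ`.
  have key : ∀ z, ∫ s, (ζ (z + s) - ζ z) * (u (z + s) - avg ρ u z) ∂unifBall m ρ
      = avg ρ (fun y => ζ y * u y) z - avg ρ ζ z * avg ρ u z := by
    intro z
    have iu : Integrable (fun s => u (z + s)) (unifBall m ρ) := integrable_unifBall hρ hu hD z
    have iζ : Integrable (fun s => ζ (z + s)) (unifBall m ρ) :=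
      integrable_unifBall hρ hζc.measurable ha z
    have iζu : Integrable (fun s => ζ (z + s) * u (z + s)) (unifBall m ρ) :=
      iζ.mul_bdd (hu.comp (by fun_prop)).aestronglyMeasurable (ae_of_all _ fun s => hD _)
    have e : (fun s => (ζ (z + s) - ζ z) * (u (z + s) - avg ρ u z)) = fun s =>
        ζ (z + s) * u (z + s) - ζ (z + s) * avg ρ u z - (ζ z * u (z + s) - ζ z * avg ρ u z) := by
      ext s; ring
    have i1 : Integrable (fun s => ζ (z + s) * avg ρ u z) (unifBall m ρ) := iζ.mul_const _
    have i2 : Integrable (fun s => ζ z * u (z + s)) (unifBall m ρ) := iu.const_mul _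
    have i3 : Integrable (fun s => ζ (z + s) * u (z + s) - ζ (z + s) * avg ρ u z)
      (unifBall m ρ) := iζu.sub i1
    have i4 : Integrable (fun s => ζ z * u (z + s) - ζ z * avg ρ u z) (unifBall m ρ) :=
      i2.sub (integrable_const _)
    rw [e, integral_sub i3 i4, integral_sub iζu i1, integral_sub i2 (integrable_const _),
      integral_mul_const, integral_const_mul]
    simp [avg]
  simp_rw [key]
  have i5 : Integrable (fun z => avg ρ ζ z * avg ρ u z) :=
    (integrable_avg hρ hζ).mul_bdd (measurable_avg hu).aestronglyMeasurable (ae_of_all _ hDa)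
  rw [integral_sub (integrable_avg hρ hζu) i5, integral_avg hρ hζu,
    integral_mul_avg hρ hζ (measurable_avg hu) hDa]

lemma ofReal_osc {ρ : ℝ} (hρ : 0 < ρ) {u : E m → ℂ} (hu : Measurable u) {D : ℝ}
    (hD : ∀ x, ‖u x‖ ≤ D) (x : E m) :
    ENNReal.ofReal (osc ρ u x) = ∫⁻ s, ‖u (x + s) - avg ρ u x‖ₑ ∂unifBall m ρ := by
  have := isProbabilityMeasure_unifBall (m := m) hρ
  rw [osc, ofReal_integral_norm_eq_lintegral_enorm]
  exact (integrable_unifBall hρ hu hD x).sub (integrable_const _)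

/-- Pairing a bump with the change of `u` under a double average costs the ratio of the two
scales. -/
lemma IsBump.enorm_integral_mul_sub_le {ζ u : E m → ℂ} {x : E m} {a r ρ : ℝ} (h : IsBump ζ x a r)
    (ha : 0 ≤ a) (hr : 0 < r) (hρ : 0 < ρ) (hu : Measurable u) {D : ℝ} (hD : ∀ x, ‖u x‖ ≤ D) :
    ‖(∫ y, ζ y * u y) - ∫ y, ζ y * avg ρ (avg ρ u) y‖ₑ ≤
      ENNReal.ofReal (a * (ρ / r)) * ∫⁻ z in ball x (r + ρ), ENNReal.ofReal (osc ρ u z) := by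
  rw [integral_mul_sub_integral_mul_avg_avg hρ h.integrable h.continuous hu hD h.norm_le,
    ← lintegral_const_mul' _ _ ENNReal.ofReal_ne_top, ← lintegral_indicator measurableSet_ball]
  refine (enorm_integral_le_lintegral_enorm _).trans (lintegral_mono fun z => ?_)
  by_cases hz : z ∈ ball x (r + ρ)
  · rw [indicator_of_mem hz, ofReal_osc hρ hu hD, ← lintegral_const_mul' _ _ ENNReal.ofReal_ne_top]
    refine (enorm_integral_le_lintegral_enorm _).trans (lintegral_mono_ae ?_)
    filter_upwards [ae_unifBall_mem ρ] with s hs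
    rw [enorm_mul]
    gcongr
    rw [← ofReal_norm]
    refine ENNReal.ofReal_le_ofReal ((h.norm_sub_le _ _).trans ?_)
    rw [mem_ball, dist_zero_right] at hs
    rw [add_sub_cancel_left]
    calc a / r * ‖s‖ ≤ a / r * ρ := by gcongr
      _ = _ := by ring
  · rw [indicator_of_notMem hz]
    simp only [nonpos_iff_eq_zero, enorm_eq_zero]
    refine integral_eq_zero_of_ae ?_
    filter_upwards [ae_unifBall_mem ρ] with s hs
    rw [mem_ball, dist_zero_right] at hs
    rw [mem_ball, dist_eq_norm, not_lt] at hz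
    have h1 : r ≤ ‖z + s - x‖ := by
      have := _root_.norm_sub_le (z + s - x) s
      rw [show z + s - x - s = z - x by abel] at this
      linarith
    have h2 : r ≤ ‖z - x‖ := by linarith
    simp only [h.eq_zero _ h1, h.eq_zero _ h2, Pi.zero_apply, sub_zero, zero_mul]

/-- Pairing a mean-zero bump with `u` is controlled by the oscillation of `u` at a larger scale. -/
lemma IsBump.enorm_integral_mul_le {ζ u : E m → ℂ} {x : E m} {a r ρ : ℝ} (h : IsBump ζ x a r)
    (hr : 0 < r) (hρ : 2 * r ≤ ρ) (hu : Measurable u) {D : ℝ} (hD : ∀ x, ‖u x‖ ≤ D) :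
    ‖∫ y, ζ y * u y‖ₑ ≤ ENNReal.ofReal (a * (ρ / r) ^ m) *
      ∫⁻ z in ball x r, ENNReal.ofReal (osc ρ u z) := by
  have hρ0 : 0 < ρ := by linarith
  have hpt : ∀ z ∈ ball x r, ‖∫ y, ζ y * u y‖ₑ ≤
      ENNReal.ofReal a * (volume (ball (0 : E m) ρ) * ENNReal.ofReal (osc ρ u z)) := by
    intro z hz
    have hζu : Integrable (fun y => ζ y * u y) :=
      h.integrable.mul_bdd hu.aestronglyMeasurable (ae_of_all _ hD)
    -- As `ζ` has mean zero, a constant can be subtracted from `u`.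
    have e : ∫ y, ζ y * u y = ∫ y, ζ y * (u y - avg ρ u z) := by
      simp_rw [mul_sub]
      rw [integral_sub hζu (h.integrable.mul_const _), integral_mul_const, h.integral_eq_zero]
      simp
    rw [e, ofReal_osc hρ0 hu hD, lintegral_unifBall _ (fun y => ‖u y - avg ρ u z‖ₑ),
      ← mul_assoc (volume _), ENNReal.mul_inv_cancel (measure_ball_pos _ _ hρ0).ne' measure_ball_lt_top.ne, one_mul,
      ← lintegral_const_mul' _ _ ENNReal.ofReal_ne_top, ← lintegral_indicator measurableSet_ball]
    refine (enorm_integral_le_lintegral_enorm _).trans (lintegral_mono fun y => ?_)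
    rw [enorm_mul]
    by_cases hy : y ∈ ball z ρ
    · rw [indicator_of_mem hy]
      gcongr
      rw [← ofReal_norm]
      exact ENNReal.ofReal_le_ofReal (h.norm_le y)
    · rw [h.eq_zero y]
      · simp
      · rw [mem_ball, dist_eq_norm, not_lt] at hy
        rw [mem_ball, dist_eq_norm] at hz
        have := norm_sub_le_norm_sub_add_norm_sub y x z
        rw [norm_sub_rev x z] at this
        linarith
  -- Average the pointwise bound over the ball of radius `r`.
  have hv : volume (ball x r) * ‖∫ y, ζ y * u y‖ₑ ≤ ∫⁻ z in ball x r,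
      ENNReal.ofReal a * (volume (ball (0 : E m) ρ) * ENNReal.ofReal (osc ρ u z)) := by
    calc _ = ∫⁻ z in ball x r, ‖∫ y, ζ y * u y‖ₑ := by rw [setLIntegral_const, mul_comm]
      _ ≤ _ := setLIntegral_mono' measurableSet_ball hpt
  rw [lintegral_const_mul' _ _ ENNReal.ofReal_ne_top,
    lintegral_const_mul' _ _ measure_ball_lt_top.ne] at hv
  have hvr : volume (ball (0 : E m) ρ) = ENNReal.ofReal ((ρ / r) ^ m) * volume (ball x r) := by
    rw [← volume_ball_mul 0 x (by positivity) hr, div_mul_cancel₀ _ hr.ne']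
  rw [hvr] at hv
  have hv0 : volume (ball x r) ≠ 0 := (measure_ball_pos _ _ hr).ne'
  have hvt : volume (ball x r) ≠ ∞ := measure_ball_lt_top.ne
  rw [← ENNReal.mul_le_mul_iff_right hv0 hvt]
  refine hv.trans (le_of_eq ?_)
  rw [ENNReal.ofReal_mul' (by positivity)]
  ring

/-- The sum of the oscillations along the chain up to scale `ε 2 ^ k`, weighted by the ratio of the
scales. -/
def oscSum (ε : ℝ) (f : E m → ℂ) (k : ℕ) (x : E m) : ℝ≥0∞ :=
  ∑ j ∈ Finset.range (k + 3), ENNReal.ofReal (2 ^ j / 2 ^ k) *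
    ((ENNReal.ofReal ((ε * 2 ^ k) ^ m))⁻¹ *
      ∫⁻ z in ball x (4 * (ε * 2 ^ k)), ENNReal.ofReal (osc (ε * 2 ^ j) (chain ε f j) z))

/-- The pairing of a bump at scale `r` with `f` is controlled by the oscillations along the chain, the
small scales carrying a geometrically decaying factor. -/
lemma IsBump.enorm_integral_le_oscSum {ζ f : E m → ℂ} {x : E m} {r ε : ℝ} {k : ℕ}
    (h : IsBump ζ x (r ^ m)⁻¹ r) (hε : 0 < ε) (hr1 : ε * 2 ^ k ≤ r) (hr2 : r ≤ 2 * (ε * 2 ^ k))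
    (hf : Measurable f) {D : ℝ} (hD : ∀ x, ‖f x‖ ≤ D) :
    ‖∫ y, ζ y * f y‖ₑ ≤ 4 ^ m * oscSum ε f k x := by
  have hk : 0 < ε * 2 ^ k := by positivity
  have hr : 0 < r := hk.trans_le hr1
  have ha : 0 ≤ (r ^ m)⁻¹ := by positivity
  have ha' : (r ^ m)⁻¹ ≤ ((ε * 2 ^ k) ^ m)⁻¹ := by gcongr
  -- Telescope along the chain up to the scale `ε 2 ^ (k + 2)`, which is at least `2 r`; there the
  -- mean-zero property is used.
  have tel : ∀ n, ‖∫ y, ζ y * f y‖ₑ ≤ ∑ j ∈ Finset.range n,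
      ‖(∫ y, ζ y * chain ε f j y) - ∫ y, ζ y * chain ε f (j + 1) y‖ₑ
        + ‖∫ y, ζ y * chain ε f n y‖ₑ := by
    intro n
    induction n with
    | zero => simp [chain]
    | succ n ih =>
      refine ih.trans ?_
      rw [Finset.sum_range_succ, add_assoc]
      gcongr
      have := enorm_add_le ((∫ y, ζ y * chain ε f n y) - ∫ y, ζ y * chain ε f (n + 1) y)
        (∫ y, ζ y * chain ε f (n + 1) y)
      rwa [sub_add_cancel] at this
  refine (tel (k + 2)).trans ?_
  rw [oscSum, Finset.sum_range_succ _ (k + 2), mul_add]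
  have four : (1 : ℝ≥0∞) ≤ 4 ^ m := one_le_pow_of_one_le' (by norm_num) m
  gcongr ?_ + ?_
  · rw [Finset.mul_sum]
    refine Finset.sum_le_sum fun j hj => ?_
    have hj' : j ≤ k + 1 := by rw [Finset.mem_range] at hj; omega
    have hjk : ε * 2 ^ j ≤ 2 * (ε * 2 ^ k) := by
      have : (2 : ℝ) ^ j ≤ 2 ^ (k + 1) := pow_le_pow_right₀ (by norm_num) hj'
      rw [pow_succ] at this
      nlinarith
    refine (h.enorm_integral_mul_sub_le ha hr (by positivity) (measurable_chain ε hf j)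
      (norm_chain_le hε hD j)).trans ?_
    refine le_trans ?_ (le_mul_of_one_le_left' four)
    rw [← ENNReal.ofReal_inv_of_pos (by positivity), ← mul_assoc,
      ← ENNReal.ofReal_mul (by positivity)]
    gcongr ENNReal.ofReal ?_ * ?_
    · have h9 : ε * 2 ^ j / r ≤ 2 ^ j / 2 ^ k := by
        rw [div_le_div_iff₀ hr (by positivity)]
        have : (0:ℝ) < 2 ^ j := by positivity
        nlinarith
      rw [mul_comm (2 ^ j / 2 ^ k : ℝ)]
      exact mul_le_mul ha' h9 (by positivity) (by positivity)
    · exact lintegral_mono_set (ball_subset_ball (by linarith))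
  · have hρ : ε * 2 ^ (k + 2) = 4 * (ε * 2 ^ k) := by rw [pow_add]; ring
    refine (h.enorm_integral_mul_le hr (ρ := ε * 2 ^ (k + 2)) (by linarith)
      (measurable_chain ε hf (k + 2)) (norm_chain_le hε hD (k + 2))).trans ?_
    have e4 : (2 : ℝ) ^ (k + 2) / 2 ^ k = 4 := by
      rw [pow_add]; field_simp; norm_num
    rw [e4, ← ENNReal.ofReal_inv_of_pos (by positivity), ← mul_assoc, ← mul_assoc,
      show (4 : ℝ≥0∞) ^ m = ENNReal.ofReal (4 ^ m) by
        rw [ENNReal.ofReal_pow (by norm_num)]; norm_num,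
      ← ENNReal.ofReal_mul (by positivity), ← ENNReal.ofReal_mul (by positivity)]
    gcongr ENNReal.ofReal ?_ * ?_
    · have h1 : (ε * 2 ^ (k + 2) / r) ^ m ≤ 4 ^ m := by
        refine pow_le_pow_left₀ (by positivity) ?_ m
        rw [div_le_iff₀ hr]; linarith
      have h0 : 0 ≤ ((ε * 2 ^ k) ^ m)⁻¹ := by positivity
      calc _ ≤ ((ε * 2 ^ k) ^ m)⁻¹ * 4 ^ m := by gcongr
        _ ≤ _ := by
          have : 0 ≤ ((ε * 2 ^ k) ^ m)⁻¹ * 4 ^ m := by positivity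
          nlinarith
    · exact lintegral_mono_set (ball_subset_ball (by linarith))

/-! ### The weighted square function estimate for one bump -/

/-- The Cauchy–Schwarz inequality, squared. -/
lemma sq_lintegral_mul_le {S : Type*} [MeasurableSpace S] (μ : Measure S) {f g : S → ℝ≥0∞}
    (hf : AEMeasurable f μ) (hg : AEMeasurable g μ) :
    (∫⁻ x, f x * g x ∂μ) ^ 2 ≤ (∫⁻ x, f x ^ 2 ∂μ) * ∫⁻ x, g x ^ 2 ∂μ := by
  have h := ENNReal.lintegral_mul_le_Lp_mul_Lq μ Real.HolderConjugate.two_two hf hg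
  have e : ∀ a : ℝ≥0∞, (a ^ (1 / 2 : ℝ)) ^ 2 = a := fun a => by
    rw [← ENNReal.rpow_natCast, ← ENNReal.rpow_mul]; norm_num
  calc _ ≤ _ := pow_le_pow_left' h 2
    _ = _ := by rw [mul_pow, e, e]; simp

lemma sq_lintegral_le_weighted {S : Type*} [MeasurableSpace S] (μ : Measure S) {g : S → ℝ≥0∞}
    (hg : Measurable g) {V : S → ℝ} (hV : Measurable V) (hp : ∀ x, 0 < V x) :
    (∫⁻ x, g x ∂μ) ^ 2 ≤
      (∫⁻ x, g x ^ 2 * ENNReal.ofReal (V x) ∂μ) * ∫⁻ x, ENNReal.ofReal (V x)⁻¹ ∂μ := by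
  have e0 : ∀ x, g x = (g x * ENNReal.ofReal √(V x)) * ENNReal.ofReal (√(V x))⁻¹ := fun x => by
    have : 0 < √(V x) := Real.sqrt_pos.2 (hp x)
    rw [mul_assoc, ← ENNReal.ofReal_mul this.le, mul_inv_cancel₀ this.ne']; simp
  have := sq_lintegral_mul_le μ (f := fun x => g x * ENNReal.ofReal √(V x))
    (g := fun x => ENNReal.ofReal (√(V x))⁻¹) (by fun_prop) (by fun_prop)
  simp_rw [← e0, mul_pow] at this
  refine this.trans (le_of_eq ?_)
  congr 1
  · congr 1; ext x
    rw [← ENNReal.ofReal_pow (Real.sqrt_nonneg _), Real.sq_sqrt (hp x).le]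
  · congr 1; ext x
    rw [← ENNReal.ofReal_pow (by positivity), inv_pow, Real.sq_sqrt (hp x).le]

lemma measurable_setLIntegral_ball {g : E m → ℝ≥0∞} (hg : Measurable g) (R : ℝ) :
    Measurable fun x => ∫⁻ z in ball x R, g z := by
  have hS : MeasurableSet {p : E m × E m | dist p.2 p.1 < R} :=
    measurableSet_lt (measurable_snd.dist measurable_fst) measurable_const
  have hm := ((hg.comp measurable_snd).indicator hS).lintegral_prod_right' (ν := volume)
  convert hm using 2 with x
  rw [← lintegral_indicator measurableSet_ball]
  rfl

/-- Averaging at scale `R` is bounded from `L²(V)` to `L²(w)` when `V` is an average of `w` at a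
scale at most comparable to `R`. -/
lemma IsA2.lintegral_sq_ball_average_le {w : E m → ℝ} {K : ℝ≥0} (h : IsA2 w K) {R : ℝ} (hR : 0 < R)
    {V Y : E m → ℝ} (hV : IsWeight V) (hVY : ∀ x, 1 ≤ V x * Y x)
    (hYw : ∀ x, ∫⁻ y in ball x (4 * R), ENNReal.ofReal (Y y)
      ≤ ∫⁻ y in ball x (16 * R), ENNReal.ofReal (w y)⁻¹) {g : E m → ℝ≥0∞} (hg : Measurable g) :
    ∫⁻ x, ((ENNReal.ofReal (R ^ m))⁻¹ * ∫⁻ z in ball x (4 * R), g z) ^ 2 * ENNReal.ofReal (w x) ≤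
      K * (ENNReal.ofReal (20 ^ m) * volume (ball (0 : E m) 1)) ^ 2 *
        ∫⁻ z, ENNReal.ofReal (V z) * g z ^ 2 := by
  set c := (ENNReal.ofReal (R ^ m))⁻¹ with hc
  have hRm : ENNReal.ofReal (R ^ m) ≠ 0 := by simp; positivity
  have hct : c ≠ ∞ := by rw [hc]; simp only [ne_eq, ENNReal.inv_eq_top]; exact hRm
  have hwm := h.measurable.ennreal_ofReal
  have hw'm := h.inv.measurable.ennreal_ofReal
  have hVm := hV.measurable.ennreal_ofReal
  set G : E m → ℝ≥0∞ := fun z => ENNReal.ofReal (V z) * g z ^ 2 with hG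
  have hGm : Measurable G := hVm.mul (hg.pow_const 2)
  have hpt : ∀ x, (c * ∫⁻ z in ball x (4 * R), g z) ^ 2 * ENNReal.ofReal (w x) ≤
      c ^ 2 * ∫⁻ z, (ball z (4 * R)).indicator (fun x => ENNReal.ofReal (w x) *
        (G z * ∫⁻ y in ball z (20 * R), ENNReal.ofReal (w y)⁻¹)) x := by
    intro x
    -- Cauchy–Schwarz with the weight `V`, where `V⁻¹ ≤ Y` is dominated by `w⁻¹` on a larger ball.
    have h1 := sq_lintegral_le_weighted (volume.restrict (ball x (4 * R))) hg hV.measurable hV.pos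
    have h2 : ∫⁻ z in ball x (4 * R), ENNReal.ofReal (V z)⁻¹ ≤
        ∫⁻ y in ball x (16 * R), ENNReal.ofReal (w y)⁻¹ := by
      refine le_trans (lintegral_mono fun z => ENNReal.ofReal_le_ofReal ?_) (hYw x)
      rw [inv_le_iff_one_le_mul₀' (hV.pos z)]; exact hVY z
    rw [mul_pow, mul_assoc]
    gcongr
    calc (∫⁻ z in ball x (4 * R), g z) ^ 2 * ENNReal.ofReal (w x)
        ≤ ((∫⁻ z in ball x (4 * R), g z ^ 2 * ENNReal.ofReal (V z)) *
          ∫⁻ y in ball x (16 * R), ENNReal.ofReal (w y)⁻¹) * ENNReal.ofReal (w x) := by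
            gcongr; exact h1.trans (by gcongr)
      _ = ∫⁻ z in ball x (4 * R), ENNReal.ofReal (w x) * (G z *
          ∫⁻ y in ball x (16 * R), ENNReal.ofReal (w y)⁻¹) := by
            rw [lintegral_const_mul' _ _ ENNReal.ofReal_ne_top, lintegral_mul_const _ hGm, mul_comm]
            simp only [hG, mul_comm]
      _ ≤ ∫⁻ z in ball x (4 * R), ENNReal.ofReal (w x) * (G z *
          ∫⁻ y in ball z (20 * R), ENNReal.ofReal (w y)⁻¹) := by
            refine setLIntegral_mono' measurableSet_ball fun z hz => ?_
            gcongr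
            refine ball_subset_ball' ?_
            rw [dist_comm]; rw [mem_ball] at hz; linarith
      _ = _ := by
            rw [← lintegral_indicator measurableSet_ball]
            congr 1; ext z
            simp only [indicator, mem_ball, dist_comm]
  refine (lintegral_mono hpt).trans ?_
  rw [lintegral_const_mul' _ _ (ENNReal.pow_ne_top hct)]
  have hIm : Measurable fun z => ∫⁻ y in ball z (20 * R), ENNReal.ofReal (w y)⁻¹ :=
    measurable_setLIntegral_ball hw'm _
  have hjm : Measurable (fun p : E m × E m => (ball p.2 (4 * R)).indicator
      (fun x => ENNReal.ofReal (w x) * (G p.2 *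
        ∫⁻ y in ball p.2 (20 * R), ENNReal.ofReal (w y)⁻¹)) p.1) := by
    have : (fun p : E m × E m => (ball p.2 (4 * R)).indicator
      (fun x => ENNReal.ofReal (w x) * (G p.2 *
        ∫⁻ y in ball p.2 (20 * R), ENNReal.ofReal (w y)⁻¹)) p.1) =
        {p : E m × E m | dist p.1 p.2 < 4 * R}.indicator (fun p => ENNReal.ofReal (w p.1) * (G p.2 *
        ∫⁻ y in ball p.2 (20 * R), ENNReal.ofReal (w y)⁻¹)) := by ext p; rfl
    rw [this]
    exact ((hwm.comp measurable_fst).mul ((hGm.comp measurable_snd).mul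
      (hIm.comp measurable_snd))).indicator
      (measurableSet_lt (measurable_fst.dist measurable_snd) measurable_const)
  -- After exchanging the integrals, the `A₂` condition on the ball of radius `20 R` applies.
  rw [lintegral_lintegral_swap hjm.aemeasurable]
  have hjm' : Measurable fun z => ∫⁻ x, (ball z (4 * R)).indicator
      (fun x => ENNReal.ofReal (w x) * (G z *
        ∫⁻ y in ball z (20 * R), ENNReal.ofReal (w y)⁻¹)) x := by
    exact (hjm.comp measurable_swap).lintegral_prod_right'
  rw [← lintegral_const_mul _ hjm', ← lintegral_const_mul _ hGm]
  refine lintegral_mono fun z => ?_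
  rw [lintegral_indicator measurableSet_ball, lintegral_mul_const _ hwm]
  have hA := h.le z (20 * R) (by positivity)
  rw [volume_ball_mul z 0 (by norm_num) hR, volume_ball_eq 0 hR] at hA
  have hc1 : c * ENNReal.ofReal (R ^ m) = 1 := ENNReal.inv_mul_cancel hRm ENNReal.ofReal_ne_top
  calc c ^ 2 * ((∫⁻ x in ball z (4 * R), ENNReal.ofReal (w x)) * (G z *
        ∫⁻ y in ball z (20 * R), ENNReal.ofReal (w y)⁻¹))
      ≤ c ^ 2 * ((∫⁻ x in ball z (20 * R), ENNReal.ofReal (w x)) * (G z *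
        ∫⁻ y in ball z (20 * R), ENNReal.ofReal (w y)⁻¹)) := by gcongr; norm_num
    _ = c ^ 2 * ((∫⁻ x in ball z (20 * R), ENNReal.ofReal (w x)) *
        ∫⁻ y in ball z (20 * R), ENNReal.ofReal (w y)⁻¹) * G z := by ring
    _ ≤ c ^ 2 * (K * (ENNReal.ofReal (20 ^ m) *
        (ENNReal.ofReal (R ^ m) * volume (ball (0 : E m) 1))) ^ 2) * G z := by gcongr
    _ = (c * ENNReal.ofReal (R ^ m)) ^ 2 *
        (K * (ENNReal.ofReal (20 ^ m) * volume (ball (0 : E m) 1)) ^ 2) * G z := by ring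
    _ = _ := by rw [hc1, one_pow, one_mul]

/-- The one-parameter convolution `f * φ_r`. -/
def smear (φ : E m → ℂ) (r : ℝ) (f : E m → ℂ) (x : E m) : ℂ := ∫ s, dilate φ r s * f (x - s)

lemma isBump_dilate {ψ : E m → ℂ} (hψ : IsBump ψ 0 1 1) {r : ℝ} (hr : 0 < r) (x : E m) :
    IsBump (fun y => dilate ψ r (x - y)) x (r ^ m)⁻¹ r where
  norm_sub_le y z := by
    rw [dilate, dilate, ← mul_sub, norm_mul, Complex.norm_real, Real.norm_eq_abs,
      abs_of_pos (by positivity), div_eq_mul_inv, mul_assoc]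
    gcongr
    refine (hψ.norm_sub_le _ _).trans (le_of_eq ?_)
    rw [← smul_sub, norm_smul, norm_inv, Real.norm_eq_abs, abs_of_pos hr, sub_sub_sub_cancel_left,
      norm_sub_rev]
    simp
  norm_le y := by
    rw [dilate, norm_mul, Complex.norm_real, Real.norm_eq_abs, abs_of_pos (by positivity)]
    exact mul_le_of_le_one_right (by positivity) (hψ.norm_le _)
  eq_zero y hy := by
    rw [dilate, hψ.eq_zero, mul_zero]
    rw [sub_zero, norm_smul, norm_inv, Real.norm_eq_abs, abs_of_pos hr, norm_sub_rev,
      inv_mul_eq_div, one_le_div hr]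
    exact hy
  integral_eq_zero := by
    simp only [dilate]
    rw [integral_const_mul, integral_sub_left_eq_self (fun y => ψ (r⁻¹ • y)),
      Measure.integral_comp_smul, hψ.integral_eq_zero]
    simp

lemma smear_eq (φ : E m → ℂ) (r : ℝ) (f : E m → ℂ) (x : E m) :
    smear φ r f x = ∫ y, dilate φ r (x - y) * f y := by
  rw [smear, ← integral_sub_left_eq_self _ volume x]
  simp

/-- Coefficients `2 ^ j / 2 ^ k` for `j < k + 3`, extended by zero. -/
def scaleCoeff (j k : ℕ) : ℝ≥0∞ := if j < k + 3 then ENNReal.ofReal (2 ^ j / 2 ^ k) else 0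

lemma scaleCoeff_succ (j k : ℕ) : scaleCoeff (j + 1) (k + 1) = scaleCoeff j k := by
  unfold scaleCoeff
  have : (j + 1 < k + 1 + 3) ↔ j < k + 3 := by omega
  simp only [this]
  congr 2
  rw [pow_succ, pow_succ, mul_div_mul_right _ _ (by norm_num)]

lemma tsum_scaleCoeff_left (k : ℕ) : ∑' j, scaleCoeff j k ≤ 8 := by
  rw [tsum_eq_sum (s := Finset.range (k + 3))
    (fun j hj => show scaleCoeff j k = 0 from if_neg (by simpa using hj))]
  have e : ∀ j ∈ Finset.range (k + 3), scaleCoeff j k = ENNReal.ofReal (2 ^ j / 2 ^ k) :=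
    fun j hj => if_pos (by simpa using hj)
  rw [Finset.sum_congr rfl e, ← ENNReal.ofReal_sum_of_nonneg (fun _ _ => by positivity),
    ← Finset.sum_div, geom_sum_eq (by norm_num), ← ENNReal.ofReal_ofNat]
  refine ENNReal.ofReal_le_ofReal ?_
  rw [div_le_iff₀ (by positivity), pow_add]
  norm_num
  nlinarith [(by positivity : (0:ℝ) < 2 ^ k)]

lemma tsum_scaleCoeff_right (j : ℕ) : ∑' k, scaleCoeff j k ≤ 8 := by
  have hstep : ∀ j, ∑' k, scaleCoeff (j + 1) k = scaleCoeff (j + 1) 0 + ∑' k, scaleCoeff j k := by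
    intro j
    rw [tsum_eq_zero_add' ENNReal.summable]
    simp_rw [scaleCoeff_succ]
  have h0 : ∑' k, scaleCoeff 0 k = 2 := by
    have : ∀ k, scaleCoeff 0 k = (2⁻¹ : ℝ≥0∞) ^ k := fun k => by
      rw [scaleCoeff, if_pos (by omega), pow_zero, one_div, ENNReal.ofReal_inv_of_pos (by positivity),
        ENNReal.ofReal_pow (by norm_num), ENNReal.inv_pow]
      norm_num
    simp_rw [this]
    rw [ENNReal.tsum_geometric, ENNReal.one_sub_inv_two, inv_inv]
  have h1 : ∑' k, scaleCoeff 1 k = 4 := by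
    rw [hstep 0, h0]; norm_num [scaleCoeff]
  have h2 : ∑' k, scaleCoeff 2 k = 8 := by
    rw [hstep 1, h1]; norm_num [scaleCoeff]
  have h3 : ∀ j, ∑' k, scaleCoeff (j + 2) k = 8 := by
    intro j
    induction j with
    | zero => exact h2
    | succ j ih => rw [show j + 1 + 2 = (j + 2) + 1 by ring, hstep, ih]; simp [scaleCoeff]
  match j with
  | 0 => rw [h0]; norm_num
  | 1 => rw [h1]; norm_num
  | j + 2 => exact (h3 j).le

/-- The Cauchy–Schwarz inequality for series with weights `c`. -/
lemma sq_tsum_mul_le (c T : ℕ → ℝ≥0∞) :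
    (∑' j, c j * T j) ^ 2 ≤ (∑' j, c j) * ∑' j, c j * T j ^ 2 := by
  have e : ∀ a : ℝ≥0∞, (a ^ (1 / 2 : ℝ)) * (a ^ (1 / 2 : ℝ)) = a := fun a => by
    rw [← ENNReal.rpow_add_of_nonneg _ _ (by norm_num) (by norm_num)]; norm_num
  have := sq_lintegral_mul_le (Measure.count : Measure ℕ) (f := fun j => c j ^ (1 / 2 : ℝ))
    (g := fun j => c j ^ (1 / 2 : ℝ) * T j) (measurable_of_countable _).aemeasurable
    (measurable_of_countable _).aemeasurable
  simp only [lintegral_count, mul_pow, ← mul_assoc, e] at this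
  simpa only [sq, e] using this

/-- The constant in the weighted square function estimate for a normalized bump. -/
def atomConst (m : ℕ) (K : ℝ≥0) : ℝ≥0∞ :=
  (4 ^ m) ^ 2 * 8 * 8 * (K * (ENNReal.ofReal (20 ^ m) * volume (ball (0 : E m) 1)) ^ 2) *
    ENNReal.ofReal (276 * (K * (3 ^ m) ^ 2) ^ 3)

lemma atomConst_lt_top (m : ℕ) (K : ℝ≥0) : atomConst m K < ∞ := by
  have hv : volume (ball (0 : E m) 1) < ∞ := measure_ball_lt_top
  unfold atomConst
  have h4 : (4 : ℝ≥0∞) ^ m < ∞ := ENNReal.pow_lt_top (by simp)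
  refine ENNReal.mul_lt_top (ENNReal.mul_lt_top ?_ ?_) ENNReal.ofReal_lt_top
  · exact ENNReal.mul_lt_top (ENNReal.mul_lt_top (ENNReal.pow_lt_top h4) (by simp)) (by simp)
  · exact ENNReal.mul_lt_top (by simp)
      (ENNReal.pow_lt_top (ENNReal.mul_lt_top ENNReal.ofReal_lt_top hv))

lemma lintegral_Ico_inv_le {ρ : ℝ} (hρ : 0 < ρ) :
    ∫⁻ r in Ico ρ (2 * ρ), (ENNReal.ofReal r)⁻¹ ≤ 1 := by
  calc ∫⁻ r in Ico ρ (2 * ρ), (ENNReal.ofReal r)⁻¹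
      ≤ ∫⁻ _ in Ico ρ (2 * ρ), (ENNReal.ofReal ρ)⁻¹ := by
        refine setLIntegral_mono' measurableSet_Ico fun r hr => ?_
        rw [ENNReal.inv_le_inv]
        exact ENNReal.ofReal_le_ofReal hr.1
    _ = 1 := by
        rw [setLIntegral_const, Real.volume_Ico, show 2 * ρ - ρ = ρ by ring]
        exact ENNReal.inv_mul_cancel (by simpa using hρ) ENNReal.ofReal_ne_top

/-- Schur's test: the coefficients `scaleCoeff` have bounded row and column sums, so that the sums of
oscillations inherit the bound for the energy of the chain. -/
lemma IsA2.tsum_lintegral_oscSum_le {w : E m → ℝ} {K : ℝ≥0} (h : IsA2 w K) {ε : ℝ} (hε : 0 < ε)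
    {f : E m → ℂ} (hf : Measurable f) {D : ℝ} (hD : ∀ x, ‖f x‖ ≤ D) :
    ∑' k, ∫⁻ x, (4 ^ m * oscSum ε f k x) ^ 2 * ENNReal.ofReal (w x) ≤
      atomConst m K * ∫⁻ x, ‖f x‖ₑ ^ 2 * ENNReal.ofReal (w x) := by
  have hw := h.isWeight
  have hw' := h.inv.isWeight
  have h1 : ∀ x, 1 ≤ w x * (w x)⁻¹ := fun x => (mul_inv_cancel₀ (h.pos x).ne').ge
  set C := K * (ENNReal.ofReal (20 ^ m) * volume (ball (0 : E m) 1)) ^ 2 with hC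
  set g : ℕ → E m → ℝ≥0∞ := fun j z => ENNReal.ofReal (osc (ε * 2 ^ j) (chain ε f j) z) with hg
  have hgm : ∀ j, Measurable (g j) := fun j =>
    (measurable_osc (measurable_chain ε hf j)).ennreal_ofReal
  set T : ℕ → ℕ → E m → ℝ≥0∞ := fun k j x => (ENNReal.ofReal ((ε * 2 ^ k) ^ m))⁻¹ *
      ∫⁻ z in ball x (4 * (ε * 2 ^ k)), g j z with hT
  have hTm : ∀ k j, Measurable (T k j) := fun k j =>
    (measurable_setLIntegral_ball (hgm j) _).const_mul _
  set a : ℕ → ℝ≥0∞ := fun j => ∫⁻ x, ENNReal.ofReal (avg (ε * 2 ^ j) (chain ε w j) x) *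
    g j x ^ 2 with ha
  have hosc : ∀ k x, oscSum ε f k x = ∑' j, scaleCoeff j k * T k j x := by
    intro k x
    rw [tsum_eq_sum (s := Finset.range (k + 3)) (fun j hj => by
      rw [scaleCoeff, if_neg (by simpa using hj), zero_mul])]
    refine Finset.sum_congr rfl fun j hj => ?_
    rw [scaleCoeff, if_pos (by simpa using hj)]
  have havg : ∀ k j, scaleCoeff j k * ∫⁻ x, T k j x ^ 2 * ENNReal.ofReal (w x)
      ≤ scaleCoeff j k * (C * a j) := by
    intro k j
    by_cases hjk : j < k + 3
    · gcongr
      refine h.lintegral_sq_ball_average_le (by positivity) ((hw.chain hε j).avg (by positivity))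
        (one_le_avg_mul_avg (hw.chain hε j) (hw'.chain hε j) (one_le_chain_mul_chain hε hw hw' h1 j)
          (by positivity)) (fun x => ?_) (hgm j)
      refine (hw'.setLIntegral_avg_chain_le hε j x _).trans
        (lintegral_mono_set (ball_subset_ball ?_))
      have : (2 : ℝ) ^ j ≤ 2 ^ (k + 2) := pow_le_pow_right₀ (by norm_num) (by omega)
      rw [pow_add] at this
      nlinarith
    · rw [scaleCoeff, if_neg hjk]; simp
  have hk : ∀ k, ∫⁻ x, (4 ^ m * oscSum ε f k x) ^ 2 * ENNReal.ofReal (w x) ≤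
      (4 ^ m) ^ 2 * 8 * ∑' j, scaleCoeff j k * (C * a j) := by
    intro k
    calc _ ≤ ∫⁻ x, (4 ^ m) ^ 2 * 8 * ∑' j, scaleCoeff j k * (T k j x ^ 2 * ENNReal.ofReal (w x)) := by
          refine lintegral_mono fun x => ?_
          rw [mul_pow, hosc]
          calc _ ≤ (4 ^ m) ^ 2 * (8 * ∑' j, scaleCoeff j k * T k j x ^ 2) * ENNReal.ofReal (w x) := by
                gcongr
                exact (sq_tsum_mul_le _ _).trans (by gcongr; exact tsum_scaleCoeff_left k)
            _ = _ := by
                simp_rw [← mul_assoc]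
                rw [ENNReal.tsum_mul_right]; ring
      _ = (4 ^ m) ^ 2 * 8 * ∑' j, scaleCoeff j k * ∫⁻ x, T k j x ^ 2 * ENNReal.ofReal (w x) := by
          have hm1 : ∀ j, Measurable fun x => T k j x ^ 2 * ENNReal.ofReal (w x) := fun j =>
            ((hTm k j).pow_const 2).mul h.measurable.ennreal_ofReal
          rw [lintegral_const_mul _ (Measurable.tsum fun j => (hm1 j).const_mul _),
            lintegral_tsum fun j => ((hm1 j).const_mul _).aemeasurable]
          congr 2; ext j
          rw [lintegral_const_mul _ (hm1 j)]
      _ ≤ _ := by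
          gcongr (4 ^ m) ^ 2 * 8 * ?_
          exact ENNReal.tsum_le_tsum fun j => havg k j
  calc _ ≤ ∑' k, (4 ^ m) ^ 2 * 8 * ∑' j, scaleCoeff j k * (C * a j) := ENNReal.tsum_le_tsum hk
    _ = (4 ^ m) ^ 2 * 8 * ∑' j, (∑' k, scaleCoeff j k) * (C * a j) := by
        rw [ENNReal.tsum_mul_left, ENNReal.tsum_comm]
        simp_rw [ENNReal.tsum_mul_right]
    _ ≤ (4 ^ m) ^ 2 * 8 * ∑' j, 8 * (C * a j) := by
        gcongr with j
        exact tsum_scaleCoeff_right j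
    _ = (4 ^ m) ^ 2 * 8 * 8 * C * ∑' j, a j := by
        rw [ENNReal.tsum_mul_left, ENNReal.tsum_mul_left]; ring
    _ ≤ (4 ^ m) ^ 2 * 8 * 8 * C * (ENNReal.ofReal (276 * (K * (3 ^ m) ^ 2) ^ 3) *
          ∫⁻ x, ‖f x‖ₑ ^ 2 * ENNReal.ofReal (w x)) := by
        gcongr; exact tsum_energy_le h hε hf hD
    _ = _ := by rw [atomConst]; ring

/-- The weighted square function estimate for a normalized bump. -/
theorem IsA2.lintegral_smear_atom_le {w : E m → ℝ} {K : ℝ≥0} (h : IsA2 w K) {ψ : E m → ℂ}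
    (hψ : IsBump ψ 0 1 1) {f : E m → ℂ} (hf : Measurable f) {D : ℝ} (hD : ∀ x, ‖f x‖ ≤ D) :
    ∫⁻ r in Ioi (0 : ℝ), (∫⁻ x, ‖smear ψ r f x‖ₑ ^ 2 * ENNReal.ofReal (w x)) * (ENNReal.ofReal r)⁻¹
      ≤ atomConst m K * ∫⁻ x, ‖f x‖ₑ ^ 2 * ENNReal.ofReal (w x) := by
  -- The chain has a smallest radius `ε`; the half-line is exhausted by the intervals `[2⁻ⁿ, ∞)`.
  have hU : Ioi (0 : ℝ) = ⋃ n : ℕ, Ici ((2 : ℝ)⁻¹ ^ n) := by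
    ext r
    simp only [mem_Ioi, mem_iUnion, mem_Ici]
    constructor
    · intro hr
      obtain ⟨n, hn⟩ := exists_pow_lt_of_lt_one hr (by norm_num : (2 : ℝ)⁻¹ < 1)
      exact ⟨n, hn.le⟩
    · rintro ⟨n, hn⟩
      exact lt_of_lt_of_le (by positivity) hn
  have hmono : Monotone fun n : ℕ => Ici ((2 : ℝ)⁻¹ ^ n) := fun a b hab =>
    Ici_subset_Ici.2 (pow_le_pow_of_le_one (by norm_num) (by norm_num) hab)
  rw [hU, setLIntegral_iUnion_of_directed _ hmono.directed_le]
  refine iSup_le fun n => ?_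
  set ε : ℝ := (2 : ℝ)⁻¹ ^ n with hεd
  have hε : 0 < ε := by positivity
  -- Decompose into dyadic blocks of scales, each comparable to a radius of the chain.
  have hcov : Ici ε ⊆ ⋃ k : ℕ, Ico (ε * 2 ^ k) (2 * (ε * 2 ^ k)) := by
    intro r hr
    have h1 : 1 ≤ r / ε := (one_le_div hε).2 hr
    obtain ⟨k, hk1, hk2⟩ := exists_nat_pow_near h1 (by norm_num : (1 : ℝ) < 2)
    refine mem_iUnion.2 ⟨k, ?_, ?_⟩
    · rw [le_div_iff₀ hε] at hk1; linarith
    · rw [div_lt_iff₀ hε, pow_succ] at hk2; linarith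
  calc _ ≤ ∫⁻ r in ⋃ k : ℕ, Ico (ε * 2 ^ k) (2 * (ε * 2 ^ k)),
        (∫⁻ x, ‖smear ψ r f x‖ₑ ^ 2 * ENNReal.ofReal (w x)) * (ENNReal.ofReal r)⁻¹ :=
        lintegral_mono_set hcov
    _ ≤ ∑' k : ℕ, ∫⁻ r in Ico (ε * 2 ^ k) (2 * (ε * 2 ^ k)),
        (∫⁻ x, ‖smear ψ r f x‖ₑ ^ 2 * ENNReal.ofReal (w x)) * (ENNReal.ofReal r)⁻¹ :=
        lintegral_iUnion_le _ _
    _ ≤ ∑' k : ℕ, ∫⁻ x, (4 ^ m * oscSum ε f k x) ^ 2 * ENNReal.ofReal (w x) := by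
        refine ENNReal.tsum_le_tsum fun k => ?_
        have hk : 0 < ε * 2 ^ k := by positivity
        calc _ ≤ ∫⁻ r in Ico (ε * 2 ^ k) (2 * (ε * 2 ^ k)),
              (∫⁻ x, (4 ^ m * oscSum ε f k x) ^ 2 * ENNReal.ofReal (w x)) *
                (ENNReal.ofReal r)⁻¹ := by
              refine setLIntegral_mono' measurableSet_Ico fun r hr => ?_
              gcongr with x
              rw [smear_eq]
              exact (isBump_dilate hψ (hk.trans_le hr.1) x).enorm_integral_le_oscSum hε hr.1 hr.2.le
                hf hD
          _ = (∫⁻ x, (4 ^ m * oscSum ε f k x) ^ 2 * ENNReal.ofReal (w x)) *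
                ∫⁻ r in Ico (ε * 2 ^ k) (2 * (ε * 2 ^ k)), (ENNReal.ofReal r)⁻¹ := by
              rw [lintegral_const_mul _ (by fun_prop)]
          _ ≤ _ := mul_le_of_le_one_right' (lintegral_Ico_inv_le hk)
    _ ≤ _ := h.tsum_lintegral_oscSum_le hε hf hD

/-! ### Schwartz functions of mean zero as sums of dilated bumps -/

/-- A Lipschitz cutoff: `1` on the ball of radius `1 / 2` and `0` outside the unit ball. -/
def cutoff (x : E m) : ℝ := max 0 (min 1 (2 - 2 * ‖x‖))

lemma cutoff_nonneg (x : E m) : 0 ≤ cutoff x := le_max_left _ _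

lemma cutoff_le_one (x : E m) : cutoff x ≤ 1 := max_le (by norm_num) (min_le_left _ _)

lemma cutoff_eq_one {x : E m} (h : ‖x‖ ≤ 1 / 2) : cutoff x = 1 := by
  rw [cutoff, min_eq_left (by linarith)]; norm_num

lemma cutoff_eq_zero {x : E m} (h : 1 ≤ ‖x‖) : cutoff x = 0 := by
  rw [cutoff, max_eq_left]
  exact (min_le_right _ _).trans (by linarith)

lemma abs_cutoff_sub_le (x y : E m) : |cutoff x - cutoff y| ≤ 2 * ‖x - y‖ := by
  have h := abs_le.1 (abs_norm_sub_norm_le x y)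
  unfold cutoff
  have h0 := norm_nonneg (x - y)
  rw [abs_le]
  rcases max_cases 0 (min 1 (2 - 2 * ‖x‖)) with ⟨h1, _⟩ | ⟨h1, _⟩ <;>
  rcases max_cases 0 (min 1 (2 - 2 * ‖y‖)) with ⟨h2, _⟩ | ⟨h2, _⟩ <;>
  rcases min_cases 1 (2 - 2 * ‖x‖) with ⟨h3, _⟩ | ⟨h3, _⟩ <;>
  rcases min_cases 1 (2 - 2 * ‖y‖) with ⟨h4, _⟩ | ⟨h4, _⟩ <;>
  constructor <;> linarith

lemma continuous_cutoff : Continuous (cutoff : E m → ℝ) := by unfold cutoff; fun_prop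

lemma hasCompactSupport_of_eq_zero {F : Type*} [Zero F] {g : E m → F}
    (h : ∀ x, 1 ≤ ‖x‖ → g x = 0) : HasCompactSupport g :=
  HasCompactSupport.intro (isCompact_closedBall 0 1) fun x hx => h x (by
    rw [mem_closedBall, dist_zero_right, not_le] at hx; exact hx.le)

lemma integral_cutoff_pos : 0 < ∫ x : E m, cutoff x := by
  have hi : Integrable (cutoff : E m → ℝ) :=
    continuous_cutoff.integrable_of_hasCompactSupport
      (hasCompactSupport_of_eq_zero fun x hx => cutoff_eq_zero hx)
  refine (integral_pos_iff_support_of_nonneg cutoff_nonneg hi).2 ?_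
  refine (measure_ball_pos volume (0 : E m) (by norm_num : (0:ℝ) < 1 / 2)).trans_le
    (measure_mono fun x hx => ?_)
  rw [mem_ball, dist_zero_right] at hx
  rw [Function.mem_support, cutoff_eq_one hx.le]
  norm_num

/-- `g` is bounded by `c` and `c`-Lipschitz. -/
def LipBound (g : E m → ℂ) (c : ℝ) : Prop :=
  (∀ x, ‖g x‖ ≤ c) ∧ ∀ x y, ‖g x - g y‖ ≤ c * ‖x - y‖

lemma LipBound.add {g h : E m → ℂ} {c d : ℝ} (hg : LipBound g c) (hh : LipBound h d) :
    LipBound (fun x => g x + h x) (c + d) :=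
  ⟨fun x => (norm_add_le _ _).trans (add_le_add (hg.1 x) (hh.1 x)), fun x y => by
    rw [add_sub_add_comm, add_mul]
    exact (norm_add_le _ _).trans (add_le_add (hg.2 x y) (hh.2 x y))⟩

lemma LipBound.const_mul {g : E m → ℂ} {c : ℝ} (hg : LipBound g c) (a : ℂ) :
    LipBound (fun x => a * g x) (‖a‖ * c) :=
  ⟨fun x => by rw [norm_mul]; exact mul_le_mul_of_nonneg_left (hg.1 x) (norm_nonneg _), fun x y => by
    rw [← mul_sub, norm_mul, mul_assoc]
    exact mul_le_mul_of_nonneg_left (hg.2 x y) (norm_nonneg _)⟩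

lemma LipBound.mono {g : E m → ℂ} {c d : ℝ} (hg : LipBound g c) (h : c ≤ d) : LipBound g d :=
  ⟨fun x => (hg.1 x).trans h, fun x y => (hg.2 x y).trans (by gcongr)⟩

lemma lipBound_cutoff : LipBound (fun x : E m => (cutoff x : ℂ)) 2 :=
  ⟨fun x => by
    rw [Complex.norm_real, Real.norm_eq_abs, abs_of_nonneg (cutoff_nonneg x)]
    linarith [cutoff_le_one x], fun x y => by
    rw [← Complex.ofReal_sub, Complex.norm_real, Real.norm_eq_abs]; exact abs_cutoff_sub_le x y⟩

lemma lipBound_cutoff_two : LipBound (fun x : E m => (cutoff ((2:ℝ) • x) : ℂ)) 4 :=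
  ⟨fun x => (lipBound_cutoff.1 _).trans (by norm_num), fun x y => by
    refine (lipBound_cutoff.2 _ _).trans (le_of_eq ?_)
    rw [← smul_sub, norm_smul]; norm_num; ring⟩

lemma exists_bounds (φ : 𝓢(E m, ℂ)) (k : ℕ) : ∃ C : ℝ, 0 < C ∧
    (∀ x, ‖x‖ ^ k * ‖φ x‖ ≤ C) ∧ ∀ x, ‖x‖ ^ k * ‖fderiv ℝ φ x‖ ≤ C := by
  obtain ⟨C, hC, h0⟩ := φ.decay k 0
  obtain ⟨D, hD, h1⟩ := φ.decay k 1
  refine ⟨C + D, by positivity, fun x => ?_, fun x => ?_⟩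
  · have := h0 x
    rw [norm_iteratedFDeriv_zero] at this
    linarith
  · have := h1 x
    rw [norm_iteratedFDeriv_one] at this
    linarith

/-- A function that is small away from the origin, cut off to an annulus. -/
lemma lipBound_mul_annulus {P : E m → ℂ} {b : ℝ} (hb : 0 ≤ b) (hP : Differentiable ℝ P)
    (h0 : ∀ x, 1 / 8 ≤ ‖x‖ → ‖P x‖ ≤ b) (h1 : ∀ x, 1 / 8 ≤ ‖x‖ → ‖fderiv ℝ P x‖ ≤ b) :
    LipBound (fun x => P x * ((cutoff x : ℂ) - cutoff ((2:ℝ) • x))) (16 * b) := by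
  set η : E m → ℂ := fun x => (cutoff x : ℂ) - cutoff ((2:ℝ) • x) with hη
  have e0 : ∀ x, ‖x‖ ≤ 1 / 4 → η x = 0 := fun x hx => by
    simp only [hη]
    rw [cutoff_eq_one (by linarith), cutoff_eq_one, sub_self]
    rw [norm_smul]; norm_num; linarith
  have e1 : ∀ x, ‖η x‖ ≤ 1 := fun x => by
    simp only [hη]
    rw [← Complex.ofReal_sub, Complex.norm_real, Real.norm_eq_abs, abs_le]
    constructor <;> linarith [cutoff_nonneg x, cutoff_le_one x, cutoff_nonneg ((2:ℝ) • x),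
      cutoff_le_one ((2:ℝ) • x)]
  have e2 : ∀ x y, ‖η x - η y‖ ≤ 6 * ‖x - y‖ := fun x y => by
    have h1 := lipBound_cutoff.2 x y
    have h2 := lipBound_cutoff_two.2 x y
    have : η x - η y = ((cutoff x : ℂ) - cutoff y) -
        ((cutoff ((2:ℝ) • x) : ℂ) - cutoff ((2:ℝ) • y)) := by simp only [hη]; ring
    rw [this]
    refine (norm_sub_le _ _).trans ?_
    linarith
  have hB : ∀ x, ‖P x * η x‖ ≤ b := fun x => by
    rcases le_or_gt ‖x‖ (1 / 4) with hx | hx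
    · rw [e0 x hx]; simpa using hb
    · rw [norm_mul]
      have := h0 x (by linarith)
      nlinarith [e1 x, norm_nonneg (P x), norm_nonneg (η x)]
  refine ⟨fun x => (hB x).trans (by linarith), ?_⟩
  -- It suffices to treat `x` in the annulus, by symmetry.
  have hmain : ∀ x y, 1 / 4 < ‖x‖ → ‖P x * η x - P y * η y‖ ≤ 16 * b * ‖x - y‖ := by
    intro x y hx
    -- For distant points the size bound suffices; near points are joined by a segment on which `P`
    -- and its derivative are small.
    rcases le_or_gt (1 / 8) ‖x - y‖ with h | h
    · refine (norm_sub_le _ _).trans ?_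
      nlinarith [hB x, hB y]
    · have hz : ∀ z ∈ ball x (1 / 8), 1 / 8 ≤ ‖z‖ := fun z hz => by
        rw [mem_ball, dist_eq_norm] at hz
        have := norm_sub_norm_le x z
        rw [norm_sub_rev] at this
        linarith
      have hy : y ∈ ball x (1 / 8) := by rw [mem_ball, dist_eq_norm, norm_sub_rev]; exact h
      have hxx : x ∈ ball x (1 / 8) := mem_ball_self (by norm_num)
      have hd := (convex_ball x (1 / 8)).norm_image_sub_le_of_norm_fderiv_le
        (fun z _ => hP z) (fun z hzz => h1 z (hz z hzz)) hy hxx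
      have : P x * η x - P y * η y = (P x - P y) * η x + P y * (η x - η y) := by ring
      rw [this]
      refine (norm_add_le _ _).trans ?_
      rw [norm_mul, norm_mul]
      have t1 : ‖P x - P y‖ * ‖η x‖ ≤ b * ‖x - y‖ * 1 := by gcongr; exact e1 x
      have t2 : ‖P y‖ * ‖η x - η y‖ ≤ b * (6 * ‖x - y‖) := by
        gcongr
        · exact h0 y (hz y hy)
        · exact e2 x y
      nlinarith [norm_nonneg (x - y)]
  intro x y
  rcases le_or_gt ‖x‖ (1 / 4) with hx | hx
  · rcases le_or_gt ‖y‖ (1 / 4) with hy | hy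
    · show ‖P x * η x - P y * η y‖ ≤ _
      rw [e0 x hx, e0 y hy, mul_zero, mul_zero, sub_self, norm_zero]
      positivity
    · rw [norm_sub_rev, norm_sub_rev x y]; exact hmain y x hy
  · exact hmain x y hx

/-- The rescaling `2 ^ (i m) φ (2 ^ i x)`. -/
def rescale (φ : E m → ℂ) (i : ℕ) (x : E m) : ℂ := ((2 ^ (i * m) : ℝ) : ℂ) * φ ((2 ^ i : ℝ) • x)

/-- The mass of `φ` under the cutoff at scale `2 ^ i`. -/
def cutMass (φ : E m → ℂ) (i : ℕ) : ℂ := ∫ x, rescale φ i x * cutoff x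

/-- `φ` cut off at scale `2 ^ i`, corrected to have mean zero, and rescaled to the unit ball. -/
def cutPiece (φ : E m → ℂ) (i : ℕ) (x : E m) : ℂ :=
  rescale φ i x * cutoff x - cutMass φ i / (∫ y : E m, cutoff y : ℝ) * cutoff x

/-- The difference of consecutive `cutPiece`s, rescaled to the unit ball. -/
def bumpPiece (φ : E m → ℂ) : ℕ → E m → ℂ
  | 0 => cutPiece φ 0
  | i + 1 => fun x => cutPiece φ (i + 1) x - (2 ^ m : ℝ) * cutPiece φ i ((2 : ℝ) • x)

lemma continuous_rescale {φ : E m → ℂ} (hφ : Continuous φ) (i : ℕ) : Continuous (rescale φ i) := by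
  unfold rescale; fun_prop

lemma continuous_cutPiece {φ : E m → ℂ} (hφ : Continuous φ) (i : ℕ) :
    Continuous (cutPiece φ i) := by
  have := continuous_rescale hφ i
  have := continuous_cutoff (m := m)
  unfold cutPiece; fun_prop

lemma cutPiece_eq_zero (φ : E m → ℂ) (i : ℕ) {x : E m} (hx : 1 ≤ ‖x‖) : cutPiece φ i x = 0 := by
  simp [cutPiece, cutoff_eq_zero hx]

lemma integrable_cutPiece {φ : E m → ℂ} (hφ : Continuous φ) (i : ℕ) : Integrable (cutPiece φ i) :=
  (continuous_cutPiece hφ i).integrable_of_hasCompactSupport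
    (hasCompactSupport_of_eq_zero fun _ hx => cutPiece_eq_zero φ i hx)

lemma integral_cutPiece {φ : E m → ℂ} (hφ : Continuous φ) (i : ℕ) : ∫ x, cutPiece φ i x = 0 := by
  have h1 : Integrable fun x => rescale φ i x * cutoff x := by
    refine Continuous.integrable_of_hasCompactSupport ?_
      (hasCompactSupport_of_eq_zero fun x hx => by simp [cutoff_eq_zero hx])
    have := continuous_rescale hφ i
    have := continuous_cutoff (m := m)
    fun_prop
  have h2 : Integrable fun x : E m => (cutoff x : ℂ) := by
    refine Continuous.integrable_of_hasCompactSupport ?_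
      (hasCompactSupport_of_eq_zero fun x hx => by simp [cutoff_eq_zero hx])
    have := continuous_cutoff (m := m)
    fun_prop
  have h3 : ∫ x : E m, (cutoff x : ℂ) = (∫ x : E m, cutoff x : ℝ) := integral_ofReal
  have hk : ((∫ x : E m, cutoff x : ℝ) : ℂ) ≠ 0 := by exact_mod_cast integral_cutoff_pos.ne'
  unfold cutPiece
  rw [integral_sub h1 (h2.const_mul _), integral_const_mul, h3, cutMass]
  field_simp
  simp

lemma integral_bumpPiece {φ : E m → ℂ} (hφ : Continuous φ) (i : ℕ) : ∫ x, bumpPiece φ i x = 0 := by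
  cases i with
  | zero => exact integral_cutPiece hφ 0
  | succ i =>
    have h := (integrable_cutPiece hφ i).comp_smul (by norm_num : (2:ℝ) ≠ 0)
    simp only [bumpPiece]
    rw [integral_sub (integrable_cutPiece hφ _) (h.const_mul _), integral_const_mul,
      Measure.integral_comp_smul, integral_cutPiece hφ, integral_cutPiece hφ]
    simp

lemma bumpPiece_eq_zero (φ : E m → ℂ) (i : ℕ) {x : E m} (hx : 1 ≤ ‖x‖) : bumpPiece φ i x = 0 := by
  cases i with
  | zero => exact cutPiece_eq_zero φ 0 hx
  | succ i =>
    simp only [bumpPiece]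
    rw [cutPiece_eq_zero _ _ hx, cutPiece_eq_zero, mul_zero, sub_zero]
    rw [norm_smul]; norm_num; linarith

lemma rescale_two (φ : E m → ℂ) (i : ℕ) (x : E m) :
    ((2 ^ m : ℝ) : ℂ) * rescale φ i ((2:ℝ) • x) = rescale φ (i + 1) x := by
  simp only [rescale, smul_smul]
  rw [← mul_assoc, ← Complex.ofReal_mul, ← pow_add, ← pow_succ]
  congr 3; ring

/-- The sum telescopes to `φ` cut off at scale `2 ^ n` and corrected to have mean zero. -/
lemma sum_dilate_bumpPiece (φ : E m → ℂ) (n : ℕ) (x : E m) :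
    ∑ i ∈ Finset.range (n + 1), dilate (bumpPiece φ i) (2 ^ i) x =
      dilate (cutPiece φ n) (2 ^ n) x := by
  induction n with
  | zero => simp [bumpPiece]
  | succ n ih =>
    rw [Finset.sum_range_succ, ih]
    simp only [dilate, bumpPiece, smul_smul]
    have e : (2:ℝ) * (2 ^ (n + 1))⁻¹ = (2 ^ n)⁻¹ := by rw [pow_succ]; field_simp
    rw [e]
    have e2 : (((2 ^ (n + 1)) ^ m)⁻¹ : ℝ) * 2 ^ m = ((2 ^ n) ^ m)⁻¹ := by
      rw [pow_succ, mul_pow]; field_simp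
    rw [← e2]; push_cast; ring

lemma dilate_cutPiece (φ : E m → ℂ) (n : ℕ) (x : E m) :
    dilate (cutPiece φ n) (2 ^ n) x = φ x * cutoff ((2 ^ n : ℝ)⁻¹ • x) -
      (((2 ^ n) ^ m)⁻¹ : ℝ) * (cutMass φ n / (∫ y : E m, cutoff y : ℝ) *
        cutoff ((2 ^ n : ℝ)⁻¹ • x)) := by
  simp only [dilate, cutPiece, rescale, smul_smul]
  rw [mul_inv_cancel₀ (by positivity), one_smul, mul_sub]
  congr 1
  rw [← mul_assoc, ← mul_assoc, ← Complex.ofReal_mul, pow_mul, inv_mul_cancel₀ (by positivity)]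
  simp

/-- The mass under the cutoff is minus the mass of the tail, which is bounded by the first moment. -/
lemma norm_cutMass_le (φ : 𝓢(E m, ℂ)) (h : ∫ x, φ x = 0) (i : ℕ) :
    ‖cutMass φ i‖ ≤ 2 * (∫ x, ‖x‖ * ‖φ x‖) * (2 ^ i)⁻¹ := by
  have hi : Integrable fun x => ‖x‖ * ‖φ x‖ := by simpa using φ.integrable_pow_mul volume 1
  have h2 : (2:ℝ) ^ i ≠ 0 := by positivity
  have e : cutMass φ i = ∫ x, φ x * cutoff ((2 ^ i : ℝ)⁻¹ • x) := by
    have e1 : (fun x => rescale φ i x * cutoff x) = fun x => ((2 ^ (i * m) : ℝ) : ℂ) *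
        (fun y => φ y * cutoff ((2 ^ i : ℝ)⁻¹ • y)) ((2 ^ i : ℝ) • x) := by
      ext x; simp only [rescale, smul_smul, inv_mul_cancel₀ h2, one_smul]; ring
    rw [cutMass, e1, integral_const_mul,
      Measure.integral_comp_smul volume (fun y => φ y * (cutoff ((2 ^ i : ℝ)⁻¹ • y) : ℂ)) (2 ^ i : ℝ),
      finrank_euclideanSpace_fin,
      abs_of_pos (by positivity), ← pow_mul, Complex.real_smul, ← mul_assoc, ← Complex.ofReal_mul,
      mul_inv_cancel₀ (by positivity)]
    simp
  have hc : Integrable fun x => φ x * cutoff ((2 ^ i : ℝ)⁻¹ • x) := by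
    refine φ.integrable.mul_bdd (c := 2) ?_ (ae_of_all _ fun x => lipBound_cutoff.1 _)
    have := continuous_cutoff (m := m)
    exact Continuous.aestronglyMeasurable (by fun_prop)
  have e2 : cutMass φ i = ∫ x, -(φ x * (1 - cutoff ((2 ^ i : ℝ)⁻¹ • x))) := by
    have : (fun x => -(φ x * (1 - (cutoff ((2 ^ i : ℝ)⁻¹ • x) : ℂ)))) = fun x =>
      φ x * cutoff ((2 ^ i : ℝ)⁻¹ • x) - φ x := by ext x; ring
    rw [this, integral_sub hc φ.integrable, h, e, sub_zero]
  rw [e2, mul_right_comm, ← integral_const_mul]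
  refine norm_integral_le_of_norm_le (hi.const_mul _) (ae_of_all _ fun x => ?_)
  rw [norm_neg, norm_mul, ← Complex.ofReal_one, ← Complex.ofReal_sub, Complex.norm_real,
    Real.norm_eq_abs, abs_of_nonneg (by linarith [cutoff_le_one ((2 ^ i : ℝ)⁻¹ • x)])]
  have hn : ‖(2 ^ i : ℝ)⁻¹ • x‖ = (2 ^ i)⁻¹ * ‖x‖ := by
    rw [norm_smul, norm_inv, norm_pow]; norm_num
  have : 1 - cutoff ((2 ^ i : ℝ)⁻¹ • x) ≤ 2 * ((2 ^ i)⁻¹ * ‖x‖) := by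
    rcases le_or_gt ‖(2 ^ i : ℝ)⁻¹ • x‖ (1 / 2) with hx | hx
    · rw [cutoff_eq_one hx, sub_self]; positivity
    · rw [hn] at hx; linarith [cutoff_nonneg ((2 ^ i : ℝ)⁻¹ • x)]
  calc ‖φ x‖ * (1 - cutoff ((2 ^ i : ℝ)⁻¹ • x)) ≤ ‖φ x‖ * (2 * ((2 ^ i)⁻¹ * ‖x‖)) := by gcongr
    _ = _ := by ring

/-- By the decay of `φ`, its annular pieces, rescaled to the unit ball, decay geometrically. -/
lemma exists_lipBound_rescale (φ : 𝓢(E m, ℂ)) : ∃ C : ℝ, 0 ≤ C ∧ ∀ i, LipBound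
    (fun x => rescale φ i x * ((cutoff x : ℂ) - cutoff ((2:ℝ) • x))) (C * (2 ^ i)⁻¹) := by
  obtain ⟨C, hC, h0, h1⟩ := exists_bounds φ (m + 2)
  refine ⟨16 * (C * 8 ^ (m + 2)), by positivity, fun i => ?_⟩
  have hp : (0:ℝ) < 2 ^ i := by positivity
  have hone : (1:ℝ) ≤ 2 ^ i := one_le_pow₀ (by norm_num)
  rw [mul_assoc]
  have hsm : ∀ x : E m, 1 / 8 ≤ ‖x‖ → (2 ^ i / 8 : ℝ) ^ (m + 2) ≤ ‖(2 ^ i : ℝ) • x‖ ^ (m + 2) := by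
    intro x hx
    refine pow_le_pow_left₀ (by positivity) ?_ _
    rw [norm_smul, Real.norm_eq_abs, abs_of_pos hp]
    nlinarith
  have hC' : ∀ (x : E m) (t : ℝ), 0 ≤ t → 1 / 8 ≤ ‖x‖ → ‖(2 ^ i : ℝ) • x‖ ^ (m + 2) * t ≤ C →
      2 ^ (i * m) * (2 ^ i * t) ≤ C * 8 ^ (m + 2) * (2 ^ i)⁻¹ := by
    intro x t ht hx h
    have h3 : (2 ^ i / 8 : ℝ) ^ (m + 2) * t ≤ C :=
      (mul_le_mul_of_nonneg_right (hsm x hx) ht).trans h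
    rw [div_pow, div_mul_eq_mul_div, div_le_iff₀ (by positivity)] at h3
    rw [le_mul_inv_iff₀ hp]
    calc (2:ℝ) ^ (i * m) * (2 ^ i * t) * 2 ^ i = (2 ^ i) ^ (m + 2) * t := by
          rw [pow_mul, pow_add]; ring
      _ ≤ _ := h3
  have hdf : Differentiable ℝ (φ : E m → ℂ) := φ.differentiable
  have hder : ∀ x, HasFDerivAt (rescale φ i) (((2 ^ (i * m) : ℝ) : ℂ) •
      ((fderiv ℝ φ ((2 ^ i : ℝ) • x)).comp ((2 ^ i : ℝ) • ContinuousLinearMap.id ℝ (E m)))) x := by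
    intro x
    have h2 : HasFDerivAt (fun x : E m => (2 ^ i : ℝ) • x)
        ((2 ^ i : ℝ) • ContinuousLinearMap.id ℝ (E m)) x :=
      ((2 ^ i : ℝ) • ContinuousLinearMap.id ℝ (E m)).hasFDerivAt
    exact ((hdf _).hasFDerivAt.comp x h2).const_mul _
  refine lipBound_mul_annulus (by positivity) (fun x => (hder x).differentiableAt) ?_ ?_
  · intro x hx
    rw [rescale, norm_mul, Complex.norm_real, Real.norm_eq_abs, abs_of_pos (by positivity)]
    refine le_trans ?_ (hC' x _ (norm_nonneg _) hx (h0 _))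
    gcongr
    nlinarith [norm_nonneg (φ ((2 ^ i : ℝ) • x))]
  · intro x hx
    rw [(hder x).fderiv, norm_smul, Complex.norm_real, Real.norm_eq_abs, abs_of_pos (by positivity)]
    refine le_trans ?_ (hC' x _ (norm_nonneg _) hx (h1 _))
    gcongr
    rw [ContinuousLinearMap.comp_smul, ContinuousLinearMap.comp_id, norm_smul, Real.norm_eq_abs,
      abs_of_pos hp]

lemma exists_lipBound_bumpPiece (φ : 𝓢(E m, ℂ)) (h : ∫ x, φ x = 0) :
    ∃ C : ℝ, 0 < C ∧ ∀ i, LipBound (bumpPiece φ i) (C * (2 ^ i)⁻¹) := by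
  obtain ⟨A, hA, hA'⟩ := exists_lipBound_rescale φ
  obtain ⟨B, hB, hB0, hB1⟩ := exists_bounds φ 0
  simp only [pow_zero, one_mul] at hB0 hB1
  set κ : ℝ := ∫ y : E m, cutoff y with hκ
  have hκp : 0 < κ := integral_cutoff_pos
  set I : ℝ := ∫ x, ‖x‖ * ‖φ x‖ with hI
  have hI0 : 0 ≤ I := integral_nonneg fun x => by positivity
  have hmass := norm_cutMass_le φ h
  have hq : ∀ i, ‖cutMass φ i / (κ : ℂ)‖ ≤ 2 * I / κ * (2 ^ i)⁻¹ := fun i => by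
    rw [norm_div, Complex.norm_real, Real.norm_eq_abs, abs_of_pos hκp, div_le_iff₀ hκp]
    refine (hmass i).trans (le_of_eq ?_)
    rw [← hI]; field_simp
  set J := 2 * I / κ with hJ
  have hJ0 : 0 ≤ J := by positivity
  refine ⟨3 * B + A + 2 * J + 2 * (2 ^ m * J * 4), by positivity, fun i => ?_⟩
  cases i with
  | zero =>
    have hφl : LipBound (fun x => φ x * (cutoff x : ℂ)) (3 * B) := by
      refine ⟨fun x => ?_, fun x y => ?_⟩
      · rw [norm_mul, Complex.norm_real, Real.norm_eq_abs, abs_of_nonneg (cutoff_nonneg x)]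
        nlinarith [hB0 x, cutoff_le_one x, cutoff_nonneg x, norm_nonneg (φ x)]
      · have hd := (convex_univ : Convex ℝ (univ : Set (E m))).norm_image_sub_le_of_norm_fderiv_le
          (fun z _ => φ.differentiable z) (fun z _ => hB1 z) (mem_univ y) (mem_univ x)
        have : φ x * (cutoff x : ℂ) - φ y * cutoff y
            = (φ x - φ y) * cutoff x + φ y * ((cutoff x : ℂ) - cutoff y) := by ring
        rw [this]
        refine (norm_add_le _ _).trans ?_
        rw [norm_mul, norm_mul]
        have t1 : ‖φ x - φ y‖ * ‖(cutoff x : ℂ)‖ ≤ B * ‖x - y‖ * 1 := by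
          gcongr
          rw [Complex.norm_real, Real.norm_eq_abs, abs_of_nonneg (cutoff_nonneg x)]
          exact cutoff_le_one x
        have t2 : ‖φ y‖ * ‖(cutoff x : ℂ) - cutoff y‖ ≤ B * (2 * ‖x - y‖) := by
          gcongr
          · exact hB0 y
          · exact lipBound_cutoff.2 x y
        linarith
    have e : bumpPiece φ 0 = fun x => φ x * (cutoff x : ℂ) + (-(cutMass φ 0 / (κ : ℂ))) * cutoff x := by
      ext x; simp [bumpPiece, cutPiece, rescale, ← hκ]; ring
    rw [e]
    refine (hφl.add (lipBound_cutoff.const_mul _)).mono ?_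
    rw [norm_neg]
    have := hq 0
    simp only [pow_zero, inv_one, mul_one] at this ⊢
    have : 0 ≤ 2 ^ m * J * 4 := by positivity
    linarith
  | succ i =>
    -- The annular part of `φ` and two corrections of the mass, each of size `2⁻ⁱ`.
    have e : bumpPiece φ (i + 1) = fun x =>
        rescale φ (i + 1) x * ((cutoff x : ℂ) - cutoff ((2:ℝ) • x)) +
        ((-(cutMass φ (i + 1) / (κ : ℂ))) * cutoff x +
          ((2 ^ m : ℝ) * (cutMass φ i / (κ : ℂ))) * cutoff ((2:ℝ) • x)) := by
      ext x
      simp only [bumpPiece, cutPiece, mul_sub, ← hκ]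
      rw [← mul_assoc (((2:ℝ) ^ m : ℝ) : ℂ) (rescale φ i _), rescale_two]
      ring
    rw [e]
    refine ((hA' (i + 1)).add ((lipBound_cutoff.const_mul _).add
      (lipBound_cutoff_two.const_mul _))).mono ?_
    rw [norm_neg, norm_mul, Complex.norm_real, Real.norm_eq_abs,
      abs_of_pos (by positivity : (0:ℝ) < 2 ^ m)]
    have q1 := hq (i + 1)
    have q2 := hq i
    have e2 : ((2:ℝ) ^ i)⁻¹ = 2 * (2 ^ (i + 1))⁻¹ := by rw [pow_succ]; field_simp
    rw [e2] at q2
    have hp : 0 < ((2:ℝ) ^ (i + 1))⁻¹ := by positivity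
    have q3 : 2 ^ m * ‖cutMass φ i / (κ : ℂ)‖ * 4 ≤ 2 ^ m * (J * (2 * (2 ^ (i + 1))⁻¹)) * 4 := by
      gcongr
    have : 0 ≤ 3 * B * ((2:ℝ) ^ (i + 1))⁻¹ := by positivity
    nlinarith

/-- A Schwartz function of mean zero is a convergent sum of dilated bumps with summable
coefficients. -/
theorem exists_bump_decomposition (φ : 𝓢(E m, ℂ)) (h : ∫ x, φ x = 0) :
    ∃ (c : ℝ) (ψ : ℕ → E m → ℂ), 0 < c ∧ (∀ i, IsBump (ψ i) 0 1 1) ∧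
      ∀ x, HasSum (fun i => ((c * (2 ^ i)⁻¹ : ℝ) : ℂ) * dilate (ψ i) (2 ^ i) x) (φ x) := by
  obtain ⟨c, hc, hb⟩ := exists_lipBound_bumpPiece φ h
  have hci : ∀ i, 0 < c * ((2:ℝ) ^ i)⁻¹ := fun i => by positivity
  refine ⟨c, fun i x => (((c * (2 ^ i)⁻¹)⁻¹ : ℝ) : ℂ) * bumpPiece φ i x, hc, fun i => ?_, fun x => ?_⟩
  · have hb' := (hb i).const_mul (((c * (2 ^ i)⁻¹)⁻¹ : ℝ) : ℂ)
    rw [Complex.norm_real, Real.norm_eq_abs, abs_of_pos (inv_pos.2 (hci i)),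
      inv_mul_cancel₀ (hci i).ne'] at hb'
    refine ⟨fun y z => by simpa using hb'.2 y z, hb'.1, fun y hy => ?_, ?_⟩
    · show _ * bumpPiece φ i y = 0
      rw [bumpPiece_eq_zero _ _ (by simpa using hy), mul_zero]
    · rw [integral_const_mul, integral_bumpPiece φ.continuous, mul_zero]
  · have e : (fun i : ℕ => ((c * (2 ^ i)⁻¹ : ℝ) : ℂ) * dilate (fun x =>
        (((c * (2 ^ i)⁻¹)⁻¹ : ℝ) : ℂ) * bumpPiece φ i x) (2 ^ i) x) =
        fun i => dilate (bumpPiece φ i) (2 ^ i) x := by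
      ext i
      have h0 : ((c * (2 ^ i)⁻¹ : ℝ) : ℂ) ≠ 0 := by exact_mod_cast (hci i).ne'
      simp only [dilate, Complex.ofReal_inv (c * (2 ^ i)⁻¹)]
      rw [mul_left_comm, mul_inv_cancel_left₀ h0]
    rw [e]
    have hs : Summable fun i => dilate (bumpPiece φ i) (2 ^ i) x := by
      refine Summable.of_norm_bounded (g := fun i => c * (2⁻¹ : ℝ) ^ i)
        ((summable_geometric_of_lt_one (by norm_num) (by norm_num)).mul_left c) fun i => ?_
      rw [dilate, norm_mul, Complex.norm_real, Real.norm_eq_abs, abs_of_pos (by positivity), inv_pow]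
      have h1 : (((2:ℝ) ^ i) ^ m)⁻¹ ≤ 1 := inv_le_one_of_one_le₀ (one_le_pow₀ (one_le_pow₀ (by norm_num)))
      calc _ ≤ 1 * (c * (2 ^ i)⁻¹) := by gcongr; exact (hb i).1 _
        _ = _ := one_mul _
    rw [hs.hasSum_iff_tendsto_nat, ← Filter.tendsto_add_atTop_iff_nat 1]
    simp_rw [sum_dilate_bumpPiece, dilate_cutPiece]
    set I : ℝ := ∫ x, ‖x‖ * ‖φ x‖
    set κ : ℝ := ∫ y : E m, cutoff y with hκ
    have hκp : 0 < κ := integral_cutoff_pos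
    have hpow : Filter.Tendsto (fun n : ℕ => ((2:ℝ) ^ n)⁻¹) Filter.atTop (nhds 0) := by
      simp_rw [← inv_pow]
      exact tendsto_pow_atTop_nhds_zero_of_lt_one (by norm_num) (by norm_num)
    have t1 : Filter.Tendsto (fun n : ℕ => φ x * (cutoff ((2 ^ n : ℝ)⁻¹ • x) : ℂ)) Filter.atTop
        (nhds (φ x)) := by
      have hx0 : Filter.Tendsto (fun n : ℕ => (2 ^ n : ℝ)⁻¹ • x) Filter.atTop (nhds 0) := by
        simpa using hpow.smul_const x
      have := ((Complex.continuous_ofReal.comp continuous_cutoff).tendsto (0 : E m)).comp hx0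
      simp only [Function.comp_def] at this
      rw [cutoff_eq_one (by simp)] at this
      simpa using this.const_mul (φ x)
    -- The correction of the mass tends to zero.
    have t2 : Filter.Tendsto (fun n : ℕ => (((((2:ℝ) ^ n) ^ m)⁻¹ : ℝ) : ℂ) *
        (cutMass φ n / (κ : ℂ) * cutoff ((2 ^ n : ℝ)⁻¹ • x))) Filter.atTop (nhds 0) := by
      refine squeeze_zero_norm (a := fun n => 2 * I / κ * (2 ^ n)⁻¹) (fun n => ?_) ?_
      · rw [norm_mul, norm_mul, norm_div, Complex.norm_real, Complex.norm_real, Complex.norm_real,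
          Real.norm_eq_abs, Real.norm_eq_abs, Real.norm_eq_abs, abs_of_pos (by positivity),
          abs_of_pos hκp, abs_of_nonneg (cutoff_nonneg _)]
        have h1 : (((2:ℝ) ^ n) ^ m)⁻¹ ≤ 1 :=
          inv_le_one_of_one_le₀ (one_le_pow₀ (one_le_pow₀ (by norm_num)))
        have h2 := norm_cutMass_le φ h n
        have h3 : ‖cutMass φ n‖ / κ * cutoff ((2 ^ n : ℝ)⁻¹ • x) ≤ 2 * I * (2 ^ n)⁻¹ / κ * 1 :=
          mul_le_mul (by gcongr) (cutoff_le_one _) (cutoff_nonneg _)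
            (div_nonneg ((norm_nonneg _).trans h2) hκp.le)
        calc _ ≤ 1 * (2 * I * (2 ^ n)⁻¹ / κ * 1) :=
              mul_le_mul h1 h3 (mul_nonneg (by positivity) (cutoff_nonneg _)) (by norm_num)
          _ = _ := by ring
      · simpa using hpow.const_mul (2 * I / κ)
    simpa using t1.sub t2

/-! ### The weighted one-parameter square function estimate -/

lemma dilate_dilate (ψ : E m → ℂ) (a r : ℝ) (x : E m) :
    dilate (dilate ψ a) r x = dilate ψ (a * r) x := by
  simp only [dilate, smul_smul]
  rw [← mul_assoc, ← Complex.ofReal_mul, ← mul_inv, ← mul_inv, ← mul_pow, mul_comm r a]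

lemma measurable_dilate {φ : E m → ℂ} (hφ : Measurable φ) :
    Measurable fun p : ℝ × E m => dilate φ p.1 p.2 := by
  unfold dilate; fun_prop

lemma measurable_smear {φ f : E m → ℂ} (hφ : Measurable φ) (hf : Measurable f) :
    Measurable fun p : ℝ × E m => smear φ p.1 f p.2 := by
  have h1 : Measurable fun q : (ℝ × E m) × E m => dilate φ q.1.1 q.2 :=
    (measurable_dilate hφ).comp (measurable_fst.fst.prodMk measurable_snd)
  have h : Measurable fun q : (ℝ × E m) × E m => dilate φ q.1.1 q.2 * f (q.1.2 - q.2) := by fun_prop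
  exact h.stronglyMeasurable.integral_prod_right.measurable

lemma lintegral_comp_smul (g : E m → ℝ≥0∞) {a : ℝ} (ha : 0 < a) :
    ∫⁻ x, g (a • x) = ENNReal.ofReal (a ^ m)⁻¹ * ∫⁻ x, g x := by
  have := lintegral_map_equiv (μ := (volume : Measure (E m))) g
    (Homeomorph.smulOfNeZero a ha.ne').toMeasurableEquiv
  simp only [Homeomorph.toMeasurableEquiv_coe, Homeomorph.smulOfNeZero_apply] at this
  rw [← this]
  have h2 := Measure.map_addHaar_smul (volume : Measure (E m)) ha.ne'
  simp only [finrank_euclideanSpace_fin] at h2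
  rw [h2, lintegral_smul_measure,
    abs_of_pos (by positivity), smul_eq_mul]

lemma enorm_ofReal_of_nonneg {a : ℝ} (ha : 0 ≤ a) : ‖(a : ℂ)‖ₑ = ENNReal.ofReal a := by
  rw [← ofReal_norm, Complex.norm_real, Real.norm_of_nonneg ha]

lemma lintegral_enorm_dilate (φ : E m → ℂ) {r : ℝ} (hr : 0 < r) :
    ∫⁻ x, ‖dilate φ r x‖ₑ = ∫⁻ x, ‖φ x‖ₑ := by
  have hp : (0:ℝ) < (r ^ m)⁻¹ := by positivity
  simp only [dilate, enorm_mul]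
  rw [lintegral_const_mul' _ _ enorm_ne_top, lintegral_comp_smul (fun x => ‖φ x‖ₑ) (inv_pos.2 hr),
    ← mul_assoc, enorm_ofReal_of_nonneg hp.le, ← ENNReal.ofReal_mul hp.le]
  rw [inv_pow, inv_inv, inv_mul_cancel₀ (by positivity)]; simp

lemma integrable_dilate {φ : E m → ℂ} (hφ : Integrable φ) {r : ℝ} (hr : 0 < r) :
    Integrable (dilate φ r) := by
  unfold dilate
  exact (hφ.comp_smul (inv_ne_zero hr.ne')).const_mul _

/-- The measure `dr / r` is invariant under dilation. -/
lemma lintegral_Ioi_comp_mul (F : ℝ → ℝ≥0∞) {a : ℝ} (ha : 0 < a) :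
    ∫⁻ r in Ioi (0:ℝ), F (a * r) * (ENNReal.ofReal r)⁻¹ =
      ∫⁻ r in Ioi (0:ℝ), F r * (ENNReal.ofReal r)⁻¹ := by
  have himg : (fun r => a * r) '' Ioi (0:ℝ) = Ioi 0 := by
    rw [image_mul_left_Ioi ha, mul_zero]
  conv_rhs => rw [← himg, lintegral_image_eq_lintegral_abs_deriv_mul measurableSet_Ioi
    (f' := fun _ => a) (fun x _ => by simpa using ((hasDerivAt_id x).const_mul a).hasDerivWithinAt)
    (mul_right_injective₀ ha.ne').injOn]
  refine setLIntegral_congr_fun measurableSet_Ioi fun r hr => ?_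
  rw [abs_of_pos ha, ENNReal.ofReal_mul ha.le, ENNReal.mul_inv (by simp [ha]) (by simp),
    mul_left_comm (F _), ← mul_assoc, ENNReal.mul_inv_cancel (by simp [ha]) (by simp), one_mul]

/-- The pointwise bound of a smear by the smears of the bumps in a decomposition. -/
lemma enorm_smear_le_tsum {φ : E m → ℂ} {a : ℕ → ℝ} {ψ : ℕ → E m → ℂ} (ha : ∀ i, 0 ≤ a i)
    (has : ∑' i, ENNReal.ofReal (a i) ≠ ∞) (hψ : ∀ i, IsBump (ψ i) 0 1 1)
    (h : ∀ x, HasSum (fun i => (a i : ℂ) * dilate (ψ i) (2 ^ i) x) (φ x)) {f : E m → ℂ}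
    (hf : Measurable f) {D : ℝ} (hD : ∀ x, ‖f x‖ ≤ D) {r : ℝ} (hr : 0 < r) (x : E m) :
    ‖smear φ r f x‖ₑ ≤ ∑' i, ENNReal.ofReal (a i) * ‖smear (ψ i) (2 ^ i * r) f x‖ₑ := by
  have e : ∀ s, dilate φ r s * f (x - s) =
      ∑' i, (a i : ℂ) * (dilate (ψ i) (2 ^ i * r) s * f (x - s)) := fun s => by
    have h1 := ((h (r⁻¹ • s)).mul_left (((r ^ m)⁻¹ : ℝ) : ℂ)).mul_right (f (x - s))
    have h2 : ∀ i, (((r ^ m)⁻¹ : ℝ) : ℂ) * ((a i : ℂ) * dilate (ψ i) (2 ^ i) (r⁻¹ • s)) * f (x - s)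
        = (a i : ℂ) * (dilate (ψ i) (2 ^ i * r) s * f (x - s)) := fun i => by
      rw [show dilate (ψ i) (2 ^ i * r) s = (((r ^ m)⁻¹ : ℝ) : ℂ) * dilate (ψ i) (2 ^ i) (r⁻¹ • s) from
        (dilate_dilate (ψ i) (2 ^ i) r s).symm]
      ring
    simp only [h2] at h1
    rw [h1.tsum_eq]; rfl
  have hpos : ∀ i : ℕ, 0 < 2 ^ i * r := fun i => by positivity
  have hmeas : ∀ i, AEStronglyMeasurable
      (fun s => (a i : ℂ) * (dilate (ψ i) (2 ^ i * r) s * f (x - s))) volume := fun i => by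
    have := (integrable_dilate (hψ i).integrable (hpos i)).aestronglyMeasurable
    exact (this.mul (hf.comp (by fun_prop)).aestronglyMeasurable).const_mul _
  have hfin : ∑' i, ∫⁻ s, ‖(a i : ℂ) * (dilate (ψ i) (2 ^ i * r) s * f (x - s))‖ₑ ≠ ∞ := by
    have hb : ∀ i, ∫⁻ s, ‖(a i : ℂ) * (dilate (ψ i) (2 ^ i * r) s * f (x - s))‖ₑ ≤
        ENNReal.ofReal (a i) * (volume (ball (0 : E m) 1) * ENNReal.ofReal D) := fun i => by
      calc _ ≤ ∫⁻ s, ENNReal.ofReal (a i) * (‖dilate (ψ i) (2 ^ i * r) s‖ₑ * ENNReal.ofReal D) := by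
            refine lintegral_mono fun s => ?_
            rw [enorm_mul, enorm_mul, enorm_ofReal_of_nonneg (ha i)]
            gcongr
            rw [← ofReal_norm]
            exact ENNReal.ofReal_le_ofReal (hD _)
        _ = ENNReal.ofReal (a i) * ((∫⁻ s, ‖ψ i s‖ₑ) * ENNReal.ofReal D) := by
            rw [lintegral_const_mul' _ _ ENNReal.ofReal_ne_top,
              lintegral_mul_const' _ _ ENNReal.ofReal_ne_top, lintegral_enorm_dilate _ (hpos i)]
        _ ≤ _ := by
            gcongr
            rw [← lintegral_indicator_one measurableSet_ball]
            refine lintegral_mono fun s => ?_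
            by_cases hs : s ∈ ball (0 : E m) 1
            · rw [indicator_of_mem hs, Pi.one_apply, ← ofReal_norm]
              exact ENNReal.ofReal_le_one.2 ((hψ i).norm_le s)
            · rw [indicator_of_notMem hs, (hψ i).eq_zero s (by
                rw [mem_ball, not_lt, dist_eq_norm] at hs; exact hs)]
              simp
    refine ne_top_of_le_ne_top ?_ (ENNReal.tsum_le_tsum hb)
    rw [ENNReal.tsum_mul_right]
    exact ENNReal.mul_ne_top has (ENNReal.mul_ne_top measure_ball_lt_top.ne ENNReal.ofReal_ne_top)
  rw [smear]
  simp_rw [e]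
  rw [integral_tsum hmeas hfin]
  refine enorm_tsum_le_tsum_enorm.trans (le_of_eq (tsum_congr fun i => ?_))
  rw [integral_const_mul, enorm_mul, enorm_ofReal_of_nonneg (ha i), smear]

lemma measurable_lintegral_smear {φ f : E m → ℂ} (hφ : Measurable φ) (hf : Measurable f)
    {w : E m → ℝ≥0∞} (hw : Measurable w) :
    Measurable fun r : ℝ => ∫⁻ x, ‖smear φ r f x‖ₑ ^ 2 * w x := by
  have : Measurable fun p : ℝ × E m => ‖smear φ p.1 f p.2‖ₑ ^ 2 * w p.2 :=
    ((measurable_smear hφ hf).enorm.pow_const 2).mul (hw.comp measurable_snd)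
  exact this.lintegral_prod_right'

/-- The Cauchy–Schwarz inequality for series, multiplied by a common factor. -/
lemma sq_tsum_mul_mul_le (c T : ℕ → ℝ≥0∞) (b : ℝ≥0∞) :
    (∑' j, c j * T j) ^ 2 * b ≤ (∑' j, c j) * ∑' j, c j * (T j ^ 2 * b) := by
  simp only [← mul_assoc (c _)]
  rw [ENNReal.tsum_mul_right, ← mul_assoc]
  exact mul_le_mul_left (sq_tsum_mul_le c T) b

lemma lintegral_mul_tsum {S : Type*} [MeasurableSpace S] (μ : Measure S) {A : ℝ≥0∞} (hA : A ≠ ∞)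
    {c : ℕ → ℝ≥0∞} (hc : ∀ i, c i ≠ ∞) {F : ℕ → S → ℝ≥0∞} (hF : ∀ i, Measurable (F i)) :
    ∫⁻ x, A * ∑' i, c i * F i x ∂μ = A * ∑' i, c i * ∫⁻ x, F i x ∂μ := by
  rw [lintegral_const_mul' _ _ hA, lintegral_tsum fun i => ((hF i).const_mul _).aemeasurable]
  congr 1
  exact tsum_congr fun i => lintegral_const_mul' _ _ (hc i)

/-- The weighted square function estimate for a superposition of dilated bumps. -/
lemma IsA2.lintegral_smear_le_of_hasSum {w : E m → ℝ} {K : ℝ≥0} (hw : IsA2 w K) {φ : E m → ℂ}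
    {a : ℕ → ℝ} {ψ : ℕ → E m → ℂ} (ha : ∀ i, 0 ≤ a i)
    (has : ∑' i, ENNReal.ofReal (a i) ≠ ∞) (hψ : ∀ i, IsBump (ψ i) 0 1 1)
    (h : ∀ x, HasSum (fun i => (a i : ℂ) * dilate (ψ i) (2 ^ i) x) (φ x)) {f : E m → ℂ}
    (hf : Measurable f) {D : ℝ} (hD : ∀ x, ‖f x‖ ≤ D) :
    ∫⁻ r in Ioi (0 : ℝ), (∫⁻ x, ‖smear φ r f x‖ₑ ^ 2 * ENNReal.ofReal (w x)) * (ENNReal.ofReal r)⁻¹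
      ≤ (∑' i, ENNReal.ofReal (a i)) * ((∑' i, ENNReal.ofReal (a i)) * (atomConst m K *
        ∫⁻ x, ‖f x‖ₑ ^ 2 * ENNReal.ofReal (w x))) := by
  have hwm := hw.measurable.ennreal_ofReal
  have hsm : ∀ i, Measurable fun p : ℝ × E m => smear (ψ i) p.1 f p.2 := fun i =>
    measurable_smear (hψ i).continuous.measurable hf
  -- The weighted norm of the `i`-th smear at scale `r`.
  obtain ⟨T, hT⟩ : ∃ T : ℕ → ℝ → ℝ≥0∞, ∀ i r, T i r =
    ∫⁻ x, ‖smear (ψ i) r f x‖ₑ ^ 2 * ENNReal.ofReal (w x) := ⟨_, fun _ _ => rfl⟩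
  have hTm : ∀ i, Measurable (T i) := fun i => by
    rw [funext (hT i)]
    exact measurable_lintegral_smear (hψ i).continuous.measurable hf hwm
  have h1 : ∀ r ∈ Ioi (0:ℝ), ∫⁻ x, ‖smear φ r f x‖ₑ ^ 2 * ENNReal.ofReal (w x) ≤
      (∑' i, ENNReal.ofReal (a i)) * ∑' i, ENNReal.ofReal (a i) * T i (2 ^ i * r) := by
    intro r hr
    simp only [hT]
    rw [← lintegral_mul_tsum volume has (fun i => ENNReal.ofReal_ne_top)
      (F := fun i x => ‖smear (ψ i) (2 ^ i * r) f x‖ₑ ^ 2 * ENNReal.ofReal (w x)) fun i =>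
      (((hsm i).comp measurable_prodMk_left).enorm.pow_const 2).mul hwm]
    exact lintegral_mono fun x => (mul_le_mul_left
      (pow_le_pow_left' (enorm_smear_le_tsum ha has hψ h hf hD hr x) 2) _).trans
        (sq_tsum_mul_mul_le _ _ _)
  have h2 : ∀ i, ∫⁻ r in Ioi (0 : ℝ), T i (2 ^ i * r) * (ENNReal.ofReal r)⁻¹ ≤ atomConst m K *
        ∫⁻ x, ‖f x‖ₑ ^ 2 * ENNReal.ofReal (w x) := fun i => by
    rw [lintegral_Ioi_comp_mul (T i) (by positivity : (0:ℝ) < 2 ^ i)]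
    simp only [hT]
    exact hw.lintegral_smear_atom_le (hψ i) hf hD
  have h3 : ∀ i, Measurable fun r => T i (2 ^ i * r) * (ENNReal.ofReal r)⁻¹ := fun i =>
    ((hTm i).comp (measurable_const_mul ((2:ℝ) ^ i))).mul (by fun_prop)
  calc _ ≤ ∫⁻ r in Ioi (0 : ℝ), (∑' i, ENNReal.ofReal (a i)) * ∑' i, ENNReal.ofReal (a i) *
          (T i (2 ^ i * r) * (ENNReal.ofReal r)⁻¹) := by
        refine setLIntegral_mono' measurableSet_Ioi fun r hr => ?_
        refine (mul_le_mul_left (h1 r hr) _).trans (le_of_eq ?_)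
        simp only [← mul_assoc (ENNReal.ofReal (a _))]
        rw [ENNReal.tsum_mul_right, mul_assoc]
    _ = (∑' i, ENNReal.ofReal (a i)) * ∑' i, ENNReal.ofReal (a i) *
          ∫⁻ r in Ioi (0 : ℝ), T i (2 ^ i * r) * (ENNReal.ofReal r)⁻¹ :=
        lintegral_mul_tsum _ has (fun i => ENNReal.ofReal_ne_top) h3
    _ ≤ _ := by
        refine mul_le_mul_right ?_ _
        rw [← ENNReal.tsum_mul_right]
        exact (ENNReal.tsum_le_tsum fun i => mul_le_mul_right (h2 i) _)

/-- The Littlewood–Paley square function is bounded on `L²(w)` for every `A₂` weight `w`. -/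
theorem exists_lintegral_smear_le (φ : 𝓢(E m, ℂ)) (h : ∫ x, φ x = 0) (K : ℝ≥0) :
    ∃ C : ℝ≥0∞, C < ∞ ∧ ∀ w : E m → ℝ, IsA2 w K → ∀ f : E m → ℂ, Measurable f →
      ∀ D : ℝ, (∀ x, ‖f x‖ ≤ D) →
      ∫⁻ r in Ioi (0 : ℝ), (∫⁻ x, ‖smear φ r f x‖ₑ ^ 2 * ENNReal.ofReal (w x)) * (ENNReal.ofReal r)⁻¹
        ≤ C * ∫⁻ x, ‖f x‖ₑ ^ 2 * ENNReal.ofReal (w x) := by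
  obtain ⟨c, ψ, hc, hψ, hs⟩ := exists_bump_decomposition φ h
  have ha0 : ∀ i : ℕ, 0 ≤ c * (2 ^ i)⁻¹ := fun i => by positivity
  have hAt : ∑' i : ℕ, ENNReal.ofReal (c * (2 ^ i)⁻¹) ≠ ∞ := by
    have : Summable fun i : ℕ => c * (2 ^ i)⁻¹ := by
      simp only [← inv_pow]
      exact (summable_geometric_of_lt_one (by norm_num) (by norm_num)).mul_left c
    rw [← ENNReal.ofReal_tsum_of_nonneg ha0 this]
    exact ENNReal.ofReal_ne_top
  exact ⟨_, ENNReal.mul_lt_top hAt.lt_top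
    (ENNReal.mul_lt_top hAt.lt_top (atomConst_lt_top m K)), fun w hw f hf D hD =>
    (hw.lintegral_smear_le_of_hasSum ha0 hAt hψ hs hf hD).trans_eq (by simp only [mul_assoc])⟩

/-! ### The dyadic Hardy–Littlewood maximal function -/

/-- The centred Hardy–Littlewood maximal function over balls of dyadic radius. -/
def hlMax (g : E m → ℝ≥0∞) (x : E m) : ℝ≥0∞ :=
  ⨆ k : ℤ, (volume (ball (0 : E m) (2 ^ k)))⁻¹ * ∫⁻ s in ball (0 : E m) (2 ^ k), g (x - s)

lemma setLIntegral_ball_sub (g : E m → ℝ≥0∞) (x : E m) (R : ℝ) :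
    ∫⁻ s in ball (0 : E m) R, g (x - s) = ∫⁻ y in ball x R, g y := by
  rw [← lintegral_indicator measurableSet_ball, ← lintegral_indicator measurableSet_ball,
    ← lintegral_sub_left_eq_self _ x]
  congr 1; ext s
  by_cases h : x - s ∈ ball (0 : E m) R
  · rw [indicator_of_mem h, indicator_of_mem, sub_sub_cancel]
    rwa [mem_ball, dist_eq_norm, norm_sub_rev, ← dist_zero_right]
  · rw [indicator_of_notMem h, indicator_of_notMem]
    rwa [mem_ball, dist_eq_norm, norm_sub_rev, ← dist_zero_right]

lemma measurable_setLIntegral_sub {g : E m → ℝ≥0∞} (hg : Measurable g) (R : ℝ) :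
    Measurable fun x => ∫⁻ s in ball (0 : E m) R, g (x - s) := by
  have : Measurable fun p : E m × E m => g (p.1 - p.2) := by fun_prop
  exact this.lintegral_prod_right'

lemma measurable_hlMax {g : E m → ℝ≥0∞} (hg : Measurable g) : Measurable (hlMax g) :=
  Measurable.iSup fun _ => (measurable_setLIntegral_sub hg _).const_mul _

/-- The weak type estimate when the radii are bounded. -/
lemma mul_volume_le_of_forall_ball (g : E m → ℝ≥0∞) (t : ℝ≥0∞) (n : ℤ) {A : Set (E m)}
    (hA : ∀ x ∈ A, ∃ k ≤ n, t * volume (ball (0 : E m) (2 ^ k)) ≤ ∫⁻ y in ball x (2 ^ k), g y) :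
    t * volume A ≤ ENNReal.ofReal (5 ^ m) * ∫⁻ x, g x := by
  choose! k hk hk' using hA
  -- Vitali's covering lemma; this is where the upper bound for the radii is needed.
  obtain ⟨u, hu, hd, hc⟩ := Vitali.exists_disjoint_subfamily_covering_enlargement_closedBall A
    (fun x => x) (fun x => (2:ℝ) ^ k x) (2 ^ n)
    (fun x hx => zpow_le_zpow_right₀ (by norm_num) (hk x hx)) 5 (by norm_num)
  have hpos : ∀ x, (0:ℝ) < 2 ^ k x := fun x => by positivity
  have huc : u.Countable := hd.countable_of_nonempty_interior fun x _ =>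
    ⟨x, ball_subset_interior_closedBall (mem_ball_self (hpos x))⟩
  have hd' : u.PairwiseDisjoint fun x => ball x ((2:ℝ) ^ k x) :=
    hd.mono fun x => ball_subset_closedBall
  have hcov : A ⊆ ⋃ x ∈ u, closedBall x (5 * (2:ℝ) ^ k x) := fun x hx => by
    obtain ⟨b, hb, hbx⟩ := hc x hx
    exact mem_biUnion hb (hbx (mem_closedBall_self (hpos x).le))
  calc t * volume A ≤ t * ∑' x : u, volume (closedBall (x : E m) (5 * (2:ℝ) ^ k x)) := by
        gcongr
        exact (measure_mono hcov).trans (measure_biUnion_le _ huc _)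
    _ = ∑' x : u, ENNReal.ofReal (5 ^ m) * (t * volume (ball (0 : E m) ((2:ℝ) ^ k x))) := by
        rw [← ENNReal.tsum_mul_left]
        refine tsum_congr fun x => ?_
        rw [Measure.addHaar_closedBall _ _ (by positivity), Measure.addHaar_ball_of_pos _ _ (hpos x),
          finrank_euclideanSpace_fin, mul_pow, ENNReal.ofReal_mul (by positivity)]
        ring
    _ ≤ ∑' x : u, ENNReal.ofReal (5 ^ m) * ∫⁻ y in ball (x : E m) ((2:ℝ) ^ k x), g y := by
        gcongr with x
        exact hk' x (hu x.2)
    _ = ENNReal.ofReal (5 ^ m) * ∫⁻ y in ⋃ x ∈ u, ball x ((2:ℝ) ^ k x), g y := by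
        rw [ENNReal.tsum_mul_left, lintegral_biUnion huc (fun _ _ => measurableSet_ball) hd']
    _ ≤ _ := by gcongr; exact Measure.restrict_le_self

/-- The weak type `(1, 1)` estimate for the maximal function. -/
lemma mul_volume_lt_hlMax_le (g : E m → ℝ≥0∞) (t : ℝ≥0∞) :
    t * volume {x | t < hlMax g x} ≤ ENNReal.ofReal (5 ^ m) * ∫⁻ x, g x := by
  set A : ℕ → Set (E m) := fun n => {x | ∃ k ≤ (n : ℤ),
    t < (volume (ball (0 : E m) (2 ^ k)))⁻¹ * ∫⁻ s in ball (0 : E m) (2 ^ k), g (x - s)} with hA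
  have hmono : Monotone A := fun a b hab x ⟨k, hk, h⟩ => ⟨k, hk.trans (by exact_mod_cast hab), h⟩
  have hU : {x | t < hlMax g x} = ⋃ n, A n := by
    ext x
    simp only [mem_ofPred_eq, hlMax, lt_iSup_iff, mem_iUnion, hA]
    exact ⟨fun ⟨k, h⟩ => ⟨k.toNat, k, k.self_le_toNat, h⟩, fun ⟨_, k, _, h⟩ => ⟨k, h⟩⟩
  rw [hU, hmono.measure_iUnion, ENNReal.mul_iSup]
  refine iSup_le fun n => mul_volume_le_of_forall_ball g t n fun x ⟨k, hk, h⟩ => ⟨k, hk, ?_⟩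
  have h0 : volume (ball (0 : E m) ((2:ℝ) ^ k)) ≠ 0 :=
    (measure_ball_pos _ _ (by positivity)).ne'
  rw [mul_comm, ← div_eq_mul_inv, setLIntegral_ball_sub,
    ENNReal.lt_div_iff_mul_lt (Or.inl h0) (Or.inl measure_ball_lt_top.ne)] at h
  exact h.le

lemma hlMax_add_le (g h : E m → ℝ≥0∞) (hg : Measurable g) (x : E m) :
    hlMax (fun y => g y + h y) x ≤ hlMax g x + hlMax h x := by
  refine iSup_le fun k => ?_
  rw [lintegral_add_left (by fun_prop), mul_add]
  exact add_le_add (le_iSup (fun k : ℤ => (volume (ball (0 : E m) (2 ^ k)))⁻¹ *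
    ∫⁻ s in ball (0 : E m) (2 ^ k), g (x - s)) k) (le_iSup (fun k : ℤ =>
    (volume (ball (0 : E m) (2 ^ k)))⁻¹ * ∫⁻ s in ball (0 : E m) (2 ^ k), h (x - s)) k)

lemma hlMax_const_le (c : ℝ≥0∞) (x : E m) : hlMax (fun _ => c) x ≤ c := by
  refine iSup_le fun k => ?_
  rw [setLIntegral_const, mul_left_comm]
  exact mul_le_of_le_one_right' (ENNReal.inv_mul_le_one _)

lemma hlMax_mono {g h : E m → ℝ≥0∞} (hgh : ∀ x, g x ≤ h x) (x : E m) : hlMax g x ≤ hlMax h x :=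
  iSup_mono fun _ => mul_le_mul_right (lintegral_mono fun _ => hgh _) _

/-- The layer cake formula for a power of an extended nonnegative real. -/
lemma rpow_eq_lintegral {s : ℝ} (hs : 0 < s) (a : ℝ≥0∞) :
    a ^ s = ∫⁻ t in Ioi (0:ℝ), {t : ℝ | ENNReal.ofReal t < a}.indicator
      (fun t => ENNReal.ofReal (s * t ^ (s - 1))) t := by
  have hmeas : ∀ b : ℝ≥0∞, MeasurableSet {t : ℝ | ENNReal.ofReal t < b} := fun b =>
    measurableSet_lt (by fun_prop) measurable_const
  have hreal : ∀ b : ℝ, 0 ≤ b → ∫⁻ t in Ioi (0:ℝ), {t : ℝ | ENNReal.ofReal t < ENNReal.ofReal b}.indicator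
      (fun t => ENNReal.ofReal (s * t ^ (s - 1))) t = ENNReal.ofReal b ^ s := by
    intro b hb
    have hset : {t : ℝ | ENNReal.ofReal t < ENNReal.ofReal b} ∩ Ioi 0 = Ioo 0 b := by
      ext t
      simp only [mem_inter_iff, mem_ofPred_eq, mem_Ioi, mem_Ioo]
      constructor
      · rintro ⟨h1, h2⟩
        exact ⟨h2, (ENNReal.ofReal_lt_ofReal_iff_of_nonneg h2.le).1 h1⟩
      · rintro ⟨h1, h2⟩
        exact ⟨(ENNReal.ofReal_lt_ofReal_iff_of_nonneg h1.le).2 h2, h1⟩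
    have hint : IntervalIntegrable (fun t : ℝ => s * t ^ (s - 1)) volume 0 b :=
      (intervalIntegral.intervalIntegrable_rpow' (by linarith)).const_mul s
    rw [lintegral_indicator (hmeas _), Measure.restrict_restrict (hmeas _), hset,
      restrict_Ioo_eq_restrict_Ioc, ← ofReal_integral_eq_lintegral_ofReal]
    · rw [← intervalIntegral.integral_of_le hb, intervalIntegral.integral_const_mul,
        integral_rpow (Or.inl (by linarith)), ENNReal.ofReal_rpow_of_nonneg hb hs.le]
      congr 1
      rw [sub_add_cancel, Real.zero_rpow hs.ne', sub_zero]
      field_simp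
    · exact (intervalIntegrable_iff_integrableOn_Ioc_of_le hb).1 hint
    · filter_upwards [ae_restrict_mem measurableSet_Ioc] with t ht
      have := ht.1
      positivity
  induction a with
  | coe b =>
    rw [← ENNReal.ofReal_coe_nnreal, hreal b b.2]
  | top =>
    rw [ENNReal.top_rpow_of_pos hs]
    refine (ENNReal.eq_top_of_forall_nnreal_le fun r => ?_).symm
    have h1 := hreal ((r:ℝ) ^ (1 / s)) (by positivity)
    rw [ENNReal.ofReal_rpow_of_nonneg (by positivity) hs.le, ← Real.rpow_mul r.coe_nonneg,
      one_div_mul_cancel hs.ne', Real.rpow_one, ENNReal.ofReal_coe_nnreal] at h1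
    rw [← h1]
    refine lintegral_mono fun t => indicator_le_indicator_of_subset (fun t ht => ?_) (fun _ => zero_le) t
    exact ENNReal.ofReal_lt_top

/-- The constant in the maximal inequality on `L^q`. -/
def maxConst (m : ℕ) (q : ℝ) : ℝ≥0∞ :=
  ENNReal.ofReal (2 * q * 5 ^ m / (q - 1)) * 2 ^ (q - 1)

lemma maxConst_lt_top (m : ℕ) {q : ℝ} (hq : 1 < q) : maxConst m q < ∞ :=
  ENNReal.mul_lt_top ENNReal.ofReal_lt_top
    (ENNReal.rpow_lt_top_of_nonneg (by linarith) (by norm_num))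

/-- The maximal inequality on `L^q`. -/
theorem lintegral_hlMax_rpow_le {q : ℝ} (hq : 1 < q) {g : E m → ℝ≥0∞} (hg : Measurable g) :
    ∫⁻ x, hlMax g x ^ q ≤ maxConst m q * ∫⁻ x, g x ^ q := by
  have hM := measurable_hlMax hg
  -- The part of `g` below `t / 2` contributes at most `t / 2` to the maximal function.
  have hweak : ∀ t : ℝ, 0 < t → ENNReal.ofReal (q * t ^ (q - 1)) *
      volume {x | ENNReal.ofReal t < hlMax g x} ≤ ENNReal.ofReal (2 * q * 5 ^ m / (q - 1)) *
        ∫⁻ x, g x * {t : ℝ | ENNReal.ofReal t < 2 * g x}.indicator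
          (fun t => ENNReal.ofReal ((q - 1) * t ^ (q - 1 - 1))) t := by
    intro t ht
    set S := {x | ENNReal.ofReal t < 2 * g x} with hS
    have hSm : MeasurableSet S := measurableSet_lt measurable_const (by fun_prop)
    have hsub : {x | ENNReal.ofReal t < hlMax g x} ⊆
        {x | ENNReal.ofReal (t / 2) < hlMax (S.indicator g) x} := by
      intro x hx
      simp only [mem_ofPred_eq] at hx ⊢
      have h1 : hlMax g x ≤ hlMax (S.indicator g) x + ENNReal.ofReal (t / 2) := by
        refine (hlMax_mono (h := fun y => S.indicator g y + ENNReal.ofReal (t / 2)) (fun y => ?_) x).trans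
          ((hlMax_add_le _ _ (hg.indicator hSm) x).trans (add_le_add le_rfl (hlMax_const_le _ x)))
        by_cases hy : y ∈ S
        · rw [indicator_of_mem hy]; exact le_self_add
        · rw [indicator_of_notMem hy, zero_add]
          rw [hS, mem_ofPred_eq, not_lt] at hy
          rw [ENNReal.ofReal_div_of_pos (by norm_num), ENNReal.ofReal_ofNat,
            ENNReal.le_div_iff_mul_le (by norm_num) (by norm_num), mul_comm]
          exact hy
      have h2 : ENNReal.ofReal t = ENNReal.ofReal (t / 2) + ENNReal.ofReal (t / 2) := by
        rw [← ENNReal.ofReal_add (by positivity) (by positivity)]; congr 1; ring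
      rw [h2] at hx
      exact lt_of_add_lt_add_right (hx.trans_le h1)
    have h3 := mul_volume_lt_hlMax_le (S.indicator g) (ENNReal.ofReal (t / 2))
    have e1 : ENNReal.ofReal (q * t ^ (q - 1)) =
        ENNReal.ofReal (2 * q * t ^ (q - 1 - 1)) * ENNReal.ofReal (t / 2) := by
      rw [← ENNReal.ofReal_mul (by positivity)]
      congr 1
      rw [Real.rpow_sub_one ht.ne' (q - 1)]; field_simp
    calc _ ≤ ENNReal.ofReal (2 * q * t ^ (q - 1 - 1)) * (ENNReal.ofReal (t / 2) *
          volume {x | ENNReal.ofReal (t / 2) < hlMax (S.indicator g) x}) := by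
          rw [e1, mul_assoc]; gcongr
      _ ≤ ENNReal.ofReal (2 * q * t ^ (q - 1 - 1)) *
          (ENNReal.ofReal (5 ^ m) * ∫⁻ x, S.indicator g x) := by gcongr
      _ = ENNReal.ofReal (2 * q * 5 ^ m / (q - 1)) *
          (ENNReal.ofReal ((q - 1) * t ^ (q - 1 - 1)) * ∫⁻ x, S.indicator g x) := by
          rw [← mul_assoc, ← mul_assoc, ← ENNReal.ofReal_mul (by positivity),
            ← ENNReal.ofReal_mul (div_nonneg (by positivity) (by linarith))]
          congr 2
          have : q - 1 ≠ 0 := by linarith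
          field_simp
      _ = _ := by
          rw [← lintegral_const_mul' _ _ ENNReal.ofReal_ne_top]
          congr 1
          refine lintegral_congr fun x => ?_
          by_cases hx : x ∈ S
          · rw [indicator_of_mem hx, indicator_of_mem (by exact hx), mul_comm]
          · rw [indicator_of_notMem hx, indicator_of_notMem (by exact hx), mul_zero, mul_zero]
  have hm1 : Measurable fun p : E m × ℝ => {t : ℝ | ENNReal.ofReal t < hlMax g p.1}.indicator
      (fun t => ENNReal.ofReal (q * t ^ (q - 1))) p.2 := by
    have : MeasurableSet {p : E m × ℝ | ENNReal.ofReal p.2 < hlMax g p.1} :=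
      measurableSet_lt (by fun_prop) (hM.comp measurable_fst)
    exact (show Measurable fun p : E m × ℝ => ENNReal.ofReal (q * p.2 ^ (q - 1)) by fun_prop).indicator this
  have hm2 : Measurable fun p : ℝ × E m => g p.2 * {t : ℝ | ENNReal.ofReal t < 2 * g p.2}.indicator
      (fun t => ENNReal.ofReal ((q - 1) * t ^ (q - 1 - 1))) p.1 := by
    have : MeasurableSet {p : ℝ × E m | ENNReal.ofReal p.1 < 2 * g p.2} :=
      measurableSet_lt (by fun_prop) (by fun_prop)
    exact (hg.comp measurable_snd).mul ((show Measurable fun p : ℝ × E m =>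
      ENNReal.ofReal ((q - 1) * p.1 ^ (q - 1 - 1)) by fun_prop).indicator this)
  calc ∫⁻ x, hlMax g x ^ q
      = ∫⁻ x, ∫⁻ t in Ioi (0:ℝ), {t : ℝ | ENNReal.ofReal t < hlMax g x}.indicator
          (fun t => ENNReal.ofReal (q * t ^ (q - 1))) t := by
        simp_rw [← rpow_eq_lintegral (by linarith : 0 < q)]
    _ = ∫⁻ t in Ioi (0:ℝ), ENNReal.ofReal (q * t ^ (q - 1)) *
          volume {x | ENNReal.ofReal t < hlMax g x} := by
        rw [lintegral_lintegral_swap hm1.aemeasurable]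
        refine lintegral_congr fun t => ?_
        rw [← setLIntegral_const, ← lintegral_indicator (measurableSet_lt measurable_const hM)]
        rfl
    _ ≤ ∫⁻ t in Ioi (0:ℝ), ENNReal.ofReal (2 * q * 5 ^ m / (q - 1)) *
        ∫⁻ x, g x * {t : ℝ | ENNReal.ofReal t < 2 * g x}.indicator
          (fun t => ENNReal.ofReal ((q - 1) * t ^ (q - 1 - 1))) t :=
        setLIntegral_mono' measurableSet_Ioi fun t ht => hweak t ht
    _ = ENNReal.ofReal (2 * q * 5 ^ m / (q - 1)) * ∫⁻ x, g x * (2 * g x) ^ (q - 1) := by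
        rw [lintegral_const_mul' _ _ ENNReal.ofReal_ne_top, lintegral_lintegral_swap hm2.aemeasurable]
        congr 1
        refine lintegral_congr fun x => ?_
        rw [lintegral_const_mul'' _ ?_, ← rpow_eq_lintegral (by linarith : 0 < q - 1)]
        refine Measurable.aemeasurable ?_
        exact Measurable.indicator (by fun_prop) (measurableSet_lt (by fun_prop) measurable_const)
    _ = _ := by
        rw [maxConst, mul_assoc (ENNReal.ofReal _), ← lintegral_const_mul' _ _
          (ENNReal.rpow_lt_top_of_nonneg (by linarith) (by norm_num)).ne]
        congr 1
        refine lintegral_congr fun x => ?_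
        rw [ENNReal.mul_rpow_of_nonneg _ _ (by linarith), mul_left_comm]
        congr 1
        rw [show q = 1 + (q - 1) by ring, ENNReal.rpow_add_of_nonneg _ _ (by norm_num) (by linarith)]
        simp

/-! ### `A₁` weights -/

/-- The `A₁` condition on balls, with constant `B`. -/
structure IsA1 (w : E m → ℝ) (B : ℝ≥0) : Prop where
  measurable : Measurable w
  pos : ∀ x, 0 < w x
  le : ∀ (x : E m) (r : ℝ), 0 < r → ∀ᵐ y ∂volume.restrict (ball x r),
    ∫⁻ z in ball x r, ENNReal.ofReal (w z) ≤ B * volume (ball x r) * ENNReal.ofReal (w y)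

/-- An `A₁` weight is an `A₂` weight with the same constant. -/
lemma IsA1.isA2 {w : E m → ℝ} {B : ℝ≥0} (h : IsA1 w B) : IsA2 w B where
  measurable := h.measurable
  pos := h.pos
  le x r hr := by
    have hm : Measurable fun y => ENNReal.ofReal (w y)⁻¹ := h.measurable.inv.ennreal_ofReal
    rw [← lintegral_const_mul _ hm]
    calc _ ≤ ∫⁻ _ in ball x r, B * volume (ball x r) := by
          refine lintegral_mono_ae ?_
          filter_upwards [h.le x r hr] with y hy
          refine (mul_le_mul_left hy _).trans_eq ?_
          rw [mul_assoc, ← ENNReal.ofReal_mul (h.pos y).le, mul_inv_cancel₀ (h.pos y).ne']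
          simp
      _ = _ := by rw [setLIntegral_const, sq, mul_assoc]

/-- Powers of an `A₁` weight with exponent in `[0, 1]` are `A₁` weights, by Jensen's inequality. -/
lemma IsA1.rpow {w : E m → ℝ} {B : ℝ≥0} (h : IsA1 w B) {s : ℝ} (hs : 0 ≤ s) (hs1 : s ≤ 1) :
    IsA1 (fun x => w x ^ s) (B ^ s) where
  measurable := h.measurable.pow_const s
  pos x := Real.rpow_pos_of_pos (h.pos x) s
  le x r hr := by
    filter_upwards [h.le x r hr] with y hy
    have hm := h.measurable.ennreal_ofReal
    have h1 := ENNReal.lintegral_mul_norm_pow_le (μ := volume.restrict (ball x r))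
      hm.aemeasurable (g := fun _ => 1) aemeasurable_const hs (sub_nonneg.2 hs1) (by ring)
    simp only [ENNReal.one_rpow, mul_one, lintegral_const, one_mul, Measure.restrict_apply_univ] at h1
    have e : ∀ z, ENNReal.ofReal (w z ^ s) = ENNReal.ofReal (w z) ^ s := fun z =>
      (ENNReal.ofReal_rpow_of_nonneg (h.pos z).le hs).symm
    simp only [e]
    refine h1.trans ((mul_le_mul_left (ENNReal.rpow_le_rpow hy hs) _).trans_eq ?_)
    rw [ENNReal.mul_rpow_of_nonneg _ _ hs, ENNReal.mul_rpow_of_nonneg _ _ hs,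
      ENNReal.coe_rpow_of_nonneg _ hs, mul_right_comm, mul_assoc (_ ^ s) (_ ^ s),
      ← ENNReal.rpow_add_of_nonneg _ _ hs (sub_nonneg.2 hs1)]
    simp

/-- A function that dominates its own maximal function is an `A₁` weight. -/
lemma isA1_of_hlMax_le {g : E m → ℝ≥0∞} {B : ℝ≥0} (hB : ∀ x, hlMax g x ≤ B * g x) {w : E m → ℝ}
    (hw : Measurable w) (hw0 : ∀ x, 0 < w x) (hwg : ∀ᵐ x, ENNReal.ofReal (w x) = g x) :
    IsA1 w (4 ^ m * B) where
  measurable := hw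
  pos := hw0
  le x r hr := by
    rw [lintegral_congr_ae (ae_restrict_of_ae hwg)]
    filter_upwards [ae_restrict_of_ae hwg, ae_restrict_mem measurableSet_ball] with y hy hyx
    -- A dyadic ball around `y` of comparable radius contains the given ball.
    obtain ⟨k, hk1, hk2⟩ := exists_mem_Ioc_zpow (by positivity : 0 < 2 * r) (by norm_num : (1:ℝ) < 2)
    rw [zpow_add₀ (by norm_num), zpow_one] at hk2
    have hsub : ball x r ⊆ ball y (2 ^ (k + 1)) := by
      intro z hz
      rw [mem_ball] at hz hyx ⊢
      rw [zpow_add₀ (by norm_num), zpow_one]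
      have := dist_triangle_right z y x
      linarith
    set b := volume (ball (0 : E m) (2 ^ (k + 1))) with hb
    have hb0 : b ≠ 0 := (measure_ball_pos _ _ (by positivity)).ne'
    have hbt : b ≠ ∞ := measure_ball_lt_top.ne
    have h1 : b⁻¹ * ∫⁻ z in ball y (2 ^ (k + 1)), g z ≤ B * g y := by
      refine le_trans ?_ (hB y)
      rw [← setLIntegral_ball_sub]
      exact le_iSup (fun k : ℤ => (volume (ball (0 : E m) (2 ^ k)))⁻¹ *
        ∫⁻ s in ball (0 : E m) (2 ^ k), g (y - s)) (k + 1)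
    have h2 : b ≤ ENNReal.ofReal (4 ^ m) * volume (ball x r) := by
      rw [← volume_ball_mul 0 x (by norm_num) hr]
      refine measure_mono (ball_subset_ball ?_)
      rw [zpow_add₀ (by norm_num), zpow_one]
      linarith
    rw [hy]
    calc ∫⁻ z in ball x r, g z ≤ ∫⁻ z in ball y (2 ^ (k + 1)), g z := lintegral_mono_set hsub
      _ = b * (b⁻¹ * ∫⁻ z in ball y (2 ^ (k + 1)), g z) := by
          rw [← mul_assoc, ENNReal.mul_inv_cancel hb0 hbt, one_mul]
      _ ≤ (ENNReal.ofReal (4 ^ m) * volume (ball x r)) * (B * g y) := by gcongr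
      _ = _ := by
          rw [ENNReal.ofReal_pow (by norm_num), ENNReal.ofReal_ofNat]
          push_cast; ring

/-! ### Directional maximal functions and their majorants on `ℝᵐ × ℝᵐ` -/

/-- `T` parametrizes `ℝᵐ × ℝᵐ` by a family of `m`-dimensional fibres, each of which is moved
along `ι`: the second variable of `T` is the position on the fibre. -/
structure IsDirection (T : E m × E m → E m × E m) (ι : E m → E m × E m) : Prop where
  measurePreserving : MeasurePreserving T volume volume
  measurable : Measurable ι
  map_sub : ∀ y₁ y₂ s, T (y₁, y₂ - s) = T (y₁, y₂) - ι s

/-- The three directions along which the twisted dilates act: the two coordinate subspaces and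
the diagonal. -/
def dirVec (i : Fin 3) (s : E m) : E m × E m := ![(s, 0), (0, s), (s, s)] i

/-- The fibrations of `ℝᵐ × ℝᵐ` belonging to the three directions. -/
def dirMap (i : Fin 3) (y : E m × E m) : E m × E m := ![(y.2, y.1), y, (y.2, y.2 + y.1)] i

lemma isDirection_dir (i : Fin 3) : IsDirection (m := m) (dirMap i) (dirVec i) := by
  have hswap : MeasurePreserving (fun y : E m × E m => (y.2, y.1)) volume volume :=
    Measure.measurePreserving_swap
  fin_cases i
  · exact ⟨hswap, measurable_id.prodMk measurable_const, fun y₁ y₂ s => by simp [dirMap, dirVec]⟩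
  · exact ⟨MeasurePreserving.id _, measurable_const.prodMk measurable_id,
      fun y₁ y₂ s => by simp [dirMap, dirVec]⟩
  · refine ⟨(measurePreserving_prod_add (volume : Measure (E m)) volume).comp hswap,
      measurable_id.prodMk measurable_id, fun y₁ y₂ s => ?_⟩
    simp only [dirMap, dirVec, Fin.reduceFinMk, Matrix.cons_val]
    ext <;> (simp; try ring)

/-- The maximal function along the translates of `ι`. -/
def dirMax (ι : E m → E m × E m) (h : E m × E m → ℝ≥0∞) (z : E m × E m) : ℝ≥0∞ :=
  ⨆ k : ℤ, (volume (ball (0 : E m) (2 ^ k)))⁻¹ * ∫⁻ s in ball (0 : E m) (2 ^ k), h (z - ι s)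

lemma measurable_dirMax {ι : E m → E m × E m} (hι : Measurable ι) {h : E m × E m → ℝ≥0∞}
    (hh : Measurable h) : Measurable (dirMax ι h) := by
  refine Measurable.iSup fun k => Measurable.const_mul ?_ _
  have : Measurable fun p : (E m × E m) × E m => h (p.1 - ι p.2) := by fun_prop
  exact this.lintegral_prod_right'

section
variable {T : E m × E m → E m × E m} {ι : E m → E m × E m}

/-- On a fibre, the directional maximal function is the maximal function on `ℝᵐ`. -/
lemma IsDirection.dirMax_apply (hT : IsDirection T ι) (h : E m × E m → ℝ≥0∞) (y₁ y₂ : E m) :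
    dirMax ι h (T (y₁, y₂)) = hlMax (fun y => h (T (y₁, y))) y₂ := by
  simp only [dirMax, hlMax, hT.map_sub]

/-- Integration over the fibres of a direction. -/
lemma IsDirection.lintegral_eq (hT : IsDirection T ι) {h : E m × E m → ℝ≥0∞} (hh : Measurable h) :
    ∫⁻ z, h z = ∫⁻ y₁, ∫⁻ y₂, h (T (y₁, y₂)) := by
  rw [← hT.measurePreserving.lintegral_comp hh, Measure.volume_eq_prod,
    lintegral_prod (fun y => h (T y)) (hh.comp hT.measurePreserving.measurable).aemeasurable]

lemma IsDirection.ae_ae (hT : IsDirection T ι) {P : E m × E m → Prop} (h : ∀ᵐ z, P z) :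
    ∀ᵐ y₁, ∀ᵐ y₂, P (T (y₁, y₂)) :=
  Measure.ae_ae_of_ae_prod (hT.measurePreserving.quasiMeasurePreserving.ae h)

lemma IsDirection.measurable_slice (hT : IsDirection T ι) {F : Type*} [MeasurableSpace F]
    {h : E m × E m → F} (hh : Measurable h) (y : E m) : Measurable fun y₂ => h (T (y, y₂)) :=
  hh.comp (hT.measurePreserving.measurable.comp measurable_prodMk_left)

lemma IsDirection.lintegral_dirMax_rpow_le (hT : IsDirection T ι) {q : ℝ} (hq : 1 < q)
    {h : E m × E m → ℝ≥0∞} (hh : Measurable h) :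
    ∫⁻ z, dirMax ι h z ^ q ≤ maxConst m q * ∫⁻ z, h z ^ q := by
  rw [hT.lintegral_eq ((measurable_dirMax hT.measurable hh).pow_const q),
    hT.lintegral_eq (hh.pow_const q), ← lintegral_const_mul' _ _ (maxConst_lt_top m hq).ne]
  refine lintegral_mono fun y₁ => ?_
  simp only [hT.dirMax_apply]
  exact lintegral_hlMax_rpow_le hq (hT.measurable_slice hh y₁)

lemma dirMax_tsum_le (hι : Measurable ι) {g : ℕ → E m × E m → ℝ≥0∞}
    (hg : ∀ k, Measurable (g k)) {c : ℕ → ℝ≥0∞} (hc : ∀ k, c k ≠ ∞) (z : E m × E m) :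
    dirMax ι (fun z => ∑' k, c k * g k z) z ≤ ∑' k, c k * dirMax ι (g k) z := by
  refine iSup_le fun j => ?_
  have hm : ∀ k, Measurable fun s => g k (z - ι s) := fun k => (hg k).comp (by fun_prop)
  rw [lintegral_tsum fun k => ((hm k).const_mul _).aemeasurable, ← ENNReal.tsum_mul_left]
  refine ENNReal.tsum_le_tsum fun k => ?_
  rw [lintegral_const_mul' _ _ (hc k), mul_left_comm]
  exact mul_le_mul_right (le_iSup (fun j : ℤ => (volume (ball (0 : E m) (2 ^ j)))⁻¹ *
    ∫⁻ s in ball (0 : E m) (2 ^ j), g k (z - ι s)) j) _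

end

/-- The sum of the three directional maximal functions. -/
def sumMax (h : E m × E m → ℝ≥0∞) (z : E m × E m) : ℝ≥0∞ := ∑ i, dirMax (dirVec i) h z

lemma measurable_sumMax {h : E m × E m → ℝ≥0∞} (hh : Measurable h) : Measurable (sumMax h) :=
  Finset.measurable_sum _ fun i _ => measurable_dirMax (isDirection_dir i).measurable hh

/-- A bound for the norm of `sumMax` on `L^q`, to the power `q`. -/
def sumMaxConst (m : ℕ) (q : ℝ) : ℝ≥0∞ := 3 ^ (q - 1) * (3 * maxConst m q) + 1

lemma sumMaxConst_ne_top (m : ℕ) {q : ℝ} (hq : 1 < q) : sumMaxConst m q ≠ ∞ :=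
  ENNReal.add_ne_top.2 ⟨ENNReal.mul_ne_top (ENNReal.rpow_lt_top_of_nonneg (by linarith) (by simp)).ne
    (ENNReal.mul_ne_top (by simp) (maxConst_lt_top m hq).ne), by simp⟩

lemma lintegral_sumMax_rpow_le {q : ℝ} (hq : 1 < q) {h : E m × E m → ℝ≥0∞} (hh : Measurable h) :
    ∫⁻ z, sumMax h z ^ q ≤ sumMaxConst m q * ∫⁻ z, h z ^ q := by
  calc ∫⁻ z, sumMax h z ^ q ≤ ∫⁻ z, 3 ^ (q - 1) * ∑ i, dirMax (dirVec i) h z ^ q := by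
        refine lintegral_mono fun z => ?_
        refine (ENNReal.rpow_sum_le_const_mul_sum_rpow _ _ hq.le).trans_eq ?_
        simp
    _ = 3 ^ (q - 1) * ∑ i, ∫⁻ z, dirMax (dirVec i) h z ^ q := by
        rw [lintegral_const_mul' _ _ (ENNReal.rpow_lt_top_of_nonneg (by linarith) (by simp)).ne,
          lintegral_finsetSum _ fun i _ =>
            (measurable_dirMax (isDirection_dir i).measurable hh).pow_const q]
    _ ≤ 3 ^ (q - 1) * ∑ _i : Fin 3, maxConst m q * ∫⁻ z, h z ^ q := by
        gcongr with i
        exact (isDirection_dir i).lintegral_dirMax_rpow_le hq hh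
    _ = 3 ^ (q - 1) * (3 * maxConst m q) * ∫⁻ z, h z ^ q := by
        rw [Finset.sum_const, Finset.card_univ, Fintype.card_fin, nsmul_eq_mul]
        push_cast; ring
    _ ≤ _ := by
        gcongr
        exact le_self_add

lemma measurable_iterate_sumMax {h : E m × E m → ℝ≥0∞} (hh : Measurable h) (k : ℕ) :
    Measurable (sumMax^[k] h) := by
  induction k with
  | zero => exact hh
  | succ k ih => rw [Function.iterate_succ_apply']; exact measurable_sumMax ih

lemma lintegral_iterate_sumMax_rpow_le {q : ℝ} (hq : 1 < q) {h : E m × E m → ℝ≥0∞}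
    (hh : Measurable h) (k : ℕ) :
    ∫⁻ z, sumMax^[k] h z ^ q ≤ sumMaxConst m q ^ k * ∫⁻ z, h z ^ q := by
  induction k with
  | zero => simp
  | succ k ih =>
    rw [Function.iterate_succ_apply', pow_succ', mul_assoc]
    exact (lintegral_sumMax_rpow_le hq (measurable_iterate_sumMax hh k)).trans
      (mul_le_mul_right ih _)

/-- Jensen's inequality for the geometric weights `2 ^ -(k + 1)`. -/
lemma tsum_geometric_rpow_le {q : ℝ} (hq : 1 ≤ q) (a : ℕ → ℝ≥0∞) :
    (∑' k, (2⁻¹ : ℝ≥0∞) ^ (k + 1) * a k) ^ q ≤ ∑' k, (2⁻¹ : ℝ≥0∞) ^ (k + 1) * a k ^ q := by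
  have hq0 : 0 < q := by linarith
  set μ : Measure ℕ := Measure.sum fun k => ((2⁻¹ : ℝ≥0∞) ^ (k + 1)) • Measure.dirac k with hμ
  have hint : ∀ b : ℕ → ℝ≥0∞, ∫⁻ k, b k ∂μ = ∑' k, (2⁻¹ : ℝ≥0∞) ^ (k + 1) * b k := fun b => by
    rw [hμ, lintegral_sum_measure]
    simp
  have h1 := ENNReal.lintegral_mul_norm_pow_le (μ := μ) (f := fun k => a k ^ q) (g := fun _ => 1)
    (measurable_of_countable _).aemeasurable aemeasurable_const (p := 1 / q) (q := 1 - 1 / q)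
    (by positivity) (sub_nonneg.2 (by rw [div_le_one hq0]; exact hq)) (by ring)
  have hone : ∫⁻ _, (1 : ℝ≥0∞) ∂μ = 1 := by
    rw [hint]; simp only [mul_one]
    rw [ENNReal.tsum_geometric_add_one, ENNReal.one_sub_inv_two, inv_inv,
      ENNReal.inv_mul_cancel (by simp) (by simp)]
  have e : ∀ k, (a k ^ q) ^ (1 / q) = a k := fun k => by
    rw [← ENNReal.rpow_mul, mul_one_div_cancel hq0.ne', ENNReal.rpow_one]
  simp only [e, hone, ENNReal.one_rpow, mul_one] at h1
  rw [hint, hint] at h1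
  calc _ ≤ ((∑' k, (2⁻¹ : ℝ≥0∞) ^ (k + 1) * a k ^ q) ^ (1 / q)) ^ q :=
        ENNReal.rpow_le_rpow h1 hq0.le
    _ = _ := by rw [← ENNReal.rpow_mul, one_div_mul_cancel hq0.ne', ENNReal.rpow_one]

/-- The Rubio de Francia iteration: every positive function in `L^q` has a majorant of comparable
norm that is an `A₁` weight along almost every fibre in each of the three directions. -/
theorem exists_isA1_majorant (m : ℕ) {q : ℝ} (hq : 1 < q) : ∃ B : ℝ≥0,
    ∀ h : E m × E m → ℝ≥0∞, Measurable h → (∀ z, 0 < h z) → ∫⁻ z, h z ^ q ≠ ∞ →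
    ∃ v : E m × E m → ℝ, Measurable v ∧ (∀ z, 0 < v z) ∧ (∀ᵐ z, h z ≤ ENNReal.ofReal (v z)) ∧
      ∫⁻ z, ENNReal.ofReal (v z) ^ q ≤ 2 ^ q * ∫⁻ z, h z ^ q ∧
      ∀ i, ∀ᵐ y₁, IsA1 (fun y₂ => v (dirMap i (y₁, y₂))) B := by
  have hq0 : 0 < q := by linarith
  -- `N` bounds the norm of `sumMax` on `L^q`.
  set N : ℝ≥0∞ := sumMaxConst m q ^ (1 / q) with hN
  have hNt : N ≠ ∞ := (ENNReal.rpow_lt_top_of_nonneg (by positivity) (sumMaxConst_ne_top m hq)).ne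
  have hN0 : N ≠ 0 := by
    have : sumMaxConst m q ≠ 0 := by simp [sumMaxConst]
    rw [hN]; simp [this, hq0.le]
  have hNq : N ^ q = sumMaxConst m q := by
    rw [hN, ← ENNReal.rpow_mul, one_div_mul_cancel hq0.ne', ENNReal.rpow_one]
  clear_value N
  refine ⟨4 ^ m * (2 * N).toNNReal, fun h hh hpos hfin => ?_⟩
  set c : ℕ → ℝ≥0∞ := fun k => (2⁻¹ * N⁻¹) ^ k with hc
  have hct : ∀ k, c k ≠ ∞ := fun k =>
    ENNReal.pow_ne_top (ENNReal.mul_ne_top (by simp) (by simpa using hN0))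
  set v : E m × E m → ℝ≥0∞ := fun z => ∑' k, c k * sumMax^[k] h z with hv
  have hvm : Measurable v := Measurable.tsum fun k =>
    (measurable_iterate_sumMax hh k).const_mul _
  have hvh : ∀ z, h z ≤ v z := fun z => by
    refine le_trans ?_ (ENNReal.le_tsum 0)
    simp [hc]
  -- The maximal functions shift the series by one term.
  have hMv : ∀ i z, dirMax (dirVec i) v z ≤ 2 * N * v z := fun i z => by
    calc _ ≤ ∑' k, c k * dirMax (dirVec i) (sumMax^[k] h) z :=
          dirMax_tsum_le (isDirection_dir i).measurable (measurable_iterate_sumMax hh) hct z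
      _ ≤ ∑' k, 2 * N * (c (k + 1) * sumMax^[k + 1] h z) := by
          refine ENNReal.tsum_le_tsum fun k => ?_
          rw [Function.iterate_succ_apply', ← mul_assoc]
          have e : 2 * N * c (k + 1) = c k := by
            simp only [hc]
            rw [pow_succ, show 2 * N * ((2⁻¹ * N⁻¹) ^ k * (2⁻¹ * N⁻¹)) =
              (2 * 2⁻¹) * (N * N⁻¹) * (2⁻¹ * N⁻¹) ^ k by ring,
              ENNReal.mul_inv_cancel hN0 hNt, ENNReal.mul_inv_cancel (by simp) (by simp)]
            simp
          rw [e]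
          refine mul_le_mul_right ?_ _
          exact Finset.single_le_sum (f := fun i => dirMax (dirVec i) (sumMax^[k] h) z)
            (fun _ _ => zero_le) (Finset.mem_univ i)
      _ ≤ _ := by
          rw [ENNReal.tsum_mul_left]
          refine mul_le_mul_right ?_ _
          exact ENNReal.tsum_comp_le_tsum_of_injective (add_left_injective 1)
            (fun k => c k * sumMax^[k] h z)
  -- Each iterate has at most the norm of `h` after division by `N ^ k`; the weights `2 ^ -k` of the
  -- series have sum `2`.
  have hvq : ∫⁻ z, v z ^ q ≤ 2 ^ q * ∫⁻ z, h z ^ q := by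
    have e : ∀ z, v z = ∑' k, (2⁻¹ : ℝ≥0∞) ^ (k + 1) * (2 * N⁻¹ ^ k * sumMax^[k] h z) := fun z => by
      refine tsum_congr fun k => ?_
      simp only [hc]
      rw [mul_pow, pow_succ, show (2⁻¹ : ℝ≥0∞) ^ k * 2⁻¹ * (2 * N⁻¹ ^ k * sumMax^[k] h z) =
        (2⁻¹ * 2) * ((2⁻¹ : ℝ≥0∞) ^ k * N⁻¹ ^ k * sumMax^[k] h z) by ring,
        ENNReal.inv_mul_cancel (by simp) (by simp), one_mul]
    calc ∫⁻ z, v z ^ q ≤ ∫⁻ z, ∑' k, (2⁻¹ : ℝ≥0∞) ^ (k + 1) * (2 * N⁻¹ ^ k * sumMax^[k] h z) ^ q :=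
          lintegral_mono fun z => by
            simp only [e]
            exact tsum_geometric_rpow_le hq.le _
      _ = ∑' k, (2⁻¹ : ℝ≥0∞) ^ (k + 1) * ∫⁻ z, (2 * N⁻¹ ^ k * sumMax^[k] h z) ^ q := by
          rw [lintegral_tsum fun k => ((((measurable_iterate_sumMax hh k).const_mul _).pow_const
            q).const_mul _).aemeasurable]
          exact tsum_congr fun k => lintegral_const_mul' _ _ (ENNReal.pow_ne_top (by simp))
      _ ≤ ∑' k, (2⁻¹ : ℝ≥0∞) ^ (k + 1) * (2 ^ q * ∫⁻ z, h z ^ q) := by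
          refine ENNReal.tsum_le_tsum fun k => mul_le_mul_right ?_ _
          have h1 : ∀ z, (2 * N⁻¹ ^ k * sumMax^[k] h z) ^ q =
              2 ^ q * (sumMaxConst m q ^ k)⁻¹ * sumMax^[k] h z ^ q := fun z => by
            rw [ENNReal.mul_rpow_of_nonneg _ _ hq0.le, ENNReal.mul_rpow_of_nonneg _ _ hq0.le,
              ← ENNReal.inv_pow, ENNReal.inv_rpow, ← hNq, ← ENNReal.rpow_natCast, ← ENNReal.rpow_natCast,
              ← ENNReal.rpow_mul, ← ENNReal.rpow_mul, mul_comm q]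
          have hs0 : sumMaxConst m q ≠ 0 := by simp [sumMaxConst]
          have hk0 : sumMaxConst m q ^ k ≠ 0 := pow_ne_zero _ hs0
          have hkt : sumMaxConst m q ^ k ≠ ∞ := ENNReal.pow_ne_top (sumMaxConst_ne_top m hq)
          simp only [h1]
          rw [lintegral_const_mul' _ _ (ENNReal.mul_ne_top
            (ENNReal.rpow_lt_top_of_nonneg hq0.le (by simp)).ne (by simpa using hk0)), mul_assoc]
          refine mul_le_mul_right ?_ _
          rw [ENNReal.inv_mul_le_iff hk0 hkt]
          exact lintegral_iterate_sumMax_rpow_le hq hh k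
      _ = _ := by
          rw [ENNReal.tsum_mul_right, ENNReal.tsum_geometric_add_one, ENNReal.one_sub_inv_two,
            inv_inv, ENNReal.inv_mul_cancel (by simp) (by simp), one_mul]
  have hvfin : ∀ᵐ z, v z < ∞ := by
    have h2 : ∫⁻ z, v z ^ q ≠ ∞ := ne_top_of_le_ne_top (ENNReal.mul_ne_top
      (ENNReal.rpow_lt_top_of_nonneg hq0.le (by simp)).ne hfin) hvq
    filter_upwards [ae_lt_top (hvm.pow_const q) h2] with z hz
    by_contra hc'
    rw [not_lt, top_le_iff] at hc'
    rw [hc', ENNReal.top_rpow_of_pos hq0] at hz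
    exact lt_irrefl _ hz
  -- The values `∞`, taken on a null set, are replaced by `1`.
  have hS : MeasurableSet {z | v z = ∞} := hvm (measurableSet_singleton ∞)
  have hwm : Measurable fun z => if v z = ∞ then (1:ℝ) else (v z).toReal :=
    Measurable.ite hS measurable_const hvm.ennreal_toReal
  have hw0 : ∀ z, 0 < if v z = ∞ then (1:ℝ) else (v z).toReal := fun z => by
    split_ifs with hz
    · norm_num
    · exact ENNReal.toReal_pos ((hpos z).trans_le (hvh z)).ne' hz
  have hwv : ∀ z, v z < ∞ → ENNReal.ofReal (if v z = ∞ then (1:ℝ) else (v z).toReal) = v z :=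
    fun z hz => by rw [if_neg hz.ne, ENNReal.ofReal_toReal hz.ne]
  refine ⟨fun z => if v z = ∞ then 1 else (v z).toReal, hwm, hw0, ?_, ?_, fun i => ?_⟩
  · filter_upwards [hvfin] with z hz
    rw [hwv z hz]; exact hvh z
  · refine le_trans (le_of_eq (lintegral_congr_ae ?_)) hvq
    filter_upwards [hvfin] with z hz
    rw [hwv z hz]
  · have hT := isDirection_dir (m := m) i
    filter_upwards [hT.ae_ae hvfin] with y₁ hy₁
    refine isA1_of_hlMax_le (g := fun y₂ => v (dirMap i (y₁, y₂))) (fun y₂ => ?_)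
      (hT.measurable_slice hwm y₁) (fun y₂ => hw0 _) ?_
    · rw [← hT.dirMax_apply, ENNReal.coe_toNNReal (ENNReal.mul_ne_top (by simp) hNt)]
      exact hMv i _
    · filter_upwards [hy₁] with y₂ hy₂
      exact hwv _ hy₂

/-! ### Twisted convolutions as iterated directional convolutions -/

instance : (volume : Measure (E m × E m)).IsAddHaarMeasure :=
  inferInstanceAs ((volume : Measure (E m)).prod (volume : Measure (E m))).IsAddHaarMeasure

instance : (volume : Measure (E m × E m)).IsNegInvariant :=
  ⟨((Measure.measurePreserving_neg (volume : Measure (E m))).prod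
    (Measure.measurePreserving_neg (volume : Measure (E m)))).map_eq⟩

/-- The convolution of `f` with `φ_r` along the translates of `ι`. -/
def dirSmear (ι : E m → E m × E m) (φ : E m → ℂ) (r : ℝ) (f : E m × E m → ℂ) (z : E m × E m) : ℂ :=
  ∫ s, dilate φ r s * f (z - ι s)

lemma IsDirection.dirSmear_apply {T : E m × E m → E m × E m} {ι : E m → E m × E m}
    (hT : IsDirection T ι) (φ : E m → ℂ) (r : ℝ) (f : E m × E m → ℂ) (y₁ y₂ : E m) :
    dirSmear ι φ r f (T (y₁, y₂)) = smear φ r (fun y => f (T (y₁, y))) y₂ := by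
  simp only [dirSmear, smear, hT.map_sub]

lemma measurable_dirSmear {S : Type*} [MeasurableSpace S] {ι : E m → E m × E m} (hι : Measurable ι)
    {φ : E m → ℂ} (hφ : Measurable φ) {f : S → E m × E m → ℂ}
    (hf : Measurable fun p : S × (E m × E m) => f p.1 p.2) :
    Measurable fun p : (ℝ × S) × (E m × E m) => dirSmear ι φ p.1.1 (f p.1.2) p.2 := by
  have h1 : Measurable fun q : ((ℝ × S) × (E m × E m)) × E m => dilate φ q.1.1.1 q.2 :=
    (measurable_dilate hφ).comp (measurable_fst.fst.fst.prodMk measurable_snd)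
  have h2 : Measurable fun q : ((ℝ × S) × (E m × E m)) × E m => f q.1.1.2 (q.1.2 - ι q.2) :=
    hf.comp (f := fun q : ((ℝ × S) × (E m × E m)) × E m => (q.1.1.2, q.1.2 - ι q.2)) (by fun_prop)
  exact (h1.mul h2).stronglyMeasurable.integral_prod_right.measurable

lemma norm_dirSmear_le (ι : E m → E m × E m) {φ : E m → ℂ} (hφ : Integrable φ) {r : ℝ}
    (hr : 0 < r) {f : E m × E m → ℂ} {D : ℝ} (hD : ∀ z, ‖f z‖ ≤ D) (z : E m × E m) :
    ‖dirSmear ι φ r f z‖ ≤ ∫ s, ‖dilate φ r s‖ * D := by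
  refine norm_integral_le_of_norm_le ((integrable_dilate hφ hr).norm.mul_const D)
    (ae_of_all _ fun s => ?_)
  rw [norm_mul]
  exact mul_le_mul_of_nonneg_left (hD _) (norm_nonneg _)

/-- The push-forward as a function of its three factors. -/
lemma pushforward_tensor (a b c : E m → ℂ) (y : E m × E m) :
    pushforward (tensor a b c) y = ∫ u, a (y.1 - u) * b (y.2 - u) * c u := rfl

/-- Subtraction of the diagonal vector `(u, u)` preserves the measure. -/
lemma measurePreserving_diagonal_shear :
    MeasurePreserving (fun p : (E m × E m) × E m => (p.1 - (p.2, p.2), p.2))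
      (volume.prod volume) (volume.prod volume) := by
  have hskew : MeasurePreserving (fun p : E m × (E m × E m) => (p.1, p.2 - (p.1, p.1)))
      (volume.prod volume) (volume.prod volume) := by
    refine (MeasurePreserving.id (volume : Measure (E m))).skew_product (g := fun u y => y - (u, u))
      (by unfold Function.uncurry; fun_prop) (ae_of_all _ fun u => ?_)
    exact (measurePreserving_sub_right volume (u, u)).map_eq
  exact Measure.measurePreserving_swap.comp (hskew.comp Measure.measurePreserving_swap)

lemma integrable_tensor_mul {a b c : E m → ℂ} (ha : Integrable a) (hb : Integrable b)
    (hc : Integrable c) {f : E m × E m → ℂ} (hf : Measurable f) {D : ℝ} (hD : ∀ z, ‖f z‖ ≤ D)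
    (x : E m × E m) :
    Integrable (fun p : (E m × E m) × E m => a p.1.1 * b p.1.2 * c p.2 * f (x - p.1 - (p.2, p.2)))
      (volume.prod volume) := by
  have h : Integrable (fun p : (E m × E m) × E m => a p.1.1 * b p.1.2 * c p.2)
      ((volume.prod volume).prod volume) := (ha.mul_prod hb).mul_prod hc
  exact h.mul_bdd (hf.comp (by fun_prop)).aestronglyMeasurable (ae_of_all _ fun p => hD _)

lemma integrable_fibre_mul {a b c : E m → ℂ} (ha : Integrable a) (hb : Integrable b)
    (hc : Integrable c) {f : E m × E m → ℂ} (hf : Measurable f) {D : ℝ} (hD : ∀ z, ‖f z‖ ≤ D)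
    (x : E m × E m) :
    Integrable (fun p : (E m × E m) × E m => a (p.1.1 - p.2) * b (p.1.2 - p.2) * c p.2 * f (x - p.1))
      (volume.prod volume) := by
  refine (measurePreserving_diagonal_shear.integrable_comp_of_integrable
    (integrable_tensor_mul ha hb hc hf hD x)).congr (ae_of_all _ fun p => ?_)
  simp only [Function.comp_apply, Prod.fst_sub, Prod.snd_sub]
  rw [sub_sub, sub_add_cancel]

lemma conv_eq_sub (f k : E m × E m → ℂ) (x : E m × E m) : conv f k x = ∫ y, f (x - y) * k y := by
  rw [conv, ← integral_sub_left_eq_self _ volume x]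
  simp only [sub_sub_cancel]

/-- Convolution with a push-forward is an iterated convolution along the three directions. -/
lemma conv_pushforward_tensor {a b c : E m → ℂ} (ha : Integrable a) (hb : Integrable b)
    (hc : Integrable c) {f : E m × E m → ℂ} (hf : Measurable f) {D : ℝ} (hD : ∀ z, ‖f z‖ ≤ D)
    (x : E m × E m) :
    conv f (pushforward (tensor a b c)) x =
      ∫ s₁, a s₁ * ∫ s₂, b s₂ * ∫ s₃, c s₃ * f (x - (s₁, 0) - (0, s₂) - (s₃, s₃)) := by
  have h1 := integrable_fibre_mul ha hb hc hf hD x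
  have h2 := integrable_tensor_mul ha hb hc hf hD x
  calc conv f (pushforward (tensor a b c)) x
      = ∫ y : E m × E m, ∫ u, a (y.1 - u) * b (y.2 - u) * c u * f (x - y) := by
        rw [conv_eq_sub]
        refine integral_congr_ae (ae_of_all _ fun y => ?_)
        simp only [pushforward_tensor]
        rw [integral_mul_const, mul_comm]
    _ = ∫ u, ∫ y : E m × E m, a (y.1 - u) * b (y.2 - u) * c u * f (x - y) :=
        integral_integral_swap (f := fun (y : E m × E m) u =>
          a (y.1 - u) * b (y.2 - u) * c u * f (x - y)) h1
    _ = ∫ u, ∫ y : E m × E m, a y.1 * b y.2 * c u * f (x - y - (u, u)) := by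
        refine integral_congr_ae (ae_of_all _ fun u => ?_)
        simp only
        rw [← integral_add_right_eq_self _ (u, u)]
        simp only [Prod.fst_add, Prod.snd_add, add_sub_cancel_right, sub_sub]
    _ = ∫ y : E m × E m, ∫ u, a y.1 * b y.2 * c u * f (x - y - (u, u)) :=
        (integral_integral_swap (f := fun (y : E m × E m) u =>
          a y.1 * b y.2 * c u * f (x - y - (u, u))) h2).symm
    _ = ∫ s₁, ∫ s₂, ∫ u, a s₁ * b s₂ * c u * f (x - (s₁, s₂) - (u, u)) := by
        rw [Measure.volume_eq_prod, integral_prod]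
        exact h2.integral_prod_left
    _ = _ := by
        refine integral_congr_ae (ae_of_all _ fun s₁ => ?_)
        simp only
        rw [← integral_const_mul]
        refine integral_congr_ae (ae_of_all _ fun s₂ => ?_)
        simp only
        rw [← integral_const_mul, ← integral_const_mul]
        refine integral_congr_ae (ae_of_all _ fun s₃ => ?_)
        have : x - (s₁, s₂) = x - (s₁, 0) - (0, s₂) := by ext <;> simp
        simp only [this]
        ring

/-- The iterated directional convolution with parameter `r`. -/
def iterSmear (φ₁ φ₂ φ₃ : E m → ℂ) (r : ℝ × ℝ × ℝ) (f : E m × E m → ℂ) : E m × E m → ℂ :=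
  dirSmear (dirVec 0) φ₁ r.1 (dirSmear (dirVec 1) φ₂ r.2.1 (dirSmear (dirVec 2) φ₃ r.2.2 f))

/-- Convolution with a twisted dilate is the iterated convolution along the two coordinate subspaces
and the diagonal. -/
lemma conv_twistedDilate {φ₁ φ₂ φ₃ : E m → ℂ} (h₁ : Integrable φ₁) (h₂ : Integrable φ₂)
    (h₃ : Integrable φ₃) {r : ℝ × ℝ × ℝ} (hr : r ∈ Ioi (0 : ℝ) ×ˢ Ioi (0 : ℝ) ×ˢ Ioi (0 : ℝ))
    {f : E m × E m → ℂ} (hf : Measurable f) {D : ℝ} (hD : ∀ z, ‖f z‖ ≤ D) (x : E m × E m) :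
    conv f (twistedDilate φ₁ φ₂ φ₃ r) x = iterSmear φ₁ φ₂ φ₃ r f x :=
  conv_pushforward_tensor (integrable_dilate h₁ hr.1) (integrable_dilate h₂ hr.2.1)
    (integrable_dilate h₃ hr.2.2) hf hD x

/-! ### The weighted estimate for the twisted square function -/

/-- The weighted one-parameter estimate along the fibres of a direction. -/
lemma IsDirection.lintegral_dirSmear_le {T : E m × E m → E m × E m} {ι : E m → E m × E m}
    (hT : IsDirection T ι) {φ : E m → ℂ} (hφ : Measurable φ) {K : ℝ≥0} {C : ℝ≥0∞} (hCt : C ≠ ∞)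
    (hC : ∀ w : E m → ℝ, IsA2 w K → ∀ f : E m → ℂ, Measurable f → ∀ D : ℝ, (∀ x, ‖f x‖ ≤ D) →
      ∫⁻ r in Ioi (0 : ℝ), (∫⁻ x, ‖smear φ r f x‖ₑ ^ 2 * ENNReal.ofReal (w x)) * (ENNReal.ofReal r)⁻¹
        ≤ C * ∫⁻ x, ‖f x‖ₑ ^ 2 * ENNReal.ofReal (w x))
    {v : E m × E m → ℝ} (hv : Measurable v) (hA : ∀ᵐ y₁, IsA2 (fun y₂ => v (T (y₁, y₂))) K)
    {f : E m × E m → ℂ} (hf : Measurable f) {D : ℝ} (hD : ∀ z, ‖f z‖ ≤ D) :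
    ∫⁻ r in Ioi (0 : ℝ), (∫⁻ z, ‖dirSmear ι φ r f z‖ₑ ^ 2 * ENNReal.ofReal (v z)) *
      (ENNReal.ofReal r)⁻¹ ≤ C * ∫⁻ z, ‖f z‖ₑ ^ 2 * ENNReal.ofReal (v z) := by
  have hvm := hv.ennreal_ofReal
  have hsm : Measurable fun p : ℝ × (E m × E m) => dirSmear ι φ p.1 f p.2 := by
    have := measurable_dirSmear (S := Unit) hT.measurable hφ (f := fun _ => f) (by fun_prop)
    exact this.comp (f := fun p : ℝ × (E m × E m) => ((p.1, ()), p.2)) (by fun_prop)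
  have hTm := hT.measurePreserving.measurable
  have hJ : Measurable fun p : ℝ × (E m × E m) =>
      ‖dirSmear ι φ p.1 f (T p.2)‖ₑ ^ 2 * ENNReal.ofReal (v (T p.2)) := by
    refine Measurable.mul (Measurable.pow_const ?_ 2) (hvm.comp (hTm.comp measurable_snd))
    exact (hsm.comp (measurable_fst.prodMk (hTm.comp measurable_snd))).enorm
  have hJ2 : Measurable fun p : (ℝ × E m) × E m =>
      ‖dirSmear ι φ p.1.1 f (T (p.1.2, p.2))‖ₑ ^ 2 * ENNReal.ofReal (v (T (p.1.2, p.2))) :=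
    hJ.comp (f := fun p : (ℝ × E m) × E m => (p.1.1, (p.1.2, p.2))) (by fun_prop)
  have hJ3 : Measurable fun p : ℝ × E m => ∫⁻ y₂,
      ‖dirSmear ι φ p.1 f (T (p.2, y₂))‖ₑ ^ 2 * ENNReal.ofReal (v (T (p.2, y₂))) :=
    hJ2.lintegral_prod_right'
  calc ∫⁻ r in Ioi (0 : ℝ), (∫⁻ z, ‖dirSmear ι φ r f z‖ₑ ^ 2 * ENNReal.ofReal (v z)) *
        (ENNReal.ofReal r)⁻¹
      = ∫⁻ r in Ioi (0 : ℝ), ∫⁻ y₁, (∫⁻ y₂, ‖dirSmear ι φ r f (T (y₁, y₂))‖ₑ ^ 2 *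
          ENNReal.ofReal (v (T (y₁, y₂)))) * (ENNReal.ofReal r)⁻¹ := by
        refine setLIntegral_congr_fun measurableSet_Ioi fun r hr => ?_
        have h1 : Measurable fun z => ‖dirSmear ι φ r f z‖ₑ ^ 2 * ENNReal.ofReal (v z) :=
          ((hsm.comp measurable_prodMk_left).enorm.pow_const 2).mul hvm
        have hr0 : (ENNReal.ofReal r)⁻¹ ≠ ∞ := by simpa using hr
        rw [lintegral_mul_const' _ _ hr0, hT.lintegral_eq h1]
    _ = ∫⁻ y₁, ∫⁻ r in Ioi (0 : ℝ), (∫⁻ y₂, ‖dirSmear ι φ r f (T (y₁, y₂))‖ₑ ^ 2 *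
          ENNReal.ofReal (v (T (y₁, y₂)))) * (ENNReal.ofReal r)⁻¹ := by
        refine lintegral_lintegral_swap (Measurable.aemeasurable ?_)
        exact hJ3.mul (by fun_prop)
    _ ≤ ∫⁻ y₁, C * ∫⁻ y₂, ‖f (T (y₁, y₂))‖ₑ ^ 2 * ENNReal.ofReal (v (T (y₁, y₂))) := by
        refine lintegral_mono_ae ?_
        filter_upwards [hA] with y₁ hy₁
        simp only [hT.dirSmear_apply]
        exact hC _ hy₁ _ (hT.measurable_slice hf y₁) D fun _ => hD _
    _ = _ := by
        have h1 : Measurable fun z => ‖f z‖ₑ ^ 2 * ENNReal.ofReal (v z) :=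
          (hf.enorm.pow_const 2).mul hvm
        rw [lintegral_const_mul' _ _ hCt, hT.lintegral_eq h1]

lemma measurable_dirSmear₁ {ι : E m → E m × E m} (hι : Measurable ι) {φ : E m → ℂ}
    (hφ : Measurable φ) (r : ℝ) {f : E m × E m → ℂ} (hf : Measurable f) :
    Measurable (dirSmear ι φ r f) := by
  have := measurable_dirSmear (S := Unit) hι hφ (f := fun _ => f) (by fun_prop)
  exact this.comp (f := fun z : E m × E m => ((r, ()), z)) (by fun_prop)

lemma measurable_iterSmear {φ₁ φ₂ φ₃ : E m → ℂ} (h₁ : Measurable φ₁) (h₂ : Measurable φ₂)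
    (h₃ : Measurable φ₃) {f : E m × E m → ℂ} (hf : Measurable f) :
    Measurable fun p : (ℝ × ℝ × ℝ) × (E m × E m) => iterSmear φ₁ φ₂ φ₃ p.1 f p.2 := by
  have hd := fun i => (isDirection_dir (m := m) i).measurable
  have m3 := measurable_dirSmear (S := Unit) (hd 2) h₃ (f := fun _ => f) (by fun_prop)
  have m3' : Measurable fun p : ℝ × (E m × E m) => dirSmear (dirVec 2) φ₃ p.1 f p.2 :=
    m3.comp (f := fun p : ℝ × (E m × E m) => ((p.1, ()), p.2)) (by fun_prop)
  have m2 : Measurable fun p : (ℝ × ℝ) × (E m × E m) =>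
      dirSmear (dirVec 1) φ₂ p.1.1 (dirSmear (dirVec 2) φ₃ p.1.2 f) p.2 :=
    measurable_dirSmear (hd 1) h₂ (f := fun r => dirSmear (dirVec 2) φ₃ r f) m3'
  exact measurable_dirSmear (hd 0) h₁
    (f := fun r : ℝ × ℝ => dirSmear (dirVec 1) φ₂ r.1 (dirSmear (dirVec 2) φ₃ r.2 f)) m2

lemma squareFunction_sq (φ₁ φ₂ φ₃ : E m → ℂ) (f : E m × E m → ℂ) (x : E m × E m) :
    squareFunction φ₁ φ₂ φ₃ f x ^ 2 = ∫⁻ r in Ioi (0 : ℝ) ×ˢ Ioi (0 : ℝ) ×ˢ Ioi (0 : ℝ),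
      ‖conv f (twistedDilate φ₁ φ₂ φ₃ r) x‖ₑ ^ 2 / ENNReal.ofReal (r.1 * r.2.1 * r.2.2) := by
  rw [squareFunction, ← ENNReal.rpow_natCast, ← ENNReal.rpow_mul]
  norm_num

lemma setLIntegral_octant (F : ℝ × ℝ × ℝ → ℝ≥0∞) (hF : Measurable F) :
    ∫⁻ r in Ioi (0 : ℝ) ×ˢ Ioi (0 : ℝ) ×ˢ Ioi (0 : ℝ), F r =
      ∫⁻ r₃ in Ioi (0 : ℝ), ∫⁻ r₂ in Ioi (0 : ℝ), ∫⁻ r₁ in Ioi (0 : ℝ), F (r₁, r₂, r₃) := by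
  rw [Measure.volume_eq_prod, ← Measure.prod_restrict, lintegral_prod_symm' _ hF,
    Measure.volume_eq_prod, ← Measure.prod_restrict, lintegral_prod_symm']
  exact hF.lintegral_prod_left'

/-- Three one-parameter estimates combine to a three-parameter estimate. -/
lemma lintegral_octant_le_of_forall {G : ℝ → ℝ → ℝ → ℝ≥0∞} {H : ℝ → ℝ → ℝ≥0∞} {I : ℝ → ℝ≥0∞}
    {J C₁ C₂ C₃ : ℝ≥0∞} (hC₁ : C₁ ≠ ∞) (hC₂ : C₂ ≠ ∞)
    (h₁ : ∀ r₂ r₃, 0 < r₂ → 0 < r₃ →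
      ∫⁻ r₁ in Ioi (0 : ℝ), G r₁ r₂ r₃ * (ENNReal.ofReal r₁)⁻¹ ≤ C₁ * H r₂ r₃)
    (h₂ : ∀ r₃, 0 < r₃ → ∫⁻ r₂ in Ioi (0 : ℝ), H r₂ r₃ * (ENNReal.ofReal r₂)⁻¹ ≤ C₂ * I r₃)
    (h₃ : ∫⁻ r₃ in Ioi (0 : ℝ), I r₃ * (ENNReal.ofReal r₃)⁻¹ ≤ C₃ * J) :
    ∫⁻ r₃ in Ioi (0 : ℝ), ∫⁻ r₂ in Ioi (0 : ℝ), ∫⁻ r₁ in Ioi (0 : ℝ), G r₁ r₂ r₃ *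
      (ENNReal.ofReal r₁)⁻¹ * ((ENNReal.ofReal r₂)⁻¹ * (ENNReal.ofReal r₃)⁻¹) ≤
        C₁ * (C₂ * (C₃ * J)) := by
  have hinv : ∀ r : ℝ, r ∈ Ioi (0:ℝ) → (ENNReal.ofReal r)⁻¹ ≠ ∞ := fun r hr => by simpa using hr
  calc _ ≤ ∫⁻ r₃ in Ioi (0 : ℝ), ∫⁻ r₂ in Ioi (0 : ℝ), C₁ * (H r₂ r₃ * (ENNReal.ofReal r₂)⁻¹ *
            (ENNReal.ofReal r₃)⁻¹) := by
        refine setLIntegral_mono' measurableSet_Ioi fun r₃ hr₃ =>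
          setLIntegral_mono' measurableSet_Ioi fun r₂ hr₂ => ?_
        rw [lintegral_mul_const' _ _ (ENNReal.mul_ne_top (hinv _ hr₂) (hinv _ hr₃)),
          mul_assoc (H r₂ r₃), ← mul_assoc C₁]
        exact mul_le_mul_left (h₁ r₂ r₃ hr₂ hr₃) _
    _ ≤ ∫⁻ r₃ in Ioi (0 : ℝ), C₁ * (C₂ * (I r₃ * (ENNReal.ofReal r₃)⁻¹)) := by
        refine setLIntegral_mono' measurableSet_Ioi fun r₃ hr₃ => ?_
        rw [lintegral_const_mul' _ _ hC₁, lintegral_mul_const' _ _ (hinv _ hr₃), ← mul_assoc C₂]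
        exact mul_le_mul_right (mul_le_mul_left (h₂ r₃ hr₃) _) _
    _ ≤ _ := by
        rw [lintegral_const_mul' _ _ hC₁, lintegral_const_mul' _ _ hC₂]
        exact mul_le_mul_right (mul_le_mul_right h₃ _) _

lemma measurableSet_octant :
    MeasurableSet (Ioi (0 : ℝ) ×ˢ Ioi (0 : ℝ) ×ˢ Ioi (0 : ℝ)) :=
  measurableSet_Ioi.prod (measurableSet_Ioi.prod measurableSet_Ioi)

/-- The weighted `L²` norm of the square function as an iterated integral over the three scales. -/
lemma lintegral_squareFunction_sq_mul {φ₁ φ₂ φ₃ : E m → ℂ} (h₁ : Measurable φ₁)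
    (h₂ : Measurable φ₂) (h₃ : Measurable φ₃) (i₁ : Integrable φ₁) (i₂ : Integrable φ₂)
    (i₃ : Integrable φ₃) {f : E m × E m → ℂ} (hf : Measurable f) {D : ℝ} (hD : ∀ z, ‖f z‖ ≤ D)
    {v : E m × E m → ℝ} (hv : Measurable v) :
    ∫⁻ z, squareFunction φ₁ φ₂ φ₃ f z ^ 2 * ENNReal.ofReal (v z) =
      ∫⁻ r₃ in Ioi (0 : ℝ), ∫⁻ r₂ in Ioi (0 : ℝ), ∫⁻ r₁ in Ioi (0 : ℝ),
        (∫⁻ z, ‖iterSmear φ₁ φ₂ φ₃ (r₁, r₂, r₃) f z‖ₑ ^ 2 * ENNReal.ofReal (v z)) *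
          (ENNReal.ofReal r₁)⁻¹ * ((ENNReal.ofReal r₂)⁻¹ * (ENNReal.ofReal r₃)⁻¹) := by
  have hG : Measurable fun p : (ℝ × ℝ × ℝ) × (E m × E m) =>
      ‖iterSmear φ₁ φ₂ φ₃ p.1 f p.2‖ₑ ^ 2 * ENNReal.ofReal (v p.2) :=
    ((measurable_iterSmear h₁ h₂ h₃ hf).enorm.pow_const 2).mul
      (hv.ennreal_ofReal.comp measurable_snd)
  obtain ⟨G, hGe⟩ : ∃ G : ℝ × ℝ × ℝ → E m × E m → ℝ≥0∞, ∀ r z, G r z =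
    ‖iterSmear φ₁ φ₂ φ₃ r f z‖ₑ ^ 2 * ENNReal.ofReal (v z) := ⟨_, fun _ _ => rfl⟩
  have hsq : ∀ z, squareFunction φ₁ φ₂ φ₃ f z ^ 2 * ENNReal.ofReal (v z) =
      ∫⁻ r in Ioi (0 : ℝ) ×ˢ Ioi (0 : ℝ) ×ˢ Ioi (0 : ℝ), G r z * ((ENNReal.ofReal r.1)⁻¹ *
            ((ENNReal.ofReal r.2.1)⁻¹ * (ENNReal.ofReal r.2.2)⁻¹)) := fun z => by
    rw [squareFunction_sq, ← lintegral_mul_const' _ _ ENNReal.ofReal_ne_top]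
    refine setLIntegral_congr_fun measurableSet_octant fun r hr => ?_
    have p1 : 0 < r.1 := hr.1
    have p2 : 0 < r.2.1 := hr.2.1
    rw [hGe, conv_twistedDilate i₁ i₂ i₃ hr hf hD, ENNReal.ofReal_mul (by positivity),
      ENNReal.ofReal_mul p1.le, div_eq_mul_inv,
      ENNReal.mul_inv (Or.inr ENNReal.ofReal_ne_top)
        (Or.inl (ENNReal.mul_ne_top ENNReal.ofReal_ne_top ENNReal.ofReal_ne_top)),
      ENNReal.mul_inv (by simp) (by simp)]
    ring
  have hGm : Measurable fun p : (ℝ × ℝ × ℝ) × (E m × E m) => G p.1 p.2 := by simpa only [hGe]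
  simp only [← hGe, hsq]
  clear hsq hGe hG
  have hG1 : Measurable fun r : ℝ × ℝ × ℝ => ∫⁻ z, G r z := hGm.lintegral_prod_right'
  have hinv : ∀ r : ℝ, r ∈ Ioi (0:ℝ) → (ENNReal.ofReal r)⁻¹ ≠ ∞ := fun r hr => by simpa using hr
  have hmeas : Measurable fun p : (E m × E m) × (ℝ × ℝ × ℝ) => G p.2 p.1 *
      ((ENNReal.ofReal p.2.1)⁻¹ * ((ENNReal.ofReal p.2.2.1)⁻¹ * (ENNReal.ofReal p.2.2.2)⁻¹)) :=
    (hGm.comp (measurable_swap (α := E m × E m) (β := ℝ × ℝ × ℝ))).mul (by fun_prop)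
  rw [lintegral_lintegral_swap hmeas.aemeasurable]
  have e : ∫⁻ r in Ioi (0 : ℝ) ×ˢ Ioi (0 : ℝ) ×ˢ Ioi (0 : ℝ), ∫⁻ z, G r z *
        ((ENNReal.ofReal r.1)⁻¹ * ((ENNReal.ofReal r.2.1)⁻¹ * (ENNReal.ofReal r.2.2)⁻¹)) =
      ∫⁻ r in Ioi (0 : ℝ) ×ˢ Ioi (0 : ℝ) ×ˢ Ioi (0 : ℝ), (∫⁻ z, G r z) * (ENNReal.ofReal r.1)⁻¹ *
        ((ENNReal.ofReal r.2.1)⁻¹ * (ENNReal.ofReal r.2.2)⁻¹) := by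
    refine setLIntegral_congr_fun measurableSet_octant fun r hr => ?_
    rw [lintegral_mul_const' _ _ (ENNReal.mul_ne_top (hinv _ hr.1)
      (ENNReal.mul_ne_top (hinv _ hr.2.1) (hinv _ hr.2.2))), mul_assoc]
  rw [e]
  refine setLIntegral_octant (fun r : ℝ × ℝ × ℝ => (∫⁻ z, G r z) * (ENNReal.ofReal r.1)⁻¹ *
        ((ENNReal.ofReal r.2.1)⁻¹ * (ENNReal.ofReal r.2.2)⁻¹)) ?_
  exact (hG1.mul (by fun_prop)).mul (by fun_prop)

/-- The twisted square function is bounded on `L²(v)` for weights `v` that satisfy the `A₂`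
condition along almost every fibre in each of the three directions. -/
theorem exists_lintegral_squareFunction_le (φ₁ φ₂ φ₃ : 𝓢(E m, ℂ)) (h₁ : ∫ x, φ₁ x = 0)
    (h₂ : ∫ x, φ₂ x = 0) (h₃ : ∫ x, φ₃ x = 0) (K : ℝ≥0) :
    ∃ C : ℝ≥0∞, C ≠ ∞ ∧ ∀ v : E m × E m → ℝ, Measurable v →
      (∀ i, ∀ᵐ y₁, IsA2 (fun y₂ => v (dirMap i (y₁, y₂))) K) → ∀ f : E m × E m → ℂ,
      Measurable f → ∀ D : ℝ, (∀ z, ‖f z‖ ≤ D) →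
      ∫⁻ z, squareFunction φ₁ φ₂ φ₃ f z ^ 2 * ENNReal.ofReal (v z) ≤
        C * ∫⁻ z, ‖f z‖ₑ ^ 2 * ENNReal.ofReal (v z) := by
  obtain ⟨C₁, hC₁, H₁⟩ := exists_lintegral_smear_le φ₁ h₁ K
  obtain ⟨C₂, hC₂, H₂⟩ := exists_lintegral_smear_le φ₂ h₂ K
  obtain ⟨C₃, hC₃, H₃⟩ := exists_lintegral_smear_le φ₃ h₃ K
  have i₁ : Integrable φ₁ := φ₁.integrable
  have i₂ : Integrable φ₂ := φ₂.integrable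
  have i₃ : Integrable φ₃ := φ₃.integrable
  have m₁ : Measurable φ₁ := φ₁.continuous.measurable
  have m₂ : Measurable φ₂ := φ₂.continuous.measurable
  have m₃ : Measurable φ₃ := φ₃.continuous.measurable
  refine ⟨C₁ * (C₂ * C₃), ENNReal.mul_ne_top hC₁.ne (ENNReal.mul_ne_top hC₂.ne hC₃.ne),
    fun v hv hA f hf D hD => ?_⟩
  have hd := fun i => isDirection_dir (m := m) i
  have hf₃ := fun r => measurable_dirSmear₁ (hd 2).measurable m₃ r hf
  have hD₃ := fun r (hr : 0 < r) => norm_dirSmear_le (dirVec 2) i₃ hr hD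
  have k₁ := fun (r₂ r₃ : ℝ) (hr₂ : 0 < r₂) (hr₃ : 0 < r₃) =>
    (hd 0).lintegral_dirSmear_le m₁ hC₁.ne H₁ hv (hA 0)
      (measurable_dirSmear₁ (hd 1).measurable m₂ r₂ (hf₃ r₃)) (norm_dirSmear_le _ i₂ hr₂ (hD₃ r₃ hr₃))
  have k₂ := fun (r₃ : ℝ) (hr₃ : 0 < r₃) =>
    (hd 1).lintegral_dirSmear_le m₂ hC₂.ne H₂ hv (hA 1) (hf₃ r₃) (hD₃ r₃ hr₃)
  have k₃ := (hd 2).lintegral_dirSmear_le m₃ hC₃.ne H₃ hv (hA 2) hf hD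
  rw [lintegral_squareFunction_sq_mul m₁ m₂ m₃ i₁ i₂ i₃ hf hD hv, mul_assoc C₁, mul_assoc C₂]
  simp only [iterSmear]
  exact lintegral_octant_le_of_forall hC₁.ne hC₂.ne k₁ k₂ k₃

/-! ### Boundedness of the square function on `L^p` -/

lemma measurable_twistedDilate {φ₁ φ₂ φ₃ : E m → ℂ} (h₁ : Measurable φ₁) (h₂ : Measurable φ₂)
    (h₃ : Measurable φ₃) :
    Measurable fun p : (ℝ × ℝ × ℝ) × (E m × E m) => twistedDilate φ₁ φ₂ φ₃ p.1 p.2 := by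
  have a : Measurable fun q : ((ℝ × ℝ × ℝ) × (E m × E m)) × E m =>
      dilate φ₁ q.1.1.1 (q.1.2.1 - q.2) :=
    (measurable_dilate h₁).comp (f := fun q : ((ℝ × ℝ × ℝ) × (E m × E m)) × E m =>
      (q.1.1.1, q.1.2.1 - q.2)) (by fun_prop)
  have b : Measurable fun q : ((ℝ × ℝ × ℝ) × (E m × E m)) × E m =>
      dilate φ₂ q.1.1.2.1 (q.1.2.2 - q.2) :=
    (measurable_dilate h₂).comp (f := fun q : ((ℝ × ℝ × ℝ) × (E m × E m)) × E m =>
      (q.1.1.2.1, q.1.2.2 - q.2)) (by fun_prop)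
  have c : Measurable fun q : ((ℝ × ℝ × ℝ) × (E m × E m)) × E m =>
      dilate φ₃ q.1.1.2.2 q.2 :=
    (measurable_dilate h₃).comp (f := fun q : ((ℝ × ℝ × ℝ) × (E m × E m)) × E m =>
      (q.1.1.2.2, q.2)) (by fun_prop)
  exact ((a.mul b).mul c).stronglyMeasurable.integral_prod_right.measurable

lemma measurable_conv_twistedDilate {φ₁ φ₂ φ₃ : E m → ℂ} (h₁ : Measurable φ₁) (h₂ : Measurable φ₂)
    (h₃ : Measurable φ₃) {f : E m × E m → ℂ} (hf : Measurable f) :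
    Measurable fun p : (E m × E m) × (ℝ × ℝ × ℝ) => conv f (twistedDilate φ₁ φ₂ φ₃ p.2) p.1 := by
  have a : Measurable fun q : ((E m × E m) × (ℝ × ℝ × ℝ)) × (E m × E m) =>
      twistedDilate φ₁ φ₂ φ₃ q.1.2 (q.1.1 - q.2) :=
    (measurable_twistedDilate h₁ h₂ h₃).comp
      (f := fun q : ((E m × E m) × (ℝ × ℝ × ℝ)) × (E m × E m) => (q.1.2, q.1.1 - q.2)) (by fun_prop)
  exact ((hf.comp measurable_snd).mul a).stronglyMeasurable.integral_prod_right.measurable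

lemma measurable_squareFunction {φ₁ φ₂ φ₃ : E m → ℂ} (h₁ : Measurable φ₁) (h₂ : Measurable φ₂)
    (h₃ : Measurable φ₃) {f : E m × E m → ℂ} (hf : Measurable f) :
    Measurable (squareFunction φ₁ φ₂ φ₃ f) := by
  have h : Measurable fun p : (E m × E m) × (ℝ × ℝ × ℝ) =>
      ‖conv f (twistedDilate φ₁ φ₂ φ₃ p.2) p.1‖ₑ ^ 2 / ENNReal.ofReal (p.2.1 * p.2.2.1 * p.2.2.2) :=
    ((measurable_conv_twistedDilate h₁ h₂ h₃ hf).enorm.pow_const 2).div (by fun_prop)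
  exact h.lintegral_prod_right'.pow_const _

lemma conv_congr_ae {f g : E m × E m → ℂ} (h : f =ᵐ[volume] g) (k : E m × E m → ℂ) :
    conv f k = conv g k := by
  ext x
  refine integral_congr_ae ?_
  filter_upwards [h] with y hy
  rw [hy]

lemma squareFunction_congr_ae {f g : E m × E m → ℂ} (h : f =ᵐ[volume] g) (φ₁ φ₂ φ₃ : E m → ℂ) :
    squareFunction φ₁ φ₂ φ₃ f = squareFunction φ₁ φ₂ φ₃ g := by
  ext x
  simp only [squareFunction, conv_congr_ae h]

lemma squareFunction_zero (φ₁ φ₂ φ₃ : E m → ℂ) (x : E m × E m) :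
    squareFunction φ₁ φ₂ φ₃ (fun _ => 0) x = 0 := by
  simp [squareFunction, conv]

lemma exists_pos_lintegral_rpow_le {p : ℝ} (hp : 0 < p) {ε : ℝ≥0∞} (hε : ε ≠ 0) :
    ∃ k : E m × E m → ℝ≥0∞, Measurable k ∧ (∀ z, 0 < k z) ∧ ∫⁻ z, k z ^ p ≤ ε := by
  obtain ⟨g, hg0, hgm, hg⟩ := exists_pos_lintegral_lt_of_sigmaFinite
    (volume : Measure (E m × E m)) hε
  refine ⟨fun z => (g z : ℝ≥0∞) ^ (1 / p), by fun_prop, fun z => ?_, ?_⟩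
  · exact ENNReal.rpow_pos (by exact_mod_cast hg0 z) ENNReal.coe_ne_top
  · refine le_trans (le_of_eq (lintegral_congr fun z => ?_)) hg.le
    rw [← ENNReal.rpow_mul, one_div_mul_cancel hp.ne', ENNReal.rpow_one]

/-- A positive perturbation of comparable size in `L^p`. -/
lemma exists_pos_add_lintegral_rpow_le {p : ℝ} (hp : 1 ≤ p) {g : E m × E m → ℝ≥0∞}
    (hg : Measurable g) (h0 : ∫⁻ z, g z ^ p ≠ 0) :
    ∃ h : E m × E m → ℝ≥0∞, Measurable h ∧ (∀ z, 0 < h z) ∧ (∀ z, g z ≤ h z) ∧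
      ∫⁻ z, h z ^ p ≤ 2 ^ p * ∫⁻ z, g z ^ p := by
  obtain ⟨k, hk, hk0, hkp⟩ := exists_pos_lintegral_rpow_le (m := m) (by linarith : 0 < p) h0
  refine ⟨fun z => g z + k z, hg.add hk, fun z => (hk0 z).trans_le le_add_self,
    fun z => le_self_add, ?_⟩
  have h2 : (2 : ℝ≥0∞) ^ (p - 1) ≠ ∞ :=
    (ENNReal.rpow_lt_top_of_nonneg (by linarith) (by norm_num)).ne
  calc ∫⁻ z, (g z + k z) ^ p ≤ ∫⁻ z, 2 ^ (p - 1) * (g z ^ p + k z ^ p) :=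
        lintegral_mono fun z => ENNReal.rpow_add_le_mul_rpow_add_rpow _ _ hp
    _ = 2 ^ (p - 1) * ((∫⁻ z, g z ^ p) + ∫⁻ z, k z ^ p) := by
        rw [lintegral_const_mul' _ _ h2, lintegral_add_left (hg.pow_const p)]
    _ ≤ 2 ^ (p - 1) * ((∫⁻ z, g z ^ p) + ∫⁻ z, g z ^ p) := by gcongr
    _ = 2 ^ (p - 1) * 2 ^ (1:ℝ) * ∫⁻ z, g z ^ p := by
        rw [← two_mul, ENNReal.rpow_one, mul_assoc]
    _ = _ := by rw [← ENNReal.rpow_add _ _ (by norm_num) (by norm_num)]; congr 2; ring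

lemma ofReal_pos_ne {a : ℝ} (ha : 0 < a) : ENNReal.ofReal a ≠ 0 ∧ ENNReal.ofReal a ≠ ∞ :=
  ⟨by simpa using ha, ENNReal.ofReal_ne_top⟩

/-- The case `p ≤ 2`: the square function is estimated in `L²` with a weight that is a negative
power of an `A₁` majorant of `|f|`. -/
lemma exists_lintegral_rpow_le_of_le_two {p : ℝ} (hp : 1 < p) (hp2 : p ≤ 2) (φ₁ φ₂ φ₃ : 𝓢(E m, ℂ))
    (h₁ : ∫ x, φ₁ x = 0) (h₂ : ∫ x, φ₂ x = 0) (h₃ : ∫ x, φ₃ x = 0) :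
    ∃ C : ℝ≥0∞, C ≠ ∞ ∧ ∀ f : E m × E m → ℂ, Measurable f → ∀ D : ℝ, (∀ z, ‖f z‖ ≤ D) →
      ∫⁻ z, ‖f z‖ₑ ^ p ≠ 0 → ∫⁻ z, ‖f z‖ₑ ^ p ≠ ∞ →
      ∫⁻ z, squareFunction φ₁ φ₂ φ₃ f z ^ p ≤ C * ∫⁻ z, ‖f z‖ₑ ^ p := by
  obtain ⟨B, hB⟩ := exists_isA1_majorant m hp
  obtain ⟨C, hC, H⟩ := exists_lintegral_squareFunction_le φ₁ φ₂ φ₃ h₁ h₂ h₃ (B ^ (2 - p))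
  have hp0 : 0 < p := by linarith
  have e2 : (0:ℝ) ≤ p / 2 := by positivity
  have e3 : (0:ℝ) ≤ 1 - p / 2 := by linarith
  refine ⟨C ^ (p / 2) * (2 ^ p * 2 ^ p) ^ (1 - p / 2), ENNReal.mul_ne_top
    (ENNReal.rpow_ne_top_of_nonneg e2 hC) (ENNReal.rpow_ne_top_of_nonneg e3
      (ENNReal.mul_ne_top (ENNReal.rpow_ne_top_of_nonneg hp0.le (by norm_num))
        (ENNReal.rpow_ne_top_of_nonneg hp0.le (by norm_num)))), fun f hf D hD hF0 hFt => ?_⟩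
  set F := ∫⁻ z, ‖f z‖ₑ ^ p with hF
  obtain ⟨h, hh, hh0, hfh, hhp⟩ := exists_pos_add_lintegral_rpow_le hp.le hf.enorm hF0
  obtain ⟨v, hv, hv0, hhv, hvp, hA⟩ := hB h hh hh0 (ne_top_of_le_ne_top
    (ENNReal.mul_ne_top (ENNReal.rpow_ne_top_of_nonneg hp0.le (by norm_num)) hFt) hhp)
  have hwA : ∀ i, ∀ᵐ y₁, IsA2 (fun y₂ => (v (dirMap i (y₁, y₂)) ^ (2 - p))⁻¹) (B ^ (2 - p)) :=
    fun i => by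
      filter_upwards [hA i] with y₁ hy₁
      exact (hy₁.rpow (by linarith) (by linarith)).isA2.inv
  have hL2 := H (fun z => (v z ^ (2 - p))⁻¹) (hv.pow_const _).inv hwA f hf D hD
  have eW : ∀ z, ENNReal.ofReal (v z ^ (2 - p))⁻¹ = ENNReal.ofReal (v z) ^ (p - 2) := fun z => by
    rw [← Real.rpow_neg (hv0 z).le, ← ENNReal.ofReal_rpow_of_pos (hv0 z)]
    congr 1; ring
  simp only [eW] at hL2
  have hS := measurable_squareFunction φ₁.continuous.measurable φ₂.continuous.measurable
    φ₃.continuous.measurable hf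
  -- As `|f| ≤ v`, one has `|f|² v^(p-2) ≤ |f|^p`.
  have hfw : ∫⁻ z, ‖f z‖ₑ ^ 2 * ENNReal.ofReal (v z) ^ (p - 2) ≤ F := by
    refine lintegral_mono_ae ?_
    filter_upwards [hhv] with z hz
    obtain ⟨n0, nt⟩ := ofReal_pos_ne (hv0 z)
    have h1 : ‖f z‖ₑ ≤ ENNReal.ofReal (v z) := (hfh z).trans hz
    calc ‖f z‖ₑ ^ 2 * ENNReal.ofReal (v z) ^ (p - 2)
        = ‖f z‖ₑ ^ p * ‖f z‖ₑ ^ (2 - p) * ENNReal.ofReal (v z) ^ (p - 2) := by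
          rw [← ENNReal.rpow_add_of_nonneg _ _ hp0.le (by linarith), ← ENNReal.rpow_natCast]
          congr 2; push_cast; ring
      _ ≤ ‖f z‖ₑ ^ p * ENNReal.ofReal (v z) ^ (2 - p) * ENNReal.ofReal (v z) ^ (p - 2) := by
          gcongr
      _ = ‖f z‖ₑ ^ p := by
          rw [mul_assoc, ← ENNReal.rpow_add _ _ n0 nt]
          simp
  have hSw : Measurable fun z =>
      squareFunction φ₁ φ₂ φ₃ f z ^ 2 * ENNReal.ofReal (v z) ^ (p - 2) :=
    (hS.pow_const 2).mul (hv.ennreal_ofReal.pow_const _)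
  -- Hölder's inequality with exponents `2 / p` and `2 / (2 - p)`, where the powers of `v` cancel.
  have hHol := ENNReal.lintegral_mul_norm_pow_le (μ := (volume : Measure (E m × E m)))
    (g := fun z => ENNReal.ofReal (v z) ^ p) hSw.aemeasurable
    (hv.ennreal_ofReal.pow_const _).aemeasurable e2 e3 (by ring)
  calc ∫⁻ z, squareFunction φ₁ φ₂ φ₃ f z ^ p
      = ∫⁻ z, (squareFunction φ₁ φ₂ φ₃ f z ^ 2 * ENNReal.ofReal (v z) ^ (p - 2)) ^ (p / 2) *
          (ENNReal.ofReal (v z) ^ p) ^ (1 - p / 2) := by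
        refine lintegral_congr fun z => ?_
        obtain ⟨n0, nt⟩ := ofReal_pos_ne (hv0 z)
        rw [ENNReal.mul_rpow_of_nonneg _ _ e2, ← ENNReal.rpow_natCast, ← ENNReal.rpow_mul,
          ← ENNReal.rpow_mul, ← ENNReal.rpow_mul, mul_assoc, ← ENNReal.rpow_add _ _ n0 nt,
          show (p - 2) * (p / 2) + p * (1 - p / 2) = 0 by ring,
          show ((2 : ℕ) : ℝ) * (p / 2) = p by push_cast; ring, ENNReal.rpow_zero, mul_one]
    _ ≤ (C * F) ^ (p / 2) * (2 ^ p * (2 ^ p * F)) ^ (1 - p / 2) := by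
        refine hHol.trans (mul_le_mul' (ENNReal.rpow_le_rpow ?_ e2) (ENNReal.rpow_le_rpow ?_ e3))
        · exact hL2.trans (mul_le_mul_right hfw _)
        · exact hvp.trans (mul_le_mul_right hhp _)
    _ = C ^ (p / 2) * (2 ^ p * 2 ^ p) ^ (1 - p / 2) * (F ^ (p / 2) * F ^ (1 - p / 2)) := by
        rw [← mul_assoc (2 ^ p), ENNReal.mul_rpow_of_nonneg _ _ e2, ENNReal.mul_rpow_of_nonneg _ F e3]
        ring
    _ = _ := by rw [← ENNReal.rpow_add _ _ hF0 hFt]; simp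

/-- The case `2 < p`: the square function is tested against an `A₁` majorant of a power of a
function `G` below it. The function `G` is used in place of the square function because its norm is
known to be finite. -/
lemma exists_lintegral_rpow_le_of_two_lt {p : ℝ} (hp : 2 < p) (φ₁ φ₂ φ₃ : 𝓢(E m, ℂ))
    (h₁ : ∫ x, φ₁ x = 0) (h₂ : ∫ x, φ₂ x = 0) (h₃ : ∫ x, φ₃ x = 0) :
    ∃ C : ℝ≥0∞, C ≠ ∞ ∧ ∀ f : E m × E m → ℂ, Measurable f → ∀ D : ℝ, (∀ z, ‖f z‖ ≤ D) →
      ∀ G : E m × E m → ℝ≥0∞, Measurable G → (∀ z, G z ≤ squareFunction φ₁ φ₂ φ₃ f z) →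
      ∫⁻ z, G z ^ p ≠ ∞ → ∫⁻ z, G z ^ p ≤ C * ∫⁻ z, ‖f z‖ₑ ^ p := by
  have hp0 : 0 < p := by linarith
  -- The exponent dual to `p / 2`.
  set q := p / (p - 2) with hq
  have hq1 : 1 < q := by rw [hq, one_lt_div (by linarith)]; linarith
  have hq0 : 0 < q := by linarith
  have hpq : (p - 2) * q = p := by
    have : p - 2 ≠ 0 := by linarith
    rw [hq]; field_simp
  have hq' : q * (1 - 2 / p) = 1 := by
    have : p - 2 ≠ 0 := by linarith
    rw [hq]; field_simp
  obtain ⟨B, hB⟩ := exists_isA1_majorant m hq1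
  obtain ⟨C, hC, H⟩ := exists_lintegral_squareFunction_le φ₁ φ₂ φ₃ h₁ h₂ h₃ B
  have e2 : (0:ℝ) ≤ 2 / p := by positivity
  have e3 : (0:ℝ) ≤ 1 - 2 / p := by
    rw [sub_nonneg, div_le_one hp0]; exact hp.le
  set A : ℝ≥0∞ := C * (2 ^ q * 2 ^ p) ^ (1 - 2 / p) with hAdef
  have hAt : A ≠ ∞ := ENNReal.mul_ne_top hC (ENNReal.rpow_ne_top_of_nonneg e3
    (ENNReal.mul_ne_top (ENNReal.rpow_ne_top_of_nonneg hq0.le (by norm_num))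
      (ENNReal.rpow_ne_top_of_nonneg hp0.le (by norm_num))))
  refine ⟨A ^ (p / 2), ENNReal.rpow_ne_top_of_nonneg (by positivity) hAt,
    fun f hf D hD G hG hGS hPt => ?_⟩
  set F := ∫⁻ z, ‖f z‖ₑ ^ p with hF
  set P := ∫⁻ z, G z ^ p with hP
  by_cases hP0 : P = 0
  · rw [hP0]; exact zero_le
  obtain ⟨h, hh, hh0, hGh, hhp⟩ := exists_pos_add_lintegral_rpow_le (by linarith) hG hP0
  have hhq : ∀ z, (h z ^ (p - 2)) ^ q = h z ^ p := fun z => by rw [← ENNReal.rpow_mul, hpq]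
  have h2p : (2 : ℝ≥0∞) ^ p * P ≠ ∞ :=
    ENNReal.mul_ne_top (ENNReal.rpow_ne_top_of_nonneg hp0.le (by norm_num)) hPt
  obtain ⟨v, hv, hv0, hhv, hvq, hA⟩ := hB (fun z => h z ^ (p - 2)) (hh.pow_const _)
    (fun z => ENNReal.rpow_pos_of_nonneg (hh0 z) (by linarith)) (by
      simp only [hhq]; exact ne_top_of_le_ne_top h2p hhp)
  simp only [hhq] at hvq
  have hL2 := H v hv (fun i => by filter_upwards [hA i] with y₁ hy₁ using hy₁.isA2) f hf D hD
  have hHol := ENNReal.lintegral_mul_norm_pow_le (μ := (volume : Measure (E m × E m)))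
    (f := fun z => ‖f z‖ₑ ^ p) (g := fun z => ENNReal.ofReal (v z) ^ q)
    (hf.enorm.pow_const _).aemeasurable (hv.ennreal_ofReal.pow_const _).aemeasurable e2 e3 (by ring)
  have key : P ≤ A * F ^ (2 / p) * P ^ (1 - 2 / p) := by
    calc P ≤ ∫⁻ z, squareFunction φ₁ φ₂ φ₃ f z ^ 2 * ENNReal.ofReal (v z) := by
          refine lintegral_mono_ae ?_
          filter_upwards [hhv] with z hz
          calc G z ^ p = G z ^ 2 * G z ^ (p - 2) := by
                rw [← ENNReal.rpow_natCast, ← ENNReal.rpow_add_of_nonneg _ _ (by norm_num) (by linarith)]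
                congr 1; push_cast; ring
            _ ≤ squareFunction φ₁ φ₂ φ₃ f z ^ 2 * h z ^ (p - 2) := by
                gcongr
                · exact hGS z
                · exact hGh z
            _ ≤ _ := by gcongr
      _ ≤ C * ∫⁻ z, ‖f z‖ₑ ^ 2 * ENNReal.ofReal (v z) := hL2
      _ = C * ∫⁻ z, (‖f z‖ₑ ^ p) ^ (2 / p) * (ENNReal.ofReal (v z) ^ q) ^ (1 - 2 / p) := by
          congr 1
          refine lintegral_congr fun z => ?_
          rw [← ENNReal.rpow_mul, ← ENNReal.rpow_mul, hq', mul_div_cancel₀ _ hp0.ne',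
            ENNReal.rpow_one, ← ENNReal.rpow_natCast]
          norm_num
      _ ≤ C * (F ^ (2 / p) * (2 ^ q * (2 ^ p * P)) ^ (1 - 2 / p)) := by
          refine mul_le_mul_right (hHol.trans (mul_le_mul_right (ENNReal.rpow_le_rpow ?_ e3) _)) _
          exact hvq.trans (mul_le_mul_right hhp _)
      _ = _ := by
          rw [← mul_assoc (2 ^ q), ENNReal.mul_rpow_of_nonneg _ P e3, hAdef]
          ring
  have hPr0 : P ^ (1 - 2 / p) ≠ 0 := (ENNReal.rpow_pos (pos_iff_ne_zero.2 hP0) hPt).ne'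
  have hPrt : P ^ (1 - 2 / p) ≠ ∞ := ENNReal.rpow_ne_top_of_nonneg e3 hPt
  have hPsplit : P = P ^ (2 / p) * P ^ (1 - 2 / p) := by
    rw [← ENNReal.rpow_add _ _ hP0 hPt]; simp
  -- A positive power of `P`, which is finite, cancels.
  have key2 : P ^ (2 / p) ≤ A * F ^ (2 / p) := by
    have key' : P ^ (2 / p) * P ^ (1 - 2 / p) ≤ A * F ^ (2 / p) * P ^ (1 - 2 / p) := by
      rw [← hPsplit]; exact key
    exact (ENNReal.mul_le_mul_iff_left hPr0 hPrt).1 key'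
  have e4 : 2 / p * (p / 2) = 1 := by field_simp
  calc P = (P ^ (2 / p)) ^ (p / 2) := by rw [← ENNReal.rpow_mul, e4, ENNReal.rpow_one]
    _ ≤ (A * F ^ (2 / p)) ^ (p / 2) := ENNReal.rpow_le_rpow key2 (by positivity)
    _ = _ := by
        rw [ENNReal.mul_rpow_of_nonneg _ _ (by positivity), ← ENNReal.rpow_mul, e4, ENNReal.rpow_one]

/-- The square function estimate for bounded functions. -/
lemma exists_lintegral_rpow_le_of_bounded {p : ℝ} (hp : 1 < p) (φ₁ φ₂ φ₃ : 𝓢(E m, ℂ))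
    (h₁ : ∫ x, φ₁ x = 0) (h₂ : ∫ x, φ₂ x = 0) (h₃ : ∫ x, φ₃ x = 0) :
    ∃ C : ℝ≥0∞, C ≠ ∞ ∧ ∀ f : E m × E m → ℂ, Measurable f → ∀ D : ℝ, (∀ z, ‖f z‖ ≤ D) →
      ∫⁻ z, squareFunction φ₁ φ₂ φ₃ f z ^ p ≤ C * ∫⁻ z, ‖f z‖ₑ ^ p := by
  have hp0 : 0 < p := by linarith
  rcases le_or_gt p 2 with h | h
  · obtain ⟨C, hC, H⟩ := exists_lintegral_rpow_le_of_le_two hp h φ₁ φ₂ φ₃ h₁ h₂ h₃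
    refine ⟨C + 1, by simpa using hC, fun f hf D hD => ?_⟩
    by_cases hF0 : ∫⁻ z, ‖f z‖ₑ ^ p = 0
    · rw [lintegral_eq_zero_iff (hf.enorm.pow_const p)] at hF0
      have hf0 : f =ᵐ[volume] fun _ => 0 := by
        filter_upwards [hF0] with z hz
        simpa [hp0.not_gt, hp0] using hz
      simp [squareFunction_congr_ae hf0, squareFunction_zero, hp0]
    by_cases hFt : ∫⁻ z, ‖f z‖ₑ ^ p = ∞
    · rw [hFt, ENNReal.mul_top (by simp)]; exact le_top
    exact (H f hf D hD hF0 hFt).trans (mul_le_mul_left le_self_add _)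
  · obtain ⟨C, hC, H⟩ := exists_lintegral_rpow_le_of_two_lt h φ₁ φ₂ φ₃ h₁ h₂ h₃
    refine ⟨C, hC, fun f hf D hD => ?_⟩
    have hS := measurable_squareFunction φ₁.continuous.measurable φ₂.continuous.measurable
      φ₃.continuous.measurable hf
    set S := squareFunction φ₁ φ₂ φ₃ f with hSdef
    -- Truncations of the square function have finite norm and increase to it.
    set G : ℕ → E m × E m → ℝ≥0∞ := fun n => (ball 0 n).indicator fun z => min (S z) n with hG
    have hGm : ∀ n, Measurable (G n) := fun n => (hS.min measurable_const).indicator measurableSet_ball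
    have hGS : ∀ n z, G n z ≤ S z := fun n z => indicator_le_self' (fun _ _ => zero_le) z |>.trans
      (min_le_left _ _)
    have hGt : ∀ n, ∫⁻ z, G n z ^ p ≠ ∞ := fun n => by
      have h1 : ∫⁻ z, G n z ^ p ≤ ∫⁻ z, (ball (0 : E m × E m) n).indicator (fun _ => (n : ℝ≥0∞) ^ p) z := by
        refine lintegral_mono fun z => ?_
        by_cases hz : z ∈ ball (0 : E m × E m) n
        · simp only [hG, indicator_of_mem hz]
          exact ENNReal.rpow_le_rpow (min_le_right _ _) hp0.le
        · simp only [hG, indicator_of_notMem hz]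
          simp [hp0]
      refine ne_top_of_le_ne_top ?_ h1
      rw [lintegral_indicator measurableSet_ball, setLIntegral_const]
      exact ENNReal.mul_ne_top (ENNReal.rpow_ne_top_of_nonneg hp0.le (by simp)) measure_ball_lt_top.ne
    have hlim : ∀ z, Filter.Tendsto (fun n => G n z ^ p) Filter.atTop (nhds (S z ^ p)) := fun z => by
      refine ((ENNReal.continuous_rpow_const).tendsto _).comp ?_
      have h1 : Filter.Tendsto (fun n : ℕ => min (S z) n) Filter.atTop (nhds (min (S z) ∞)) :=
        tendsto_const_nhds.min ENNReal.tendsto_nat_nhds_top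
      rw [min_eq_left le_top] at h1
      refine h1.congr' ?_
      obtain ⟨N, hN⟩ := exists_nat_gt (dist z 0)
      filter_upwards [Filter.eventually_ge_atTop N] with n hn
      simp only [hG]
      rw [indicator_of_mem]
      rw [mem_ball]; exact hN.trans_le (by exact_mod_cast hn)
    calc ∫⁻ z, S z ^ p = ∫⁻ z, Filter.liminf (fun n => G n z ^ p) Filter.atTop :=
          lintegral_congr fun z => (hlim z).liminf_eq.symm
      _ ≤ Filter.liminf (fun n => ∫⁻ z, G n z ^ p) Filter.atTop :=
          lintegral_liminf_le fun n => (hGm n).pow_const p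
      _ ≤ _ := Filter.liminf_le_of_frequently_le' (Filter.Frequently.of_forall fun n =>
          H f hf D hD (G n) (hGm n) (hGS n) (hGt n))

/-- Convolutions of dominated approximations of `f` recover the convolution of `f` in the limit. At
points where the convolution integral of `f` diverges it has the value `0`, so that the inequality
holds there as well. -/
lemma enorm_conv_le_liminf {f k : E m × E m → ℂ} (hk : Measurable k) {F : ℕ → E m × E m → ℂ}
    (hF : ∀ n, Measurable (F n)) (hle : ∀ n z, ‖F n z‖ ≤ ‖f z‖)
    (hlim : ∀ z, Filter.Tendsto (fun n => F n z) Filter.atTop (nhds (f z))) (x : E m × E m) :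
    ‖conv f k x‖ₑ ≤ Filter.liminf (fun n => ‖conv (F n) k x‖ₑ) Filter.atTop := by
  by_cases hi : Integrable fun y => f y * k (x - y)
  · have ht : Filter.Tendsto (fun n => conv (F n) k x) Filter.atTop (nhds (conv f k x)) := by
      refine tendsto_integral_of_dominated_convergence _ (fun n => ?_) hi.norm
        (fun n => ae_of_all _ fun y => ?_) (ae_of_all _ fun y => (hlim y).mul_const _)
      · exact ((hF n).mul (hk.comp (by fun_prop))).aestronglyMeasurable
      · rw [norm_mul, norm_mul]
        exact mul_le_mul_of_nonneg_right (hle n y) (norm_nonneg _)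
    exact ht.enorm.liminf_eq.ge
  · rw [show conv f k x = 0 from integral_undef hi, enorm_zero]
    exact zero_le

lemma liminf_rpow {s : ℝ} (hs : 0 ≤ s) (u : ℕ → ℝ≥0∞) :
    Filter.liminf u Filter.atTop ^ s = Filter.liminf (fun n => u n ^ s) Filter.atTop :=
  Monotone.map_liminf_of_continuousAt (f := fun t : ℝ≥0∞ => t ^ s)
    (fun _ _ h => ENNReal.rpow_le_rpow h hs) u ENNReal.continuous_rpow_const.continuousAt

/-- Fatou's lemma for a square function. -/
lemma lintegral_sq_div_rpow_le_liminf {S : Type*} [MeasurableSpace S] (μ : Measure S)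
    {a ρ : S → ℝ≥0∞} {b : ℕ → S → ℝ≥0∞} (hb : ∀ n, Measurable (b n)) (hρ : Measurable ρ)
    (h : ∀ r, a r ≤ Filter.liminf (fun n => b n r) Filter.atTop) (h0 : ∀ᵐ r ∂μ, ρ r ≠ 0) :
    (∫⁻ r, a r ^ 2 / ρ r ∂μ) ^ (1 / 2 : ℝ) ≤
      Filter.liminf (fun n => (∫⁻ r, b n r ^ 2 / ρ r ∂μ) ^ (1 / 2 : ℝ)) Filter.atTop := by
  rw [← liminf_rpow (by norm_num)]
  refine ENNReal.rpow_le_rpow ?_ (by norm_num)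
  refine le_trans (lintegral_mono_ae ?_) (lintegral_liminf_le fun n => ((hb n).pow_const 2).div hρ)
  filter_upwards [h0] with r hr
  have hmono : Monotone fun t : ℝ≥0∞ => t ^ 2 / ρ r := fun s t hst => by dsimp only; gcongr
  have hcont : Continuous fun t : ℝ≥0∞ => t ^ 2 / ρ r :=
    (ENNReal.continuous_div_const _ hr).comp (ENNReal.continuous_pow 2)
  have e := hmono.map_liminf_of_continuousAt (F := Filter.atTop) (fun n => b n r) hcont.continuousAt
  exact (hmono (h r)).trans e.le

lemma squareFunction_le_liminf {φ₁ φ₂ φ₃ : E m → ℂ} (h₁ : Measurable φ₁) (h₂ : Measurable φ₂)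
    (h₃ : Measurable φ₃) {f : E m × E m → ℂ} {F : ℕ → E m × E m → ℂ}
    (hF : ∀ n, Measurable (F n)) (hle : ∀ n z, ‖F n z‖ ≤ ‖f z‖)
    (hlim : ∀ z, Filter.Tendsto (fun n => F n z) Filter.atTop (nhds (f z))) (x : E m × E m) :
    squareFunction φ₁ φ₂ φ₃ f x ≤
      Filter.liminf (fun n => squareFunction φ₁ φ₂ φ₃ (F n) x) Filter.atTop := by
  refine lintegral_sq_div_rpow_le_liminf _ (fun n => ?_) (by fun_prop) (fun r => ?_) ?_
  · exact ((measurable_conv_twistedDilate h₁ h₂ h₃ (hF n)).comp measurable_prodMk_left).enorm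
  · exact enorm_conv_le_liminf ((measurable_twistedDilate h₁ h₂ h₃).comp measurable_prodMk_left)
      hF hle hlim x
  · filter_upwards [ae_restrict_mem measurableSet_octant] with r hr
    have p1 : 0 < r.1 := hr.1
    have p2 : 0 < r.2.1 := hr.2.1
    have p3 : 0 < r.2.2 := hr.2.2
    exact (ofReal_pos_ne (by positivity)).1

/-- The truncation of `f` at height `n`. -/
def truncate (f : E m × E m → ℂ) (n : ℕ) : E m × E m → ℂ := {z | ‖f z‖ ≤ n}.indicator f

lemma measurable_truncate {f : E m × E m → ℂ} (hf : Measurable f) (n : ℕ) :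
    Measurable (truncate f n) :=
  hf.indicator (measurableSet_le hf.norm measurable_const)

lemma norm_truncate_le (f : E m × E m → ℂ) (n : ℕ) (z : E m × E m) : ‖truncate f n z‖ ≤ ‖f z‖ :=
  norm_indicator_le_norm_self f z

lemma norm_truncate_le_nat (f : E m × E m → ℂ) (n : ℕ) (z : E m × E m) : ‖truncate f n z‖ ≤ n := by
  by_cases hz : z ∈ {z | ‖f z‖ ≤ n}
  · rw [truncate, indicator_of_mem hz]; exact hz
  · rw [truncate, indicator_of_notMem hz, norm_zero]; positivity

lemma tendsto_truncate (f : E m × E m → ℂ) (z : E m × E m) :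
    Filter.Tendsto (fun n => truncate f n z) Filter.atTop (nhds (f z)) := by
  refine tendsto_const_nhds.congr' ?_
  obtain ⟨N, hN⟩ := exists_nat_gt ‖f z‖
  filter_upwards [Filter.eventually_ge_atTop N] with n hn
  rw [truncate, indicator_of_mem]
  exact hN.le.trans (by exact_mod_cast hn)

/-- The square function estimate on `L^p`, as an inequality of integrals. -/
theorem exists_lintegral_squareFunction_rpow_le {p : ℝ} (hp : 1 < p) (φ₁ φ₂ φ₃ : 𝓢(E m, ℂ))
    (h₁ : ∫ x, φ₁ x = 0) (h₂ : ∫ x, φ₂ x = 0) (h₃ : ∫ x, φ₃ x = 0) :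
    ∃ C : ℝ≥0∞, C ≠ ∞ ∧ ∀ f : E m × E m → ℂ, Measurable f →
      ∫⁻ z, squareFunction φ₁ φ₂ φ₃ f z ^ p ≤ C * ∫⁻ z, ‖f z‖ₑ ^ p := by
  have hp0 : 0 < p := by linarith
  obtain ⟨C, hC, H⟩ := exists_lintegral_rpow_le_of_bounded hp φ₁ φ₂ φ₃ h₁ h₂ h₃
  refine ⟨C, hC, fun f hf => ?_⟩
  have m₁ : Measurable φ₁ := φ₁.continuous.measurable
  have m₂ : Measurable φ₂ := φ₂.continuous.measurable
  have m₃ : Measurable φ₃ := φ₃.continuous.measurable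
  have hS := fun n => measurable_squareFunction m₁ m₂ m₃ (measurable_truncate hf n)
  calc ∫⁻ z, squareFunction φ₁ φ₂ φ₃ f z ^ p
      ≤ ∫⁻ z, Filter.liminf (fun n => squareFunction φ₁ φ₂ φ₃ (truncate f n) z ^ p)
          Filter.atTop := by
        refine lintegral_mono fun z => ?_
        rw [← liminf_rpow hp0.le]
        exact ENNReal.rpow_le_rpow (squareFunction_le_liminf m₁ m₂ m₃ (measurable_truncate hf)
          (norm_truncate_le f) (tendsto_truncate f) z) hp0.le
    _ ≤ Filter.liminf (fun n => ∫⁻ z, squareFunction φ₁ φ₂ φ₃ (truncate f n) z ^ p) Filter.atTop :=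
        lintegral_liminf_le fun n => (hS n).pow_const p
    _ ≤ C * ∫⁻ z, ‖f z‖ₑ ^ p := by
        refine Filter.liminf_le_of_frequently_le' (Filter.Frequently.of_forall fun n => ?_)
        refine (H _ (measurable_truncate hf n) n (norm_truncate_le_nat f n)).trans ?_
        gcongr with z
        exact enorm_le_iff_norm_le.2 (norm_truncate_le f n z)

/-- The `L^p` seminorm as an integral. -/
lemma eLpNorm_eq_lintegral {F : Type*} [TopologicalSpace F] [ContinuousENorm F]
    {S : Type*} [MeasurableSpace S] (μ : Measure S) {p : ℝ≥0∞} (hp : 1 < p) (hp' : p < ∞) (f : S → F) :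
    eLpNorm f p μ = (∫⁻ x, ‖f x‖ₑ ^ p.toReal ∂μ) ^ (1 / p.toReal) :=
  eLpNorm_eq_lintegral_rpow_enorm_toReal (zero_lt_one.trans hp).ne' hp'.ne

/-- The twisted square function is bounded on `L^p` for `1 < p < ∞`. -/
theorem exists_eLpNorm_squareFunction_le {p : ℝ≥0∞} (hp : 1 < p) (hp' : p < ∞)
    (φ₁ φ₂ φ₃ : 𝓢(E m, ℂ)) (h₁ : ∫ x, φ₁ x = 0) (h₂ : ∫ x, φ₂ x = 0) (h₃ : ∫ x, φ₃ x = 0) :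
    ∃ C : ℝ≥0, ∀ f : E m × E m → ℂ, MemLp f p volume →
      MemLp (squareFunction φ₁ φ₂ φ₃ f) p volume ∧
      eLpNorm (squareFunction φ₁ φ₂ φ₃ f) p volume ≤ C * eLpNorm f p volume := by
  have hp1 : 1 < p.toReal := by
    rw [← ENNReal.toReal_one]; exact (ENNReal.toReal_lt_toReal (by simp) hp'.ne).2 hp
  obtain ⟨C, hC, H⟩ := exists_lintegral_squareFunction_rpow_le hp1 φ₁ φ₂ φ₃ h₁ h₂ h₃
  have hs : (0:ℝ) ≤ 1 / p.toReal := by positivity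
  have hCs : C ^ (1 / p.toReal) ≠ ∞ := ENNReal.rpow_ne_top_of_nonneg hs hC
  have hmain : ∀ f : E m × E m → ℂ, MemLp f p volume →
      AEStronglyMeasurable (squareFunction φ₁ φ₂ φ₃ f) volume ∧
      eLpNorm (squareFunction φ₁ φ₂ φ₃ f) p volume ≤ C ^ (1 / p.toReal) * eLpNorm f p volume := by
    intro f hf
    obtain ⟨g, hg, hfg⟩ := hf.1
    rw [squareFunction_congr_ae hfg, eLpNorm_congr_ae hfg]
    refine ⟨(measurable_squareFunction φ₁.continuous.measurable φ₂.continuous.measurable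
      φ₃.continuous.measurable hg.measurable).stronglyMeasurable.aestronglyMeasurable, ?_⟩
    rw [eLpNorm_eq_lintegral _ hp hp', eLpNorm_eq_lintegral _ hp hp',
      ← ENNReal.mul_rpow_of_nonneg _ _ hs]
    simp only [enorm_eq_self]
    exact ENNReal.rpow_le_rpow (H g hg.measurable) hs
  refine ⟨(C ^ (1 / p.toReal)).toNNReal, fun f hf => ?_⟩
  obtain ⟨h1, h2⟩ := hmain f hf
  rw [ENNReal.coe_toNNReal hCs]
  exact ⟨⟨h1, h2.trans_lt (ENNReal.mul_lt_top hCs.lt_top hf.2)⟩, h2⟩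

/-! ### Plancherel's identity -/

lemma continuous_fourier {F : E m → ℂ} (hF : Integrable F) : Continuous (𝓕 F) :=
  VectorFourier.fourierIntegral_continuous Real.continuous_fourierChar
    (by exact continuous_inner) hF

/-- The `L²` Fourier transform, defined by density, is given by the Fourier integral on
`L¹ ∩ L²`: both have the same pairings with test functions. -/
lemma fourier_toLp_ae_eq {F : E m → ℂ} (hF : Integrable F) (hF2 : MemLp F 2) :
    ((𝓕 (hF2.toLp F) : Lp ℂ 2 (volume : Measure (E m))) : E m → ℂ) =ᵐ[volume] 𝓕 F := by
  refine ae_eq_of_integral_contDiff_smul_eq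
    ((Lp.memLp (𝓕 (hF2.toLp F) : Lp ℂ 2 (volume : Measure (E m)))).locallyIntegrable (by norm_num))
    (continuous_fourier hF).locallyIntegrable fun g hg hgc => ?_
  have hgc' : HasCompactSupport fun x => (g x : ℂ) := hgc.comp_left Complex.ofReal_zero
  have hg' : ContDiff ℝ _ fun x => (g x : ℂ) := Complex.ofRealCLM.contDiff.comp hg
  have hs : ∀ x, hgc'.toSchwartzMap hg' x = (g x : ℂ) := fun x => rfl
  -- The Fourier transform on `L²` agrees with that of tempered distributions.
  have h1 := Lp.fourier_toTemperedDistribution_eq (hF2.toLp F)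
  have h2 := congrArg (fun T => T (hgc'.toSchwartzMap hg')) h1
  simp only [TemperedDistribution.fourier_apply, Lp.toTemperedDistribution_apply] at h2
  have h3 : ∫ x, g x • ((𝓕 (hF2.toLp F) : Lp ℂ 2 (volume : Measure (E m))) : E m → ℂ) x
      = ∫ x, hgc'.toSchwartzMap hg' x • ((𝓕 (hF2.toLp F) : Lp ℂ 2 (volume : Measure (E m))) : E m → ℂ) x := by
    refine integral_congr_ae (Filter.Eventually.of_forall fun x => ?_)
    simp [hs]
  rw [h3, ← h2]
  have h4 : ∫ x, (𝓕 (hgc'.toSchwartzMap hg')) x • (hF2.toLp F : E m → ℂ) x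
      = ∫ x, (𝓕 (hgc'.toSchwartzMap hg')) x • F x := by
    refine integral_congr_ae ?_
    filter_upwards [hF2.coeFn_toLp] with x hx
    rw [hx]
  rw [h4]
  have h5 := VectorFourier.integral_fourierIntegral_smul_eq_flip (L := innerₗ (E m))
    (μ := volume) (ν := volume)
    Real.continuous_fourierChar (by exact continuous_inner)
      (hgc'.toSchwartzMap hg').integrable hF
  rw [flip_innerₗ] at h5
  refine Eq.trans ?_ (h5.trans ?_)
  · rfl
  · refine integral_congr_ae (Filter.Eventually.of_forall fun x => ?_)
    simp only [hs, Complex.real_smul, smul_eq_mul]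
    rfl

/-- Plancherel's identity on `L¹ ∩ L²`, in polarized form. -/
lemma integral_mul_conj_fourier {F G : E m → ℂ} (hF : Integrable F) (hF2 : MemLp F 2)
    (hG : Integrable G) (hG2 : MemLp G 2) :
    ∫ ξ, 𝓕 F ξ * (starRingEnd ℂ) (𝓕 G ξ) = ∫ x, F x * (starRingEnd ℂ) (G x) := by
  have h := Lp.inner_fourier_eq (hG2.toLp G) (hF2.toLp F)
  rw [L2.inner_def, L2.inner_def] at h
  refine Eq.trans (integral_congr_ae ?_) (h.trans (integral_congr_ae ?_))
  · filter_upwards [fourier_toLp_ae_eq hF hF2, fourier_toLp_ae_eq hG hG2] with ξ h1 h2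
    rw [h1, h2]; rfl
  · filter_upwards [hF2.coeFn_toLp, hG2.coeFn_toLp] with x h1 h2
    rw [h1, h2]; rfl

lemma lintegral_enorm_fourier_sq {F : E m → ℂ} (hF : Integrable F) (hF2 : MemLp F 2) :
    ∫⁻ ξ, ‖𝓕 F ξ‖ₑ ^ 2 = ∫⁻ x, ‖F x‖ₑ ^ 2 := by
  have h := Lp.norm_fourier_eq (hF2.toLp F)
  have h' : eLpNorm (𝓕 F) 2 volume = eLpNorm F 2 volume := by
    rw [← eLpNorm_congr_ae (fourier_toLp_ae_eq hF hF2), ← eLpNorm_congr_ae hF2.coeFn_toLp,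
      ← ENNReal.toReal_eq_toReal_iff' (Lp.eLpNorm_ne_top _) (Lp.eLpNorm_ne_top _),
      ← Lp.norm_def, ← Lp.norm_def, h]
  have e : ∀ H : E m → ℂ, ∫⁻ x, ‖H x‖ₑ ^ 2 = eLpNorm H 2 volume ^ (2 : ℝ) := by
    intro H
    rw [eLpNorm_eq_lintegral_rpow_enorm_toReal (by norm_num) (by norm_num), ← ENNReal.rpow_mul]
    simp
  rw [e, e, h']

lemma fourier_dilate (φ : E m → ℂ) {r : ℝ} (hr : 0 < r) (ξ : E m) :
    𝓕 (dilate φ r) ξ = 𝓕 φ (r • ξ) := by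
  rw [Real.fourier_eq, Real.fourier_eq]
  have h := Measure.integral_comp_inv_smul_of_nonneg (μ := (volume : Measure (E m)))
    (fun v => Real.fourierChar (-inner ℝ v (r • ξ)) • φ v) hr.le
  have e : ∀ v : E m, Real.fourierChar (-inner ℝ v ξ) • dilate φ r v
      = ((r ^ m)⁻¹ : ℝ) • (Real.fourierChar (-inner ℝ (r⁻¹ • v) (r • ξ)) • φ (r⁻¹ • v)) := by
    intro v
    rw [inner_smul_left, inner_smul_right, dilate]
    simp only [conj_trivial, Circle.smul_def, smul_eq_mul, Complex.real_smul]
    rw [inv_mul_cancel_left₀ hr.ne']; ring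
  simp_rw [e]
  rw [integral_smul, h, finrank_euclideanSpace_fin, smul_smul, inv_mul_cancel₀ (by positivity),
    one_smul]

lemma fourier_smear {φ f : E m → ℂ} (hφ : Integrable φ) (hf : Integrable f) {r : ℝ} (hr : 0 < r)
    (ξ : E m) : 𝓕 (smear φ r f) ξ = 𝓕 φ (r • ξ) * 𝓕 f ξ := by
  rw [← fourier_dilate φ hr]
  exact Real.fourier_mul_convolution_eq (integrable_dilate hφ hr) hf ξ

/-! ### Calderón's reproducing formula on `ℝᵐ` -/

/-- Bounded integrable (Borel) functions, on which every pairing below is absolutely convergent. -/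
structure IsTame {X : Type*} [MeasureSpace X] (f : X → ℂ) : Prop where
  measurable : Measurable f
  integrable : Integrable f
  exists_bound : ∃ D : ℝ, ∀ x, ‖f x‖ ≤ D

lemma IsTame.integrable_mul_conj {X : Type*} [MeasureSpace X] {f g : X → ℂ} (hf : IsTame f)
    (hg : IsTame g) : Integrable fun x => f x * (starRingEnd ℂ) (g x) := by
  obtain ⟨D, hD⟩ := hg.exists_bound
  have hgm : Measurable fun x => (starRingEnd ℂ) (g x) :=
    Complex.continuous_conj.measurable.comp hg.measurable
  exact hf.integrable.mul_bdd (c := D) hgm.aestronglyMeasurable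
    (Filter.Eventually.of_forall fun x => by simpa using hD x)

lemma IsTame.memLp_two {X : Type*} [MeasureSpace X] {f : X → ℂ} (hf : IsTame f) :
    MemLp f 2 := by
  refine (memLp_two_iff_integrable_sq_norm hf.measurable.aestronglyMeasurable).2 ?_
  refine (hf.integrable_mul_conj hf).norm.congr (Filter.Eventually.of_forall fun x => ?_)
  simp [sq]

lemma IsTame.lintegral_enorm_sq_ne_top {X : Type*} [MeasureSpace X] {f : X → ℂ} (hf : IsTame f) :
    ∫⁻ x, ‖f x‖ₑ ^ 2 ≠ ∞ := by
  have h := (hf.integrable_mul_conj hf).2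
  refine ne_of_lt (lt_of_le_of_lt (le_of_eq (lintegral_congr fun x => ?_)) h)
  rw [enorm_mul, sq, RCLike.enorm_conj]

lemma integrable_smear {φ f : E m → ℂ} (hφ : Integrable φ) (hf : Integrable f) {r : ℝ}
    (hr : 0 < r) : Integrable (smear φ r f) := by
  have h := (integrable_dilate hφ hr).integrable_convolution (ContinuousLinearMap.mul ℂ ℂ) hf
  exact h

lemma norm_smear_le {φ f : E m → ℂ} (hφ : Integrable φ) {D : ℝ} (hf : ∀ x, ‖f x‖ ≤ D) {r : ℝ}
    (hr : 0 < r) (x : E m) : ‖smear φ r f x‖ ≤ ∫ s, ‖dilate φ r s‖ * D := by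
  refine norm_integral_le_of_norm_le ((integrable_dilate hφ hr).norm.mul_const D)
    (Filter.Eventually.of_forall fun s => ?_)
  rw [norm_mul]
  exact mul_le_mul_of_nonneg_left (hf _) (norm_nonneg _)

lemma IsTame.smear {φ f : E m → ℂ} (hφm : Measurable φ) (hφ : Integrable φ) (hf : IsTame f)
    {r : ℝ} (hr : 0 < r) : IsTame (TwistedLP.smear φ r f) := by
  obtain ⟨D, hD⟩ := hf.exists_bound
  have h1 : Measurable (TwistedLP.smear φ r f) :=
    (measurable_smear hφm hf.measurable).comp (measurable_const.prodMk measurable_id)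
  exact ⟨h1, integrable_smear hφ hf.integrable hr, _, norm_smear_le hφ hD hr⟩

/-- `φ` and `ψ` form a Calderón pair with symbol `q`: `q = φ̂ · conj ψ̂` is nonnegative and its
dilates integrate to one against `dr / r`. -/
structure IsCalderonPair (φ ψ : E m → ℂ) (q : E m → ℝ) : Prop where
  measurable : Measurable q
  nonneg : ∀ ξ, 0 ≤ q ξ
  fourier_mul_conj : ∀ ξ, 𝓕 φ ξ * (starRingEnd ℂ) (𝓕 ψ ξ) = q ξ
  lintegral_eq_one : ∀ ξ, ξ ≠ 0 →
    ∫⁻ r in Ioi (0 : ℝ), ENNReal.ofReal (q (r • ξ)) * (ENNReal.ofReal r)⁻¹ = 1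

/-- The pairing at scale `r` of the two smeared functions. -/
def scalePairing (φ ψ F G : E m → ℂ) (r : ℝ) : ℂ :=
  ∫ x, smear φ r F x * (starRingEnd ℂ) (smear ψ r G x)

lemma IsCalderonPair.scalePairing_eq {φ ψ : E m → ℂ} {q : E m → ℝ} (h : IsCalderonPair φ ψ q)
    (hφm : Measurable φ) (hφ : Integrable φ) (hψm : Measurable ψ) (hψ : Integrable ψ)
    {F G : E m → ℂ} (hF : IsTame F) (hG : IsTame G) {r : ℝ} (hr : 0 < r) :
    scalePairing φ ψ F G r
      = ∫ ξ, (q (r • ξ) : ℂ) * (𝓕 F ξ * (starRingEnd ℂ) (𝓕 G ξ)) := by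
  have h1 := hF.smear hφm hφ hr
  have h2 := hG.smear hψm hψ hr
  rw [scalePairing, ← integral_mul_conj_fourier h1.integrable h1.memLp_two h2.integrable
    h2.memLp_two]
  refine integral_congr_ae (Filter.Eventually.of_forall fun ξ => ?_)
  simp only
  rw [fourier_smear hφ hF.integrable hr, fourier_smear hψ hG.integrable hr,
    ← h.fourier_mul_conj, map_mul]
  ring

lemma ae_ne_zero (hm : 1 ≤ m) : ∀ᵐ ξ : E m, ξ ≠ 0 := by
  have : Nonempty (Fin m) := ⟨⟨0, hm⟩⟩
  exact compl_mem_ae_iff.2 (measure_singleton 0)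

section
variable {φ ψ : E m → ℂ} {q : E m → ℝ} {F G : E m → ℂ}

/-- The kernel whose two iterated integrals give the two sides of Calderón's formula. -/
def calderonKernel (q : E m → ℝ) (F G : E m → ℂ) (z : ℝ × E m) : ℂ :=
  ((z.1⁻¹ : ℝ) : ℂ) * ((q (z.1 • z.2) : ℂ) * (𝓕 F z.2 * (starRingEnd ℂ) (𝓕 G z.2)))

lemma measurable_calderonKernel (hq : Measurable q) (hF : IsTame F) (hG : IsTame G) :
    Measurable (calderonKernel q F G) := by
  have hF' := (continuous_fourier hF.integrable).measurable
  have hG' := (continuous_fourier hG.integrable).measurable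
  have h1 : Measurable fun z : ℝ × E m => q (z.1 • z.2) := by fun_prop
  have h2 : Measurable fun z : ℝ × E m => (starRingEnd ℂ) (𝓕 G z.2) :=
    Complex.continuous_conj.measurable.comp (hG'.comp measurable_snd)
  have h3 : Measurable fun z : ℝ × E m => 𝓕 F z.2 := hF'.comp measurable_snd
  have h4 : Measurable fun z : ℝ × E m => (z.1⁻¹ : ℝ) := measurable_fst.inv
  exact (Complex.measurable_ofReal.comp h4).mul
    ((Complex.measurable_ofReal.comp h1).mul (h3.mul h2))

lemma enorm_calderonKernel (hq : ∀ ξ, 0 ≤ q ξ) {r : ℝ} (hr : 0 < r) (ξ : E m) :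
    ‖calderonKernel q F G (r, ξ)‖ₑ
      = (ENNReal.ofReal (q (r • ξ)) * (ENNReal.ofReal r)⁻¹) * (‖𝓕 F ξ‖ₑ * ‖𝓕 G ξ‖ₑ) := by
  rw [calderonKernel, enorm_mul, enorm_mul, enorm_mul, RCLike.enorm_conj,
    enorm_ofReal_of_nonneg (hq _), enorm_ofReal_of_nonneg (inv_nonneg.2 hr.le),
    ENNReal.ofReal_inv_of_pos hr]
  ring

lemma IsCalderonPair.lintegral_calderonKernel_le (h : IsCalderonPair φ ψ q) (hm : 1 ≤ m)
    (hF : IsTame F) (hG : IsTame G) :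
    ∫⁻ r in Ioi (0 : ℝ), ∫⁻ ξ, ‖calderonKernel q F G (r, ξ)‖ₑ
      ≤ (∫⁻ x, ‖F x‖ₑ ^ 2) + ∫⁻ x, ‖G x‖ₑ ^ 2 := by
  have hK := (measurable_calderonKernel h.measurable hF hG).enorm
  rw [lintegral_lintegral_swap hK.aemeasurable,
    ← lintegral_enorm_fourier_sq hF.integrable hF.memLp_two,
    ← lintegral_enorm_fourier_sq hG.integrable hG.memLp_two,
    ← lintegral_add_left ((continuous_fourier hF.integrable).measurable.enorm.pow_const 2)]
  refine lintegral_mono_ae ?_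
  filter_upwards [ae_ne_zero hm] with ξ hξ
  have e : ∫⁻ r in Ioi (0 : ℝ), ‖calderonKernel q F G (r, ξ)‖ₑ = ‖𝓕 F ξ‖ₑ * ‖𝓕 G ξ‖ₑ := by
    rw [setLIntegral_congr_fun measurableSet_Ioi
      (fun r hr => enorm_calderonKernel (F := F) (G := G) h.nonneg hr ξ), lintegral_mul_const',
      h.lintegral_eq_one ξ hξ, one_mul]
    exact ENNReal.mul_ne_top enorm_ne_top enorm_ne_top
  rw [e]
  rcases le_total ‖𝓕 F ξ‖ₑ ‖𝓕 G ξ‖ₑ with hle | hle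
  · exact le_add_left ((mul_le_mul_left hle _).trans_eq (sq _).symm)
  · exact le_add_right ((mul_le_mul_right hle _).trans_eq (sq _).symm)

lemma IsCalderonPair.inv_mul_scalePairing (h : IsCalderonPair φ ψ q)
    (hφm : Measurable φ) (hφ : Integrable φ) (hψm : Measurable ψ) (hψ : Integrable ψ)
    (hF : IsTame F) (hG : IsTame G) {r : ℝ} (hr : 0 < r) :
    ((r⁻¹ : ℝ) : ℂ) * scalePairing φ ψ F G r = ∫ ξ, calderonKernel q F G (r, ξ) := by
  rw [h.scalePairing_eq hφm hφ hψm hψ hF hG hr, ← integral_const_mul]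
  rfl

lemma IsCalderonPair.lintegral_scalePairing_le (h : IsCalderonPair φ ψ q) (hm : 1 ≤ m)
    (hφm : Measurable φ) (hφ : Integrable φ) (hψm : Measurable ψ) (hψ : Integrable ψ)
    (hF : IsTame F) (hG : IsTame G) :
    ∫⁻ r in Ioi (0 : ℝ), ‖((r⁻¹ : ℝ) : ℂ) * scalePairing φ ψ F G r‖ₑ
      ≤ (∫⁻ x, ‖F x‖ₑ ^ 2) + ∫⁻ x, ‖G x‖ₑ ^ 2 := by
  refine le_trans (setLIntegral_mono' measurableSet_Ioi fun r hr => ?_)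
    (h.lintegral_calderonKernel_le hm hF hG)
  rw [h.inv_mul_scalePairing hφm hφ hψm hψ hF hG hr]
  exact enorm_integral_le_lintegral_enorm _

/-- Calderón's reproducing formula, in weak form. -/
lemma IsCalderonPair.integral_mul_conj_eq (h : IsCalderonPair φ ψ q) (hm : 1 ≤ m)
    (hφm : Measurable φ) (hφ : Integrable φ) (hψm : Measurable ψ) (hψ : Integrable ψ)
    (hF : IsTame F) (hG : IsTame G) :
    ∫ x, F x * (starRingEnd ℂ) (G x)
      = ∫ r in Ioi (0 : ℝ), ((r⁻¹ : ℝ) : ℂ) * scalePairing φ ψ F G r := by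
  have hK := measurable_calderonKernel h.measurable hF hG
  -- The kernel is absolutely integrable, so that the frequency and the scale can be exchanged.
  have hint : Integrable (calderonKernel q F G) ((volume.restrict (Ioi (0 : ℝ))).prod volume) := by
    refine ⟨hK.aestronglyMeasurable, ?_⟩
    rw [hasFiniteIntegral_iff_enorm, lintegral_prod _ hK.enorm.aemeasurable]
    refine lt_of_le_of_lt (h.lintegral_calderonKernel_le hm hF hG) ?_
    exact ENNReal.add_lt_top.2
      ⟨hF.lintegral_enorm_sq_ne_top.lt_top, hG.lintegral_enorm_sq_ne_top.lt_top⟩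
  rw [setIntegral_congr_fun measurableSet_Ioi
    (fun r hr => h.inv_mul_scalePairing hφm hφ hψm hψ hF hG hr),
    integral_integral_swap (f := fun r ξ => calderonKernel q F G (r, ξ)) hint, ← integral_mul_conj_fourier hF.integrable hF.memLp_two
      hG.integrable hG.memLp_two]
  refine integral_congr_ae ?_
  filter_upwards [ae_ne_zero hm] with ξ hξ
  have e : ∀ r : ℝ, calderonKernel q F G (r, ξ)
      = ((r⁻¹ * q (r • ξ) : ℝ) : ℂ) * (𝓕 F ξ * (starRingEnd ℂ) (𝓕 G ξ)) := by
    intro r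
    rw [calderonKernel]; push_cast; ring
  have hq1 : Measurable fun r : ℝ => r⁻¹ * q (r • ξ) := by
    have := h.measurable
    fun_prop
  have e1 : ∫ r in Ioi (0 : ℝ), r⁻¹ * q (r • ξ) = 1 := by
    rw [integral_eq_lintegral_of_nonneg_ae _ hq1.aestronglyMeasurable]
    · rw [setLIntegral_congr_fun measurableSet_Ioi (g := fun r : ℝ =>
        ENNReal.ofReal (q (r • ξ)) * (ENNReal.ofReal r)⁻¹) fun r hr => ?_,
        h.lintegral_eq_one ξ hξ, ENNReal.toReal_one]
      simp only
      rw [mul_comm, ENNReal.ofReal_mul (h.nonneg _), ENNReal.ofReal_inv_of_pos hr]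
    · filter_upwards [ae_restrict_mem measurableSet_Ioi] with r hr
      exact mul_nonneg (inv_nonneg.2 (le_of_lt hr)) (h.nonneg _)
  simp_rw [e]
  rw [integral_mul_const, integral_complex_ofReal, e1, Complex.ofReal_one, one_mul]

end

/-! ### Calderón's formula along a direction of `ℝᵐ × ℝᵐ` -/

lemma lintegral_enorm_dirSmear_le {ι : E m → E m × E m} (hι : Measurable ι) {φ : E m → ℂ}
    (hφ : Measurable φ) {f : E m × E m → ℂ} (hf : Measurable f) {r : ℝ} (hr : 0 < r) :
    ∫⁻ z, ‖dirSmear ι φ r f z‖ₑ ≤ (∫⁻ s, ‖φ s‖ₑ) * ∫⁻ z, ‖f z‖ₑ := by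
  have hd : Measurable (dilate φ r) :=
    (measurable_dilate hφ).comp (measurable_const.prodMk measurable_id)
  have hm : Measurable fun p : (E m × E m) × E m => ‖dilate φ r p.2‖ₑ * ‖f (p.1 - ι p.2)‖ₑ :=
    (hd.comp measurable_snd).enorm.mul (hf.comp (by fun_prop)).enorm
  calc ∫⁻ z, ‖dirSmear ι φ r f z‖ₑ
      ≤ ∫⁻ z, ∫⁻ s, ‖dilate φ r s‖ₑ * ‖f (z - ι s)‖ₑ := by
        refine lintegral_mono fun z => (enorm_integral_le_lintegral_enorm _).trans_eq ?_
        simp only [enorm_mul]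
    _ = ∫⁻ s, ∫⁻ z, ‖dilate φ r s‖ₑ * ‖f (z - ι s)‖ₑ := lintegral_lintegral_swap hm.aemeasurable
    _ = ∫⁻ s, ‖dilate φ r s‖ₑ * ∫⁻ z, ‖f z‖ₑ := by
        refine lintegral_congr fun s => ?_
        rw [lintegral_const_mul' _ _ enorm_ne_top,
          lintegral_sub_right_eq_self (fun z => ‖f z‖ₑ) (ι s)]
    _ = (∫⁻ s, ‖φ s‖ₑ) * ∫⁻ z, ‖f z‖ₑ := by
        rw [lintegral_mul_const _ hd.enorm, lintegral_enorm_dilate φ hr]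

section
variable {T : E m × E m → E m × E m} {ι : E m → E m × E m} {φ ψ : E m → ℂ} {q : E m → ℝ}
  {F G : E m × E m → ℂ}

lemma IsTame.dirSmear (hι : Measurable ι) (hφm : Measurable φ) (hφ : Integrable φ)
    (hF : IsTame F) {r : ℝ} (hr : 0 < r) : IsTame (TwistedLP.dirSmear ι φ r F) := by
  obtain ⟨D, hD⟩ := hF.exists_bound
  have h1 := measurable_dirSmear₁ hι hφm r hF.measurable
  refine ⟨h1, ⟨h1.aestronglyMeasurable, ?_⟩, _, norm_dirSmear_le ι hφ hr hD⟩
  exact (lintegral_enorm_dirSmear_le hι hφm hF.measurable hr).trans_lt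
    (ENNReal.mul_lt_top hφ.2 hF.integrable.2)

lemma IsDirection.integrable_comp (hT : IsDirection T ι) (hF : Integrable F) :
    Integrable (fun y => F (T y)) (volume.prod volume) :=
  hT.measurePreserving.integrable_comp_of_integrable hF

lemma IsDirection.integral_eq (hT : IsDirection T ι) (hF : Integrable F) :
    ∫ z, F z = ∫ y₁, ∫ y₂, F (T (y₁, y₂)) := by
  have h : ∫ z, F z = ∫ y, F (T y) := by
    conv_lhs => rw [← hT.measurePreserving.map_eq]
    refine integral_map hT.measurePreserving.measurable.aemeasurable ?_
    rw [hT.measurePreserving.map_eq]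
    exact hF.1
  rw [h, Measure.volume_eq_prod, integral_prod _ (hT.integrable_comp hF)]

lemma IsDirection.isTame_slice (hT : IsDirection T ι) (hF : IsTame F) :
    ∀ᵐ y₁, IsTame fun y₂ => F (T (y₁, y₂)) := by
  obtain ⟨D, hD⟩ := hF.exists_bound
  filter_upwards [(hT.integrable_comp hF.integrable).prod_right_ae] with y₁ h
  exact ⟨hT.measurable_slice hF.measurable y₁, h, D, fun y₂ => hD _⟩

/-- The pairing at scale `r` of two functions smeared along a direction. -/
def dirPairing (ι : E m → E m × E m) (φ ψ : E m → ℂ) (F G : E m × E m → ℂ) (r : ℝ) : ℂ :=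
  ∫ z, dirSmear ι φ r F z * (starRingEnd ℂ) (dirSmear ι ψ r G z)

lemma IsDirection.dirPairing_eq (hT : IsDirection T ι) (hφm : Measurable φ) (hφ : Integrable φ)
    (hψm : Measurable ψ) (hψ : Integrable ψ) (hF : IsTame F) (hG : IsTame G) {r : ℝ} (hr : 0 < r) :
    dirPairing ι φ ψ F G r = ∫ y₁, scalePairing φ ψ (fun y₂ => F (T (y₁, y₂)))
      (fun y₂ => G (T (y₁, y₂))) r := by
  have h := (hF.dirSmear hT.measurable hφm hφ hr).integrable_mul_conj
    (hG.dirSmear hT.measurable hψm hψ hr)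
  rw [dirPairing, hT.integral_eq h]
  simp only [hT.dirSmear_apply, scalePairing]

lemma IsDirection.measurable_scalePairing (hT : IsDirection T ι) (hφ : Measurable φ)
    (hψ : Measurable ψ) (hF : Measurable F) (hG : Measurable G) :
    Measurable fun p : E m × ℝ => scalePairing φ ψ (fun y₂ => F (T (p.1, y₂)))
      (fun y₂ => G (T (p.1, y₂))) p.2 := by
  have key : ∀ {χ : E m → ℂ} {H : E m × E m → ℂ}, Measurable χ → Measurable H →
      Measurable fun q : (E m × ℝ) × E m => smear χ q.1.2 (fun y₂ => H (T (q.1.1, y₂))) q.2 := by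
    intro χ H hχ hH
    have h := measurable_dirSmear (S := Unit) hT.measurable hχ (f := fun _ => H) (by fun_prop)
    have h' := h.comp (f := fun q : (E m × ℝ) × E m => ((q.1.2, ()), T (q.1.1, q.2)))
      (by have := hT.measurePreserving.measurable; fun_prop)
    simpa only [Function.comp_def, hT.dirSmear_apply] using h'
  have h2 : Measurable fun q : (E m × ℝ) × E m =>
      (starRingEnd ℂ) (smear ψ q.1.2 (fun y₂ => G (T (q.1.1, y₂))) q.2) :=
    Complex.continuous_conj.measurable.comp (key hψ hG)
  exact ((key hφ hF).mul h2).stronglyMeasurable.integral_prod_right.measurable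

/-- The pairing of two functions is controlled by their pairings at all scales along a single
direction: Calderón's formula on each fibre, integrated over the fibres. -/
lemma IsDirection.enorm_integral_mul_conj_le (hT : IsDirection T ι) (h : IsCalderonPair φ ψ q)
    (hm : 1 ≤ m) (hφm : Measurable φ) (hφ : Integrable φ) (hψm : Measurable ψ) (hψ : Integrable ψ)
    (hF : IsTame F) (hG : IsTame G) :
    ‖∫ z, F z * (starRingEnd ℂ) (G z)‖ₑ
      ≤ ∫⁻ r in Ioi (0 : ℝ), ‖dirPairing ι φ ψ F G r‖ₑ * (ENNReal.ofReal r)⁻¹ := by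
  obtain ⟨J, hJ⟩ : ∃ J : E m → ℝ → ℂ, ∀ y r, J y r = ((r⁻¹ : ℝ) : ℂ) *
      scalePairing φ ψ (fun y₂ => F (T (y, y₂))) (fun y₂ => G (T (y, y₂))) r := ⟨_, fun _ _ => rfl⟩
  have hJm : Measurable fun p : E m × ℝ => J p.1 p.2 := by
    simp only [hJ]
    have h1 : Measurable fun p : E m × ℝ => ((p.2⁻¹ : ℝ) : ℂ) :=
      Complex.measurable_ofReal.comp measurable_snd.inv
    exact h1.mul (hT.measurable_scalePairing hφm hψm hF.measurable hG.measurable)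
  -- The fibrewise bounds by `L²` norms are integrable over the fibres.
  have hJi : Integrable (Function.uncurry J) (volume.prod (volume.restrict (Ioi (0 : ℝ)))) := by
    refine ⟨hJm.aestronglyMeasurable, ?_⟩
    rw [hasFiniteIntegral_iff_enorm]
    change ∫⁻ p : E m × ℝ, ‖J p.1 p.2‖ₑ ∂_ < ∞
    rw [lintegral_prod _ hJm.enorm.aemeasurable]
    have hb : ∫⁻ y, ∫⁻ r in Ioi (0 : ℝ), ‖J y r‖ₑ
        ≤ ∫⁻ y₁, ((∫⁻ y₂, ‖F (T (y₁, y₂))‖ₑ ^ 2) + ∫⁻ y₂, ‖G (T (y₁, y₂))‖ₑ ^ 2) := by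
      refine lintegral_mono_ae ?_
      filter_upwards [hT.isTame_slice hF, hT.isTame_slice hG] with y hFy hGy
      simp only [hJ]
      exact h.lintegral_scalePairing_le hm hφm hφ hψm hψ hFy hGy
    refine hb.trans_lt ?_
    have hTm := hT.measurePreserving.measurable
    have hFm : Measurable fun p : E m × E m => ‖F (T (p.1, p.2))‖ₑ ^ 2 :=
      (hF.measurable.comp hTm).enorm.pow_const 2
    rw [lintegral_add_left hFm.lintegral_prod_right',
      ← hT.lintegral_eq (h := fun z => ‖F z‖ₑ ^ 2) (hF.measurable.enorm.pow_const 2),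
      ← hT.lintegral_eq (h := fun z => ‖G z‖ₑ ^ 2) (hG.measurable.enorm.pow_const 2)]
    exact ENNReal.add_lt_top.2
      ⟨hF.lintegral_enorm_sq_ne_top.lt_top, hG.lintegral_enorm_sq_ne_top.lt_top⟩
  have e : ∫ z, F z * (starRingEnd ℂ) (G z)
      = ∫ r in Ioi (0 : ℝ), ((r⁻¹ : ℝ) : ℂ) * dirPairing ι φ ψ F G r := by
    rw [hT.integral_eq (hF.integrable_mul_conj hG)]
    have e1 : ∫ y₁, ∫ y₂, F (T (y₁, y₂)) * (starRingEnd ℂ) (G (T (y₁, y₂)))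
        = ∫ y, ∫ r in Ioi (0 : ℝ), J y r := by
      refine integral_congr_ae ?_
      filter_upwards [hT.isTame_slice hF, hT.isTame_slice hG] with y hFy hGy
      simp only [hJ]
      exact h.integral_mul_conj_eq hm hφm hφ hψm hψ hFy hGy
    rw [e1, integral_integral_swap hJi]
    refine setIntegral_congr_fun measurableSet_Ioi fun r hr => ?_
    simp only [hJ]
    rw [hT.dirPairing_eq hφm hφ hψm hψ hF hG hr, integral_const_mul]
  rw [e]
  refine (enorm_integral_le_lintegral_enorm _).trans_eq
    (setLIntegral_congr_fun measurableSet_Ioi fun r hr => ?_)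
  rw [enorm_mul, enorm_ofReal_of_nonneg (inv_nonneg.2 (le_of_lt hr)), ENNReal.ofReal_inv_of_pos hr,
    mul_comm]

end

/-! ### The three-parameter Calderón formula -/

section
variable {φ₁ φ₂ φ₃ ψ₁ ψ₂ ψ₃ : E m → ℂ} {q₁ q₂ q₃ : E m → ℝ} {F G : E m × E m → ℂ}

/-- The pairing of two functions is controlled by the pairings of their twisted smears. -/
lemma enorm_integral_mul_conj_le_octant (hm : 1 ≤ m) (h₁ : IsCalderonPair φ₁ ψ₁ q₁)
    (h₂ : IsCalderonPair φ₂ ψ₂ q₂) (h₃ : IsCalderonPair φ₃ ψ₃ q₃)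
    (a₁ : Measurable φ₁) (a₂ : Measurable φ₂) (a₃ : Measurable φ₃)
    (b₁ : Integrable φ₁) (b₂ : Integrable φ₂) (b₃ : Integrable φ₃)
    (c₁ : Measurable ψ₁) (c₂ : Measurable ψ₂) (c₃ : Measurable ψ₃)
    (d₁ : Integrable ψ₁) (d₂ : Integrable ψ₂) (d₃ : Integrable ψ₃)
    (hF : IsTame F) (hG : IsTame G) :
    ‖∫ z, F z * (starRingEnd ℂ) (G z)‖ₑ
      ≤ ∫⁻ r in Ioi (0 : ℝ) ×ˢ Ioi (0 : ℝ) ×ˢ Ioi (0 : ℝ), ∫⁻ z,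
          (‖conv F (twistedDilate φ₁ φ₂ φ₃ r) z‖ₑ * ‖conv G (twistedDilate ψ₁ ψ₂ ψ₃ r) z‖ₑ)
            / ENNReal.ofReal (r.1 * r.2.1 * r.2.2) := by
  obtain ⟨D, hD⟩ := hF.exists_bound
  obtain ⟨D', hD'⟩ := hG.exists_bound
  have hd := fun i => isDirection_dir (m := m) i
  obtain ⟨K, hK⟩ : ∃ K : ℝ → ℝ → ℝ → ℝ≥0∞, ∀ r₁ r₂ r₃, K r₁ r₂ r₃ = ‖dirPairing (dirVec 0) φ₁ ψ₁
      (dirSmear (dirVec 1) φ₂ r₂ (dirSmear (dirVec 2) φ₃ r₃ F))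
      (dirSmear (dirVec 1) ψ₂ r₂ (dirSmear (dirVec 2) ψ₃ r₃ G)) r₁‖ₑ := ⟨_, fun _ _ _ => rfl⟩
  -- Apply the bound for one direction three times, starting with the innermost convolution.
  have s1 : ‖∫ z, F z * (starRingEnd ℂ) (G z)‖ₑ ≤ ∫⁻ r₃ in Ioi (0 : ℝ), ∫⁻ r₂ in Ioi (0 : ℝ),
      ∫⁻ r₁ in Ioi (0 : ℝ), K r₁ r₂ r₃ * (ENNReal.ofReal r₁)⁻¹ *
        ((ENNReal.ofReal r₂)⁻¹ * (ENNReal.ofReal r₃)⁻¹) := by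
    refine ((hd 2).enorm_integral_mul_conj_le h₃ hm a₃ b₃ c₃ d₃ hF hG).trans ?_
    refine setLIntegral_mono' measurableSet_Ioi fun r₃ hr₃ => ?_
    have hF3 := hF.dirSmear (hd 2).measurable a₃ b₃ hr₃
    have hG3 := hG.dirSmear (hd 2).measurable c₃ d₃ hr₃
    have n3 : (ENNReal.ofReal r₃)⁻¹ ≠ ∞ := ENNReal.inv_ne_top.2 (ofReal_pos_ne hr₃).1
    have t2 := (hd 1).enorm_integral_mul_conj_le h₂ hm a₂ b₂ c₂ d₂ hF3 hG3
    refine (mul_le_mul_left t2 _).trans ?_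
    rw [← lintegral_mul_const' _ _ n3]
    refine setLIntegral_mono' measurableSet_Ioi fun r₂ hr₂ => ?_
    have hF2 := hF3.dirSmear (hd 1).measurable a₂ b₂ hr₂
    have hG2 := hG3.dirSmear (hd 1).measurable c₂ d₂ hr₂
    have n2 : (ENNReal.ofReal r₂)⁻¹ ≠ ∞ := ENNReal.inv_ne_top.2 (ofReal_pos_ne hr₂).1
    have t1 := (hd 0).enorm_integral_mul_conj_le h₁ hm a₁ b₁ c₁ d₁ hF2 hG2
    rw [mul_assoc]
    refine (mul_le_mul_left t1 _).trans ?_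
    rw [← lintegral_mul_const' _ _ (ENNReal.mul_ne_top n2 n3)]
    simp only [hK]
    exact le_rfl
  obtain ⟨L, hL⟩ : ∃ L : ℝ × ℝ × ℝ → ℝ≥0∞, ∀ r, L r = ∫⁻ z,
      (‖conv F (twistedDilate φ₁ φ₂ φ₃ r) z‖ₑ * ‖conv G (twistedDilate ψ₁ ψ₂ ψ₃ r) z‖ₑ)
        / ENNReal.ofReal (r.1 * r.2.1 * r.2.2) := ⟨_, fun _ => rfl⟩
  have hLm : Measurable L := by
    have e : L = fun r => ∫⁻ z,
      (‖conv F (twistedDilate φ₁ φ₂ φ₃ r) z‖ₑ * ‖conv G (twistedDilate ψ₁ ψ₂ ψ₃ r) z‖ₑ)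
        / ENNReal.ofReal (r.1 * r.2.1 * r.2.2) := funext hL
    rw [e]
    have k1 : Measurable fun p : (ℝ × ℝ × ℝ) × (E m × E m) =>
        ‖conv F (twistedDilate φ₁ φ₂ φ₃ p.1) p.2‖ₑ :=
      ((measurable_conv_twistedDilate a₁ a₂ a₃ hF.measurable).comp measurable_swap).enorm
    have k2 : Measurable fun p : (ℝ × ℝ × ℝ) × (E m × E m) =>
        ‖conv G (twistedDilate ψ₁ ψ₂ ψ₃ p.1) p.2‖ₑ :=
      ((measurable_conv_twistedDilate c₁ c₂ c₃ hG.measurable).comp measurable_swap).enorm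
    have k3 : Measurable fun p : (ℝ × ℝ × ℝ) × (E m × E m) =>
        ENNReal.ofReal (p.1.1 * p.1.2.1 * p.1.2.2) := by fun_prop
    exact ((k1.mul k2).div k3).lintegral_prod_right'
  simp only [← hL]
  rw [setLIntegral_octant L hLm]
  refine s1.trans (setLIntegral_mono' measurableSet_Ioi fun r₃ hr₃ =>
    setLIntegral_mono' measurableSet_Ioi fun r₂ hr₂ =>
    setLIntegral_mono' measurableSet_Ioi fun r₁ hr₁ => ?_)
  have hr : (r₁, r₂, r₃) ∈ Ioi (0 : ℝ) ×ˢ Ioi (0 : ℝ) ×ˢ Ioi (0 : ℝ) := ⟨hr₁, hr₂, hr₃⟩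
  have ew : (ENNReal.ofReal r₁)⁻¹ * ((ENNReal.ofReal r₂)⁻¹ * (ENNReal.ofReal r₃)⁻¹)
      = (ENNReal.ofReal (r₁ * r₂ * r₃))⁻¹ := by
    rw [ENNReal.ofReal_mul (mul_pos hr₁ hr₂).le, ENNReal.ofReal_mul (le_of_lt hr₁),
      ENNReal.mul_inv (Or.inr ENNReal.ofReal_ne_top) (Or.inr (ofReal_pos_ne hr₃).1),
      ENNReal.mul_inv (Or.inr ENNReal.ofReal_ne_top) (Or.inl ENNReal.ofReal_ne_top), mul_assoc]
  rw [hL, mul_assoc, ew]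
  simp only [ENNReal.div_eq_inv_mul]
  rw [lintegral_const_mul' _ _ (ENNReal.inv_ne_top.2 (ofReal_pos_ne
    (mul_pos (mul_pos hr₁ hr₂) hr₃)).1), mul_comm, hK]
  refine mul_le_mul_right ((enorm_integral_le_lintegral_enorm _).trans_eq
    (lintegral_congr fun z => ?_)) _
  rw [conv_twistedDilate b₁ b₂ b₃ hr hF.measurable hD, conv_twistedDilate d₁ d₂ d₃ hr hG.measurable hD',
    enorm_mul, RCLike.enorm_conj]
  rfl

end

/-! ### Construction of the dual function -/

/-- The open annulus `a < ‖ξ‖ < b`. -/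
def annulus (m : ℕ) (a b : ℝ) : Set (E m) := {ξ | a < ‖ξ‖ ∧ ‖ξ‖ < b}

lemma isOpen_annulus (a b : ℝ) : IsOpen (annulus m a b) :=
  (isOpen_lt continuous_const continuous_norm).inter (isOpen_lt continuous_norm continuous_const)

/-- By compactness of the sphere, a single annulus meets the nonvanishing set of `h` along every
ray. -/
lemma exists_annulus {h : E m → ℂ} (hc : Continuous h)
    (hn : ∀ ξ : E m, ξ ≠ 0 → ∃ r : ℝ, 0 < r ∧ h (r • ξ) ≠ 0) :
    ∃ a b : ℝ, 0 < a ∧ ∀ ξ : E m, ξ ≠ 0 → ∃ t : ℝ,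
      Real.exp t • ξ ∈ annulus m a b ∧ h (Real.exp t • ξ) ≠ 0 := by
  -- `U n` is the set of points whose ray meets the nonvanishing set at a scale between `1 / (n + 1)`
  -- and `n + 1`.
  obtain ⟨U, hU⟩ : ∃ U : ℕ → Set (E m), ∀ n ξ, ξ ∈ U n ↔
      ∃ r : ℝ, 1 / ((n : ℝ) + 1) < r ∧ r < n + 1 ∧ h (r • ξ) ≠ 0 :=
    ⟨fun n => {ξ | ∃ r : ℝ, 1 / ((n : ℝ) + 1) < r ∧ r < n + 1 ∧ h (r • ξ) ≠ 0}, fun _ _ => Iff.rfl⟩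
  have hUo : ∀ n, IsOpen (U n) := by
    intro n
    have e : U n = ⋃ r ∈ Ioo (1 / ((n : ℝ) + 1)) (n + 1), {ξ | h (r • ξ) ≠ 0} := by
      ext ξ
      rw [hU]
      simp only [mem_iUnion, mem_Ioo, exists_prop, and_assoc]
      rfl
    rw [e]
    exact isOpen_biUnion fun r _ => isOpen_ne_fun (by fun_prop) continuous_const
  have hmono : Monotone U := by
    intro n k hnk ξ hξ
    rw [hU] at hξ ⊢
    obtain ⟨r, h1, h2, h3⟩ := hξ
    have hnk' : (n : ℝ) ≤ k := by exact_mod_cast hnk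
    refine ⟨r, lt_of_le_of_lt ?_ h1, by linarith, h3⟩
    exact one_div_le_one_div_of_le (by positivity) (by linarith)
  obtain ⟨n, hn'⟩ := (isCompact_sphere (0 : E m) 1).elim_directed_cover U hUo (by
    intro ξ hξ
    have hξ0 : ξ ≠ 0 := by
      rintro rfl
      simp at hξ
    obtain ⟨r, hr, hrξ⟩ := hn ξ hξ0
    obtain ⟨n, hn⟩ := exists_nat_gt (max r (1 / r))
    refine mem_iUnion.2 ⟨n, (hU n ξ).2 ⟨r, ?_, ?_, hrξ⟩⟩
    · rw [one_div_lt (by positivity) hr]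
      linarith [le_max_right r (1 / r)]
    · linarith [le_max_left r (1 / r)]) hmono.directed_le
  refine ⟨1 / ((n : ℝ) + 1), n + 1, by positivity, fun ξ hξ => ?_⟩
  have hξn : 0 < ‖ξ‖ := norm_pos_iff.2 hξ
  have h1 : ‖ξ‖⁻¹ • ξ ∈ sphere (0 : E m) 1 := by
    simp [norm_smul, inv_mul_cancel₀ hξn.ne']
  obtain ⟨r, hr1, hr2, hr3⟩ := (hU n _).1 (hn' h1)
  have hr : 0 < r := lt_trans (by positivity) hr1
  refine ⟨Real.log (r * ‖ξ‖⁻¹), ?_⟩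
  rw [Real.exp_log (by positivity), mul_smul]
  refine ⟨?_, hr3⟩
  have e : ‖r • ‖ξ‖⁻¹ • ξ‖ = r := by
    rw [norm_smul, mem_sphere_zero_iff_norm.1 h1, mul_one, Real.norm_of_nonneg hr.le]
  exact ⟨by rw [e]; exact hr1, by rw [e]; exact hr2⟩

/-- The integral of `q` over the ray through `ξ`, with respect to the dilation invariant
measure. -/
def rayIntegral (q : E m → ℝ) (ξ : E m) : ℝ := ∫ t : ℝ, q (Real.exp t • ξ)

/-- Ray integrals are dilation invariant. -/
lemma rayIntegral_exp_smul (q : E m → ℝ) (s : ℝ) (ξ : E m) :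
    rayIntegral q (Real.exp s • ξ) = rayIntegral q ξ := by
  have h := integral_add_right_eq_self (μ := volume) (fun t : ℝ => q (Real.exp t • ξ)) s
  rw [rayIntegral, rayIntegral, ← h]
  simp only [smul_smul, ← Real.exp_add]

/-- The measure `dr / r` is the image of Lebesgue measure under the exponential function. -/
lemma lintegral_Ioi_eq_exp (g : ℝ → ℝ≥0∞) :
    ∫⁻ r in Ioi (0 : ℝ), g r * (ENNReal.ofReal r)⁻¹ = ∫⁻ t : ℝ, g (Real.exp t) := by
  have h := lintegral_image_eq_lintegral_abs_deriv_mul (s := univ) MeasurableSet.univ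
    (fun x _ => (Real.hasDerivAt_exp x).hasDerivWithinAt) Real.exp_injective.injOn
    (fun r => g r * (ENNReal.ofReal r)⁻¹)
  rw [image_univ, Real.range_exp, Measure.restrict_univ] at h
  rw [h]
  refine lintegral_congr fun t => ?_
  have h0 := ofReal_pos_ne (Real.exp_pos t)
  rw [abs_of_pos (Real.exp_pos t), mul_comm, mul_assoc, ENNReal.inv_mul_cancel h0.1 h0.2, mul_one]

section
variable {q : E m → ℝ} {a b : ℝ}

lemma eq_zero_of_notMem_Icc (ha : 0 < a) (hq : ∀ ξ, ξ ∉ annulus m a b → q ξ = 0) {ρ : ℝ}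
    (hρ : 0 < ρ) {ξ : E m} (h1 : ρ / 2 < ‖ξ‖) (h2 : ‖ξ‖ < 2 * ρ) {t : ℝ}
    (ht : t ∉ Icc (Real.log (a / (2 * ρ))) (Real.log (2 * b / ρ))) : q (Real.exp t • ξ) = 0 := by
  refine hq _ fun hmem => ht ?_
  have e : ‖Real.exp t • ξ‖ = Real.exp t * ‖ξ‖ := by
    rw [norm_smul, Real.norm_of_nonneg (Real.exp_pos t).le]
  obtain ⟨h3, h4⟩ := hmem
  rw [e] at h3 h4
  have hb : 0 < b := ha.trans (h3.trans h4)
  have hp := Real.exp_pos t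
  constructor
  · rw [Real.log_le_iff_le_exp (by positivity), div_le_iff₀ (by positivity)]
    nlinarith
  · rw [Real.le_log_iff_exp_le (by positivity), le_div_iff₀ hρ]
    nlinarith

/-- Ray integrals of a function supported in an annulus are smooth away from the origin: there they
are locally integrals over a fixed compact interval. -/
lemma contDiffAt_rayIntegral (ha : 0 < a) (hq : ∀ ξ, ξ ∉ annulus m a b → q ξ = 0)
    {n : ℕ∞} (hs : ContDiff ℝ n q) {ξ : E m} (hξ : ξ ≠ 0) :
    ContDiffAt ℝ n (rayIntegral q) ξ := by
  have hξn : 0 < ‖ξ‖ := norm_pos_iff.2 hξ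
  have hop := isOpen_annulus (m := m) (‖ξ‖ / 2) (2 * ‖ξ‖)
  have h := contDiffOn_convolution_left_with_param_comp (μ := (volume : Measure ℝ)) (𝕜 := ℝ)
    (ContinuousLinearMap.mul ℝ ℝ) (s := annulus m (‖ξ‖ / 2) (2 * ‖ξ‖)) (n := n)
    (v := fun _ => (0 : ℝ)) contDiffOn_const (f := fun _ => (1 : ℝ))
    (g := fun ξ t => q (Real.exp t • ξ)) hop isCompact_Icc
    (fun p x hp hx => eq_zero_of_notMem_Icc ha hq hξn hp.1 hp.2 hx)
    (continuous_const.locallyIntegrable) (by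
      refine ContDiff.contDiffOn ?_
      have h1 : ContDiff ℝ n fun p : E m × ℝ => Real.exp p.2 • p.1 :=
        (Real.contDiff_exp.comp contDiff_snd).smul contDiff_fst
      exact hs.comp h1)
  have h2 : ContDiffOn ℝ n (rayIntegral q) (annulus m (‖ξ‖ / 2) (2 * ‖ξ‖)) := by
    refine h.congr fun x _ => ?_
    simp [convolution, rayIntegral]
  exact h2.contDiffAt (hop.mem_nhds ⟨by linarith, by linarith⟩)

lemma integrable_exp_smul (ha : 0 < a) (hq : ∀ ξ, ξ ∉ annulus m a b → q ξ = 0)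
    (hc : Continuous q) {ξ : E m} (hξ : ξ ≠ 0) : Integrable fun t : ℝ => q (Real.exp t • ξ) := by
  have hξn : 0 < ‖ξ‖ := norm_pos_iff.2 hξ
  have h1 : Continuous fun t : ℝ => q (Real.exp t • ξ) :=
    hc.comp (Real.continuous_exp.smul continuous_const)
  exact h1.integrable_of_hasCompactSupport (HasCompactSupport.intro isCompact_Icc
    fun t ht => eq_zero_of_notMem_Icc ha hq hξn (by linarith) (by linarith) ht)

lemma rayIntegral_pos (ha : 0 < a) (hq : ∀ ξ, ξ ∉ annulus m a b → q ξ = 0)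
    (hc : Continuous q) (h0 : ∀ ξ, 0 ≤ q ξ) {ξ : E m} (hξ : ξ ≠ 0)
    (hpos : ∃ t : ℝ, q (Real.exp t • ξ) ≠ 0) : 0 < rayIntegral q ξ := by
  obtain ⟨t, ht⟩ := hpos
  have h1 : Continuous fun t : ℝ => q (Real.exp t • ξ) :=
    hc.comp (Real.continuous_exp.smul continuous_const)
  exact integral_pos_of_integrable_nonneg_nonzero h1 (integrable_exp_smul ha hq hc hξ)
    (fun t => h0 _) ht

lemma lintegral_div_rayIntegral (ha : 0 < a) (hq : ∀ ξ, ξ ∉ annulus m a b → q ξ = 0)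
    (hc : Continuous q) (h0 : ∀ ξ, 0 ≤ q ξ) {ξ : E m} (hξ : ξ ≠ 0)
    (hpos : 0 < rayIntegral q ξ) :
    ∫⁻ r in Ioi (0 : ℝ), ENNReal.ofReal (q (r • ξ) / rayIntegral q (r • ξ)) * (ENNReal.ofReal r)⁻¹
      = 1 := by
  rw [lintegral_Ioi_eq_exp fun r => ENNReal.ofReal (q (r • ξ) / rayIntegral q (r • ξ))]
  simp only [rayIntegral_exp_smul]
  rw [← ofReal_integral_eq_lintegral_ofReal
    ((integrable_exp_smul ha hq hc hξ).div_const _)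
    (Filter.Eventually.of_forall fun t => div_nonneg (h0 _) hpos.le), integral_div,
    ← rayIntegral, div_self hpos.ne', ENNReal.ofReal_one]

end

/-- A nondegenerate Schwartz function is one half of a Calderón pair. The symbol of the other half
is `φ̂ η / D`, where `η` is a cutoff to an annulus and the dilation invariant function `D` is the
integral of `|φ̂|² η` over rays. -/
lemma exists_isCalderonPair (φ : 𝓢(E m, ℂ)) (hφ : Nondegenerate φ) :
    ∃ ψ : 𝓢(E m, ℂ), ∫ x, ψ x = 0 ∧ ∃ q : E m → ℝ, IsCalderonPair φ ψ q := by
  obtain ⟨h, hh⟩ : ∃ h : 𝓢(E m, ℂ), ∀ ξ, h ξ = 𝓕 (φ : E m → ℂ) ξ :=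
    ⟨𝓕 φ, fun ξ => by rw [SchwartzMap.fourier_coe]⟩
  obtain ⟨a, b, ha, hab⟩ := exists_annulus h.continuous (fun ξ hξ => by
    simpa only [hh] using hφ ξ hξ)
  obtain ⟨η, hη, hηs, hηr⟩ := (isOpen_annulus (m := m) a b).exists_contDiff_support_eq (n := ⊤)
  have hη0 : ∀ ξ, 0 ≤ η ξ := fun ξ => (hηr ⟨ξ, rfl⟩).1
  have hηz : ∀ ξ, ξ ∉ annulus m a b → η ξ = 0 := by
    intro ξ hξ
    rw [← hη] at hξ
    exact Function.notMem_support.1 hξ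
  obtain ⟨Q, hQ⟩ : ∃ Q : E m → ℝ, ∀ ξ, Q ξ = ‖h ξ‖ ^ 2 * η ξ := ⟨_, fun _ => rfl⟩
  have hQs : ContDiff ℝ ((⊤ : ℕ∞) : WithTop ℕ∞) Q := by
    rw [funext hQ]
    exact ((h.smooth ⊤).norm_sq ℝ).mul hηs
  have hQ0 : ∀ ξ, 0 ≤ Q ξ := fun ξ => by rw [hQ]; exact mul_nonneg (sq_nonneg _) (hη0 ξ)
  have hQz : ∀ ξ, ξ ∉ annulus m a b → Q ξ = 0 := fun ξ hξ => by rw [hQ, hηz ξ hξ, mul_zero]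
  have hD : ∀ ξ, ξ ≠ 0 → 0 < rayIntegral Q ξ := by
    intro ξ hξ
    refine rayIntegral_pos ha hQz hQs.continuous hQ0 hξ ?_
    obtain ⟨t, ht, ht'⟩ := hab ξ hξ
    refine ⟨t, ?_⟩
    rw [hQ]
    rw [← hη] at ht
    exact mul_ne_zero (pow_ne_zero 2 (norm_ne_zero_iff.2 ht')) ht
  obtain ⟨χ, hχ⟩ : ∃ χ : E m → ℂ, ∀ ξ, χ ξ = (η ξ / rayIntegral Q ξ) • h ξ := ⟨_, fun _ => rfl⟩
  have hχz : ∀ ξ, ξ ∉ annulus m a b → χ ξ = 0 := fun ξ hξ => by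
    rw [hχ, hηz ξ hξ, zero_div, zero_smul]
  have hχs : ContDiff ℝ ((⊤ : ℕ∞) : WithTop ℕ∞) χ := by
    rw [contDiff_iff_contDiffAt]
    intro ξ
    -- Near the origin the ray integral is not smooth, but there the cutoff vanishes.
    by_cases hξ : ξ = 0
    · have hev : χ =ᶠ[nhds ξ] fun _ => 0 := by
        have hb : ball (0 : E m) a ∈ nhds ξ := by rw [hξ]; exact ball_mem_nhds _ ha
        filter_upwards [hb] with x hx
        refine hχz x fun hmem => ?_
        rw [mem_ball_zero_iff] at hx
        exact absurd hmem.1 hx.le.not_gt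
      exact contDiffAt_const.congr_of_eventuallyEq hev
    · rw [funext hχ]
      exact (hηs.contDiffAt.div (contDiffAt_rayIntegral ha hQz hQs hξ) (hD ξ hξ).ne').smul
        (h.smooth ⊤).contDiffAt
  have hχc : HasCompactSupport χ := by
    refine HasCompactSupport.intro (isCompact_closedBall (0 : E m) b) fun ξ hξ => hχz ξ fun hmem => ?_
    rw [mem_closedBall_zero_iff] at hξ
    exact hξ hmem.2.le
  obtain ⟨X, hX⟩ : ∃ X : 𝓢(E m, ℂ), ∀ ξ, X ξ = χ ξ :=
    ⟨hχc.toSchwartzMap hχs, fun _ => rfl⟩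
  have hψ : ∀ ξ, 𝓕 ((𝓕⁻ X : 𝓢(E m, ℂ)) : E m → ℂ) ξ = χ ξ := by
    intro ξ
    rw [← SchwartzMap.fourier_coe, FourierTransform.fourier_fourierInv_eq, hX]
  have hqe : ∀ ξ, 𝓕 (φ : E m → ℂ) ξ * (starRingEnd ℂ) (χ ξ)
      = ((Q ξ / rayIntegral Q ξ : ℝ) : ℂ) := by
    intro ξ
    rw [← hh, hχ, hQ, Complex.real_smul, map_mul, Complex.conj_ofReal]
    have := Complex.mul_conj (h ξ)
    rw [Complex.normSq_eq_norm_sq] at this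
    rw [mul_left_comm, this]
    push_cast
    ring
  -- The partner is the inverse Fourier transform of `χ`.
  refine ⟨𝓕⁻ X, ?_, fun ξ => Q ξ / rayIntegral Q ξ, ?_, ?_, ?_, ?_⟩
  · have h0 := hψ 0
    rw [Real.fourier_eq] at h0
    simp only [inner_zero_right, neg_zero, AddChar.map_zero_eq_one, one_smul] at h0
    rw [h0]
    refine hχz 0 fun hmem => ?_
    have := hmem.1
    rw [norm_zero] at this
    exact absurd this ha.le.not_gt
  · have e : (fun ξ => Q ξ / rayIntegral Q ξ)
        = fun ξ => (𝓕 (φ : E m → ℂ) ξ * (starRingEnd ℂ) (χ ξ)).re := by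
      funext ξ
      rw [hqe, Complex.ofReal_re]
    rw [e]
    have h1 : Continuous (𝓕 (φ : E m → ℂ)) := continuous_fourier φ.integrable
    have h2 := hχs.continuous
    exact (Complex.continuous_re.comp (h1.mul (Complex.continuous_conj.comp h2))).measurable
  · intro ξ
    refine div_nonneg (hQ0 ξ) (integral_nonneg fun t => hQ0 _)
  · intro ξ
    rw [hψ, hqe]
  · intro ξ hξ
    exact lintegral_div_rayIntegral ha hQz hQs.continuous hQ0 hξ (hD ξ hξ)

/-! ### The lower bound -/

/-- The Cauchy–Schwarz inequality with a weight in the denominator. -/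
lemma lintegral_mul_div_le {S : Type*} [MeasurableSpace S] (μ : Measure S) {A B ρ : S → ℝ≥0∞}
    (hA : Measurable A) (hB : Measurable B) (hρ : Measurable ρ) :
    ∫⁻ r, (A r * B r) / ρ r ∂μ ≤
      (∫⁻ r, A r ^ 2 / ρ r ∂μ) ^ (1 / 2 : ℝ) * (∫⁻ r, B r ^ 2 / ρ r ∂μ) ^ (1 / 2 : ℝ) := by
  have hm : ∀ {D : S → ℝ≥0∞}, Measurable D → Measurable fun r => D r * (ρ r)⁻¹ ^ (1 / 2 : ℝ) :=
    fun hD => hD.mul (hρ.inv.pow_const _)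
  have h := ENNReal.lintegral_mul_le_Lp_mul_Lq μ Real.HolderConjugate.two_two
    (hm hA).aemeasurable (hm hB).aemeasurable
  have e1 : ∀ t : ℝ≥0∞, t ^ (1 / 2 : ℝ) * t ^ (1 / 2 : ℝ) = t := by
    intro t
    rw [← ENNReal.rpow_add_of_nonneg _ _ (by norm_num) (by norm_num)]
    norm_num
  have e2 : ∀ d t : ℝ≥0∞, (d * t ^ (1 / 2 : ℝ)) ^ (2 : ℝ) = d ^ 2 * t := by
    intro d t
    rw [ENNReal.mul_rpow_of_nonneg _ _ (by norm_num), ← ENNReal.rpow_mul]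
    norm_num
  simp only [e2, Pi.mul_apply] at h
  simp only [ENNReal.div_eq_inv_mul, mul_comm (ρ _)⁻¹]
  refine le_trans (le_of_eq (lintegral_congr fun r => ?_)) h
  conv_lhs => rw [← e1 (ρ r)⁻¹]
  ring

section
variable {φ₁ φ₂ φ₃ ψ₁ ψ₂ ψ₃ : E m → ℂ} {q₁ q₂ q₃ : E m → ℝ} {F G : E m × E m → ℂ}

/-- The pairing of two functions is controlled by their square functions with respect to dual
profiles. -/
lemma enorm_integral_mul_conj_le_squareFunction (hm : 1 ≤ m) (h₁ : IsCalderonPair φ₁ ψ₁ q₁)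
    (h₂ : IsCalderonPair φ₂ ψ₂ q₂) (h₃ : IsCalderonPair φ₃ ψ₃ q₃)
    (a₁ : Measurable φ₁) (a₂ : Measurable φ₂) (a₃ : Measurable φ₃)
    (b₁ : Integrable φ₁) (b₂ : Integrable φ₂) (b₃ : Integrable φ₃)
    (c₁ : Measurable ψ₁) (c₂ : Measurable ψ₂) (c₃ : Measurable ψ₃)
    (d₁ : Integrable ψ₁) (d₂ : Integrable ψ₂) (d₃ : Integrable ψ₃)
    (hF : IsTame F) (hG : IsTame G) :
    ‖∫ z, F z * (starRingEnd ℂ) (G z)‖ₑ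
      ≤ ∫⁻ z, squareFunction φ₁ φ₂ φ₃ F z * squareFunction ψ₁ ψ₂ ψ₃ G z := by
  have k1 := measurable_conv_twistedDilate a₁ a₂ a₃ hF.measurable
  have k2 := measurable_conv_twistedDilate c₁ c₂ c₃ hG.measurable
  refine (enorm_integral_mul_conj_le_octant hm h₁ h₂ h₃ a₁ a₂ a₃ b₁ b₂ b₃ c₁ c₂ c₃ d₁ d₂ d₃
    hF hG).trans ?_
  simp only [squareFunction]
  obtain ⟨U, hU⟩ : ∃ U : (E m × E m) → (ℝ × ℝ × ℝ) → ℂ,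
      ∀ z r, U z r = conv F (twistedDilate φ₁ φ₂ φ₃ r) z := ⟨_, fun _ _ => rfl⟩
  obtain ⟨V, hV⟩ : ∃ V : (E m × E m) → (ℝ × ℝ × ℝ) → ℂ,
      ∀ z r, V z r = conv G (twistedDilate ψ₁ ψ₂ ψ₃ r) z := ⟨_, fun _ _ => rfl⟩
  simp only [← hU, ← hV] at k1 k2 ⊢
  have k3 : Measurable fun r : ℝ × ℝ × ℝ => ENNReal.ofReal (r.1 * r.2.1 * r.2.2) := by fun_prop
  have k4 : Measurable fun p : (ℝ × ℝ × ℝ) × (E m × E m) => ‖U p.2 p.1‖ₑ :=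
    (k1.comp measurable_swap).enorm
  have k5 : Measurable fun p : (ℝ × ℝ × ℝ) × (E m × E m) => ‖V p.2 p.1‖ₑ :=
    (k2.comp measurable_swap).enorm
  rw [lintegral_lintegral_swap ((k4.mul k5).div (k3.comp measurable_fst)).aemeasurable]
  refine lintegral_mono fun z => ?_
  have m1 : Measurable fun r => ‖U z r‖ₑ :=
    (k1.comp (f := fun r : ℝ × ℝ × ℝ => (z, r)) measurable_prodMk_left).enorm
  have m2 : Measurable fun r => ‖V z r‖ₑ :=
    (k2.comp (f := fun r : ℝ × ℝ × ℝ => (z, r)) measurable_prodMk_left).enorm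
  exact lintegral_mul_div_le _ m1 m2 k3

end

/-- The function `|f|^{p-2} f`, which pairs with `f` to `∫ |f|^p`. It vanishes where `f` does,
whatever the value of the power of zero. -/
def dualFun (p : ℝ) (f : E m × E m → ℂ) (z : E m × E m) : ℂ := ((‖f z‖ ^ (p - 2) : ℝ) : ℂ) * f z

lemma norm_dualFun {p : ℝ} (hp : 1 < p) (f : E m × E m → ℂ) (z : E m × E m) :
    ‖dualFun p f z‖ = ‖f z‖ ^ (p - 1) := by
  rw [dualFun, norm_mul, Complex.norm_real, Real.norm_of_nonneg (by positivity)]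
  rcases eq_or_ne ‖f z‖ 0 with h | h
  · rw [h, mul_zero, Real.zero_rpow (by linarith)]
  · conv_lhs => rw [← Real.rpow_one ‖f z‖]
    rw [Real.rpow_one, ← Real.rpow_add_one h]
    congr 1; ring

lemma measurable_dualFun (p : ℝ) {f : E m × E m → ℂ} (hf : Measurable f) :
    Measurable (dualFun p f) :=
  (Complex.measurable_ofReal.comp (hf.norm.pow_const _)).mul hf

lemma mul_conj_dualFun {p : ℝ} (hp : 1 < p) (f : E m × E m → ℂ) (z : E m × E m) :
    f z * (starRingEnd ℂ) (dualFun p f z) = ((‖f z‖ ^ p : ℝ) : ℂ) := by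
  rw [dualFun, map_mul, Complex.conj_ofReal, mul_left_comm, Complex.mul_conj,
    Complex.normSq_eq_norm_sq, ← Complex.ofReal_mul]
  congr 1
  rcases eq_or_ne ‖f z‖ 0 with h | h
  · rw [h, Real.zero_rpow (by linarith : p ≠ 0)]; simp
  · rw [← Real.rpow_add_natCast h]
    congr 1; push_cast; ring

lemma isTame_of_bounded {f : E m × E m → ℂ} (hf : Measurable f) {D : ℝ} (hD : ∀ z, ‖f z‖ ≤ D)
    {B : Set (E m × E m)} (hB : volume B ≠ ∞) (hfB : ∀ z, z ∉ B → f z = 0) : IsTame f :=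
  ⟨hf, Measure.integrableOn_of_bounded (M := D) hB hf.aestronglyMeasurable
    (Filter.Eventually.of_forall hD) |>.integrable_of_forall_notMem_eq_zero hfB, D, hD⟩

lemma enorm_rpow_eq_ofReal (w : ℂ) {p : ℝ} (hp : 0 ≤ p) : ‖w‖ₑ ^ p = ENNReal.ofReal (‖w‖ ^ p) := by
  rw [← ofReal_norm, ENNReal.ofReal_rpow_of_nonneg (norm_nonneg _) hp]

/-- The lower bound for bounded functions supported in a set of finite measure, by duality. -/
lemma exists_lintegral_rpow_le_squareFunction_of_bounded (hm : 1 ≤ m) {p : ℝ} (hp : 1 < p)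
    (φ₁ φ₂ φ₃ : 𝓢(E m, ℂ)) (h₁ : Nondegenerate φ₁) (h₂ : Nondegenerate φ₂)
    (h₃ : Nondegenerate φ₃) :
    ∃ C : ℝ≥0∞, C ≠ ∞ ∧ ∀ f : E m × E m → ℂ, Measurable f → ∀ D : ℝ, (∀ z, ‖f z‖ ≤ D) →
      ∀ B : Set (E m × E m), volume B ≠ ∞ → (∀ z, z ∉ B → f z = 0) →
      ∫⁻ z, ‖f z‖ₑ ^ p ≤ C * ∫⁻ z, squareFunction φ₁ φ₂ φ₃ f z ^ p := by
  obtain ⟨ψ₁, z₁, q₁, P₁⟩ := exists_isCalderonPair φ₁ h₁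
  obtain ⟨ψ₂, z₂, q₂, P₂⟩ := exists_isCalderonPair φ₂ h₂
  obtain ⟨ψ₃, z₃, q₃, P₃⟩ := exists_isCalderonPair φ₃ h₃
  have hpq := Real.HolderConjugate.conjExponent hp
  obtain ⟨q, hq⟩ : ∃ q, q = p.conjExponent := ⟨_, rfl⟩
  rw [← hq] at hpq
  obtain ⟨C, hC, H⟩ := exists_lintegral_squareFunction_rpow_le hpq.symm.lt ψ₁ ψ₂ ψ₃ z₁ z₂ z₃
  have hp0 : 0 < p := by linarith
  have hq0 : 0 < q := hpq.symm.pos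
  have a : ∀ φ : 𝓢(E m, ℂ), Measurable φ := fun φ => φ.continuous.measurable
  have hCq : (C ^ (1 / q)) ^ p ≠ ∞ := ENNReal.rpow_ne_top_of_nonneg hp0.le
    (ENNReal.rpow_ne_top_of_nonneg (by positivity) hC)
  refine ⟨(C ^ (1 / q)) ^ p, hCq, fun f hf D hD B hB hfB => ?_⟩
  have hD0 : 0 ≤ D := (norm_nonneg _).trans (hD 0)
  have hF := isTame_of_bounded hf hD hB hfB
  have hG : IsTame (dualFun p f) := isTame_of_bounded (measurable_dualFun p hf) (D := D ^ (p - 1))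
    (fun z => by
      rw [norm_dualFun hp]
      exact Real.rpow_le_rpow (norm_nonneg _) (hD z) (by linarith)) hB
    (fun z hz => by rw [dualFun, hfB z hz, mul_zero])
  obtain ⟨A, hA⟩ : ∃ A, A = ∫⁻ z, ‖f z‖ₑ ^ p := ⟨_, rfl⟩
  have eA : ‖∫ z, f z * (starRingEnd ℂ) (dualFun p f z)‖ₑ = A := by
    simp only [mul_conj_dualFun hp]
    rw [integral_complex_ofReal, enorm_ofReal_of_nonneg (integral_nonneg fun z => by positivity),
      ofReal_integral_eq_lintegral_ofReal _ (Filter.Eventually.of_forall fun z => by positivity), hA]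
    · exact lintegral_congr fun z => (enorm_rpow_eq_ofReal _ hp0.le).symm
    · refine (hF.integrable_mul_conj hG).norm.congr (Filter.Eventually.of_forall fun z => ?_)
      simp only
      rw [mul_conj_dualFun hp, Complex.norm_real, Real.norm_of_nonneg (by positivity)]
  have hAt : A ≠ ∞ := by rw [← eA]; exact enorm_ne_top
  have eG : ∫⁻ z, ‖dualFun p f z‖ₑ ^ q = A := by
    rw [hA]
    refine lintegral_congr fun z => ?_
    rw [enorm_rpow_eq_ofReal _ hq0.le, enorm_rpow_eq_ofReal _ hp0.le, norm_dualFun hp,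
      ← Real.rpow_mul (norm_nonneg _), hpq.sub_one_mul_conj]
  have hSm : ∀ (χ₁ χ₂ χ₃ : 𝓢(E m, ℂ)) {g : E m × E m → ℂ}, Measurable g →
      AEMeasurable (squareFunction χ₁ χ₂ χ₃ g) volume :=
    fun χ₁ χ₂ χ₃ g hg => (measurable_squareFunction (a χ₁) (a χ₂) (a χ₃) hg).aemeasurable
  -- The duality estimate and Hölder's inequality; the upper bound for the dual profiles estimates
  -- the second factor.
  have key : A ≤ (∫⁻ z, squareFunction φ₁ φ₂ φ₃ f z ^ p) ^ (1 / p) * (C ^ (1 / q) * A ^ (1 / q)) := by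
    conv_lhs => rw [← eA]
    refine (enorm_integral_mul_conj_le_squareFunction hm P₁ P₂ P₃ (a _) (a _) (a _) φ₁.integrable
      φ₂.integrable φ₃.integrable (a _) (a _) (a _) ψ₁.integrable ψ₂.integrable ψ₃.integrable
      hF hG).trans ?_
    refine (ENNReal.lintegral_mul_le_Lp_mul_Lq volume hpq (hSm φ₁ φ₂ φ₃ hf)
      (hSm ψ₁ ψ₂ ψ₃ hG.measurable)).trans (mul_le_mul_right ?_ _)
    rw [← ENNReal.mul_rpow_of_nonneg _ _ (by positivity)]
    refine ENNReal.rpow_le_rpow ?_ (by positivity)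
    rw [← eG]
    exact H _ hG.measurable
  rw [← hA]
  -- Since `A` is finite, its power `1 / q` cancels.
  rcases eq_or_ne A 0 with h0 | h0
  · rw [h0]; exact zero_le
  have hAq0 : A ^ (1 / q) ≠ 0 := by simp [ENNReal.rpow_eq_zero_iff, h0, hAt]
  have hAqt : A ^ (1 / q) ≠ ∞ := ENNReal.rpow_ne_top_of_nonneg (by positivity) hAt
  have eApq : A ^ (1 / p) * A ^ (1 / q) = A := by
    rw [← ENNReal.rpow_add _ _ h0 hAt, one_div, one_div, hpq.inv_add_inv_eq_one, ENNReal.rpow_one]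
  have key2 : A ^ (1 / p) ≤ C ^ (1 / q) * (∫⁻ z, squareFunction φ₁ φ₂ φ₃ f z ^ p) ^ (1 / p) := by
    rw [← ENNReal.mul_le_mul_iff_left hAq0 hAqt, eApq]
    refine key.trans_eq ?_
    ring
  have key3 := ENNReal.rpow_le_rpow key2 hp0.le
  rw [ENNReal.mul_rpow_of_nonneg _ _ hp0.le, ← ENNReal.rpow_mul, ← ENNReal.rpow_mul _ (1 / p),
    one_div_mul_cancel hp0.ne', ENNReal.rpow_one, ENNReal.rpow_one] at key3
  exact key3

/-! ### Passage to general functions -/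

lemma exists_norm_dilate_le (φ : 𝓢(E m, ℂ)) (r : ℝ) :
    ∃ D : ℝ, ∀ x, ‖dilate φ r x‖ ≤ D := by
  refine ⟨‖(((r ^ m)⁻¹ : ℝ) : ℂ)‖ * SchwartzMap.seminorm ℝ 0 0 φ, fun x => ?_⟩
  rw [dilate, norm_mul]
  exact mul_le_mul_of_nonneg_left (SchwartzMap.norm_le_seminorm ℝ φ _) (norm_nonneg _)

section
variable (φ₁ φ₂ φ₃ : 𝓢(E m, ℂ)) {r : ℝ × ℝ × ℝ}

lemma integrable_twistedDilate (hr : r ∈ Ioi (0 : ℝ) ×ˢ Ioi (0 : ℝ) ×ˢ Ioi (0 : ℝ)) :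
    Integrable (twistedDilate φ₁ φ₂ φ₃ r) := by
  have h := integrable_fibre_mul (integrable_dilate φ₁.integrable hr.1)
    (integrable_dilate φ₂.integrable hr.2.1) (integrable_dilate φ₃.integrable hr.2.2)
    (f := fun _ => 1) measurable_const (D := 1) (fun _ => by simp) 0
  simp only [mul_one] at h
  exact h.integral_prod_left

lemma exists_norm_twistedDilate_le (hr : r ∈ Ioi (0 : ℝ) ×ˢ Ioi (0 : ℝ) ×ˢ Ioi (0 : ℝ)) :
    ∃ D : ℝ, ∀ x, ‖twistedDilate φ₁ φ₂ φ₃ r x‖ ≤ D := by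
  obtain ⟨D₁, hD₁⟩ := exists_norm_dilate_le φ₁ r.1
  obtain ⟨D₂, hD₂⟩ := exists_norm_dilate_le φ₂ r.2.1
  have h0 : 0 ≤ D₁ := (norm_nonneg _).trans (hD₁ 0)
  refine ⟨∫ u, D₁ * D₂ * ‖dilate φ₃ r.2.2 u‖, fun x => ?_⟩
  refine norm_integral_le_of_norm_le
    ((integrable_dilate φ₃.integrable hr.2.2).norm.const_mul _)
    (Filter.Eventually.of_forall fun u => ?_)
  rw [tensor, norm_mul, norm_mul]
  exact mul_le_mul_of_nonneg_right
    (mul_le_mul (hD₁ _) (hD₂ _) (norm_nonneg _) h0) (norm_nonneg _)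

end

/-- An `L^p` function is convolved with a bounded integrable kernel by an absolutely convergent
integral. -/
lemma integrable_mul_of_lintegral_rpow {p : ℝ} (hp : 1 ≤ p) {f k : E m × E m → ℂ}
    (hf : Measurable f) (hfp : ∫⁻ z, ‖f z‖ₑ ^ p ≠ ∞) (hkm : Measurable k) (hk : Integrable k)
    {D : ℝ} (hD : ∀ z, ‖k z‖ ≤ D) (x : E m × E m) : Integrable fun y => f y * k (x - y) := by
  have hk' : Integrable fun y => k (x - y) := hk.comp_sub_left x
  have hkm' : Measurable fun y => k (x - y) := hkm.comp (by fun_prop)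
  refine ⟨(hf.mul hkm').aestronglyMeasurable, ?_⟩
  have hle : ∀ y, ‖f y * k (x - y)‖ₑ ≤ ‖k (x - y)‖ₑ + ENNReal.ofReal D * ‖f y‖ₑ ^ p := by
    intro y
    rw [enorm_mul]
    rcases le_total ‖f y‖ₑ 1 with h | h
    · exact le_add_right ((mul_le_mul_left h _).trans_eq (one_mul _))
    · refine le_add_left ?_
      rw [mul_comm]
      refine mul_le_mul' ?_ ?_
      · rw [← ofReal_norm]; exact ENNReal.ofReal_le_ofReal (hD _)
      · conv_lhs => rw [← ENNReal.rpow_one ‖f y‖ₑ]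
        exact ENNReal.rpow_le_rpow_of_exponent_le h hp
  refine lt_of_le_of_lt (lintegral_mono hle) ?_
  rw [lintegral_add_left hkm'.enorm, lintegral_const_mul' _ _ ENNReal.ofReal_ne_top]
  exact ENNReal.add_lt_top.2 ⟨hk'.2, ENNReal.mul_lt_top ENNReal.ofReal_lt_top hfp.lt_top⟩

lemma conv_sub_twistedDilate {p : ℝ} (hp : 1 ≤ p) (φ₁ φ₂ φ₃ : 𝓢(E m, ℂ)) {f g : E m × E m → ℂ}
    (hf : Measurable f) (hg : Measurable g) (hfp : ∫⁻ z, ‖f z‖ₑ ^ p ≠ ∞)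
    (hgp : ∫⁻ z, ‖g z‖ₑ ^ p ≠ ∞) {r : ℝ × ℝ × ℝ}
    (hr : r ∈ Ioi (0 : ℝ) ×ˢ Ioi (0 : ℝ) ×ˢ Ioi (0 : ℝ)) (x : E m × E m) :
    conv (fun z => f z - g z) (twistedDilate φ₁ φ₂ φ₃ r) x
      = conv f (twistedDilate φ₁ φ₂ φ₃ r) x - conv g (twistedDilate φ₁ φ₂ φ₃ r) x := by
  have hk : Measurable (twistedDilate φ₁ φ₂ φ₃ r) :=
    (measurable_twistedDilate φ₁.continuous.measurable φ₂.continuous.measurable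
      φ₃.continuous.measurable).comp (f := fun z : E m × E m => (r, z)) measurable_prodMk_left
  obtain ⟨D, hD⟩ := exists_norm_twistedDilate_le φ₁ φ₂ φ₃ hr
  have hi := integrable_twistedDilate φ₁ φ₂ φ₃ hr
  obtain ⟨k, hke⟩ : ∃ k, k = twistedDilate φ₁ φ₂ φ₃ r := ⟨_, rfl⟩
  rw [← hke] at hk hD hi ⊢
  simp only [conv, sub_mul]
  exact integral_sub (integrable_mul_of_lintegral_rpow hp hf hfp hk hi hD x)
    (integrable_mul_of_lintegral_rpow hp hg hgp hk hi hD x)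

/-- The square function is quasi-subadditive on `L^p`. -/
lemma squareFunction_sub_le {p : ℝ} (hp : 1 ≤ p) (φ₁ φ₂ φ₃ : 𝓢(E m, ℂ)) {f g : E m × E m → ℂ}
    (hf : Measurable f) (hg : Measurable g) (hfp : ∫⁻ z, ‖f z‖ₑ ^ p ≠ ∞)
    (hgp : ∫⁻ z, ‖g z‖ₑ ^ p ≠ ∞) (x : E m × E m) :
    squareFunction φ₁ φ₂ φ₃ (fun z => f z - g z) x
      ≤ 2 * (squareFunction φ₁ φ₂ φ₃ f x + squareFunction φ₁ φ₂ φ₃ g x) := by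
  have a : ∀ φ : 𝓢(E m, ℂ), Measurable φ := fun φ => φ.continuous.measurable
  have hmf : Measurable fun r => ‖conv f (twistedDilate φ₁ φ₂ φ₃ r) x‖ₑ :=
    ((measurable_conv_twistedDilate (a φ₁) (a φ₂) (a φ₃) hf).comp
      (f := fun r : ℝ × ℝ × ℝ => (x, r)) measurable_prodMk_left).enorm
  have hm1 : Measurable fun r => ‖conv f (twistedDilate φ₁ φ₂ φ₃ r) x‖ₑ ^ 2 /
      ENNReal.ofReal (r.1 * r.2.1 * r.2.2) :=
    (hmf.pow_const 2).div (by fun_prop)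
  have hsq : ∀ s t : ℝ≥0∞, (s + t) ^ 2 ≤ 2 * (s ^ 2 + t ^ 2) := by
    intro s t
    have h := ENNReal.rpow_add_le_mul_rpow_add_rpow s t (by norm_num : (1 : ℝ) ≤ 2)
    norm_num at h
    exact h
  have h2 : squareFunction φ₁ φ₂ φ₃ (fun z => f z - g z) x ^ 2
      ≤ 2 * (squareFunction φ₁ φ₂ φ₃ f x ^ 2 + squareFunction φ₁ φ₂ φ₃ g x ^ 2) := by
    rw [squareFunction_sq, squareFunction_sq, squareFunction_sq, ← lintegral_add_left hm1,
      ← lintegral_const_mul' _ _ (by norm_num)]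
    refine setLIntegral_mono' measurableSet_octant fun r hr => ?_
    rw [conv_sub_twistedDilate hp φ₁ φ₂ φ₃ hf hg hfp hgp hr, ← ENNReal.add_div, ← mul_div_assoc]
    refine ENNReal.div_le_div_right ?_ _
    refine le_trans ?_ (hsq _ _)
    gcongr
    exact enorm_sub_le
  have h3 : squareFunction φ₁ φ₂ φ₃ (fun z => f z - g z) x ^ 2
      ≤ (2 * (squareFunction φ₁ φ₂ φ₃ f x + squareFunction φ₁ φ₂ φ₃ g x)) ^ 2 := by
    refine h2.trans ?_
    rw [mul_pow]
    refine mul_le_mul' (by norm_num) ?_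
    rw [add_sq, add_right_comm]
    exact le_self_add
  exact (ENNReal.pow_le_pow_left_iff (by norm_num)).1 h3

/-- The restriction of `f` to the ball of radius `n`, truncated at height `n`. -/
def ballTruncate (f : E m × E m → ℂ) (n : ℕ) : E m × E m → ℂ :=
  (closedBall (0 : E m × E m) n).indicator (truncate f n)

lemma measurable_ballTruncate {f : E m × E m → ℂ} (hf : Measurable f) (n : ℕ) :
    Measurable (ballTruncate f n) :=
  (measurable_truncate hf n).indicator isClosed_closedBall.measurableSet

lemma norm_ballTruncate_le (f : E m × E m → ℂ) (n : ℕ) (z : E m × E m) : ‖ballTruncate f n z‖ ≤ n :=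
  (norm_indicator_le_norm_self _ z).trans (norm_truncate_le_nat f n z)

lemma ballTruncate_eq_or (f : E m × E m → ℂ) (n : ℕ) (z : E m × E m) :
    ballTruncate f n z = f z ∨ ballTruncate f n z = 0 := by
  by_cases h : z ∈ closedBall (0 : E m × E m) n
  · rw [ballTruncate, indicator_of_mem h, truncate]
    exact (em (z ∈ {z | ‖f z‖ ≤ n})).imp (fun h => indicator_of_mem h _)
      (fun h => indicator_of_notMem h _)
  · exact Or.inr (indicator_of_notMem h _)

lemma eventually_ballTruncate_eq (f : E m × E m → ℂ) (z : E m × E m) :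
    ∀ᶠ n in Filter.atTop, ballTruncate f n z = f z := by
  obtain ⟨N, hN⟩ := exists_nat_gt (max ‖f z‖ ‖z‖)
  filter_upwards [Filter.eventually_ge_atTop N] with n hn
  have hn' : (N : ℝ) ≤ n := by exact_mod_cast hn
  have h1 : z ∈ closedBall (0 : E m × E m) n := by
    rw [mem_closedBall_zero_iff]
    linarith [le_max_right ‖f z‖ ‖z‖]
  have h2 : z ∈ {z | ‖f z‖ ≤ n} := by
    change ‖f z‖ ≤ n
    linarith [le_max_left ‖f z‖ ‖z‖]
  rw [ballTruncate, indicator_of_mem h1, truncate, indicator_of_mem h2]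

lemma enorm_sub_ballTruncate_le (f : E m × E m → ℂ) (n : ℕ) (z : E m × E m) :
    ‖f z - ballTruncate f n z‖ₑ ≤ ‖f z‖ₑ := by
  rcases ballTruncate_eq_or f n z with h | h <;> rw [h] <;> simp

lemma tendsto_lintegral_sub_ballTruncate {p : ℝ} (hp : 0 < p) {f : E m × E m → ℂ} (hf : Measurable f)
    (hfp : ∫⁻ z, ‖f z‖ₑ ^ p ≠ ∞) :
    Filter.Tendsto (fun n => ∫⁻ z, ‖f z - ballTruncate f n z‖ₑ ^ p) Filter.atTop (nhds 0) := by
  have h := tendsto_lintegral_of_dominated_convergence (μ := volume)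
    (F := fun n z => ‖f z - ballTruncate f n z‖ₑ ^ p) (f := fun _ => 0) (fun z => ‖f z‖ₑ ^ p)
    (fun n => (hf.sub (measurable_ballTruncate hf n)).enorm.pow_const p)
    (fun n => Filter.Eventually.of_forall fun z =>
      ENNReal.rpow_le_rpow (enorm_sub_ballTruncate_le f n z) hp.le) hfp
    (Filter.Eventually.of_forall fun z => by
      refine tendsto_const_nhds.congr' ?_
      filter_upwards [eventually_ballTruncate_eq f z] with n hn
      rw [hn, sub_self, enorm_zero, ENNReal.zero_rpow_of_pos hp])
  simpa using h

/-- The lower bound on `L^p`, as an inequality of integrals. The square function of the truncation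
error is estimated by the upper bound. -/
theorem exists_lintegral_rpow_le_squareFunction (hm : 1 ≤ m) {p : ℝ} (hp : 1 < p)
    (φ₁ φ₂ φ₃ : 𝓢(E m, ℂ)) (z₁ : ∫ x, φ₁ x = 0) (z₂ : ∫ x, φ₂ x = 0) (z₃ : ∫ x, φ₃ x = 0)
    (h₁ : Nondegenerate φ₁) (h₂ : Nondegenerate φ₂) (h₃ : Nondegenerate φ₃) :
    ∃ C : ℝ≥0∞, C ≠ ∞ ∧ ∀ f : E m × E m → ℂ, Measurable f → ∫⁻ z, ‖f z‖ₑ ^ p ≠ ∞ →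
      ∫⁻ z, ‖f z‖ₑ ^ p ≤ C * ∫⁻ z, squareFunction φ₁ φ₂ φ₃ f z ^ p := by
  have hp0 : 0 < p := by linarith
  have a : ∀ φ : 𝓢(E m, ℂ), Measurable φ := fun φ => φ.continuous.measurable
  obtain ⟨C, hC, H⟩ := exists_lintegral_squareFunction_rpow_le hp φ₁ φ₂ φ₃ z₁ z₂ z₃
  obtain ⟨C', hC', H'⟩ := exists_lintegral_rpow_le_squareFunction_of_bounded hm hp φ₁ φ₂ φ₃ h₁ h₂ h₃
  obtain ⟨N, hN⟩ : ∃ N : ℝ≥0∞, N = 2 ^ (p - 1) := ⟨_, rfl⟩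
  have hNt : N ≠ ∞ := by rw [hN]; exact ENNReal.rpow_ne_top_of_nonneg (by linarith) (by norm_num)
  have h2t : (2 : ℝ≥0∞) ^ p ≠ ∞ := ENNReal.rpow_ne_top_of_nonneg hp0.le (by norm_num)
  have hadd : ∀ s t : ℝ≥0∞, (s + t) ^ p ≤ N * (s ^ p + t ^ p) := fun s t => by
    rw [hN]; exact ENNReal.rpow_add_le_mul_rpow_add_rpow s t hp.le
  have hK1 : N * (C' * (2 ^ p * N)) ≠ ∞ :=
    ENNReal.mul_ne_top hNt (ENNReal.mul_ne_top hC' (ENNReal.mul_ne_top h2t hNt))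
  refine ⟨N * (C' * (2 ^ p * N)), hK1, fun f hf hfp => ?_⟩
  obtain ⟨Sp, hSp⟩ : ∃ Sp, Sp = ∫⁻ z, squareFunction φ₁ φ₂ φ₃ f z ^ p := ⟨_, rfl⟩
  obtain ⟨e, he⟩ : ∃ e : ℕ → ℝ≥0∞, ∀ n, e n = ∫⁻ z, ‖f z - ballTruncate f n z‖ₑ ^ p := ⟨_, fun _ => rfl⟩
  have hK2 : N * (C' * (2 ^ p * N)) * C + N ≠ ∞ :=
    ENNReal.add_ne_top.2 ⟨ENNReal.mul_ne_top hK1 hC, hNt⟩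
  have hmain : ∀ n, ∫⁻ z, ‖f z‖ₑ ^ p
      ≤ N * (C' * (2 ^ p * N)) * Sp + (N * (C' * (2 ^ p * N)) * C + N) * e n := by
    intro n
    have hcm := measurable_ballTruncate hf n
    have hdm : Measurable fun z => f z - ballTruncate f n z := hf.sub hcm
    have hdp : ∫⁻ z, ‖f z - ballTruncate f n z‖ₑ ^ p ≠ ∞ := ne_top_of_le_ne_top hfp
      (lintegral_mono fun z => ENNReal.rpow_le_rpow (enorm_sub_ballTruncate_le f n z) hp0.le)
    -- Split `f` into its truncation and the error, whose norm is `e n`.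
    have s1 : ∫⁻ z, ‖f z‖ₑ ^ p ≤ N * ((∫⁻ z, ‖ballTruncate f n z‖ₑ ^ p) + e n) := by
      rw [he, ← lintegral_add_left (hcm.enorm.pow_const p), ← lintegral_const_mul' _ _ hNt]
      refine lintegral_mono fun z => le_trans (ENNReal.rpow_le_rpow ?_ hp0.le) (hadd _ _)
      have := enorm_add_le (ballTruncate f n z) (f z - ballTruncate f n z)
      rwa [add_sub_cancel] at this
    have s2 := H' _ hcm n (norm_ballTruncate_le f n) (closedBall 0 n)
      (isCompact_closedBall _ _).measure_lt_top.ne fun z hz => indicator_of_notMem hz _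
    -- The truncation is `f` minus the error, so that its square function is controlled by that of
    -- `f` and the norm of the error.
    have s3 : ∫⁻ z, squareFunction φ₁ φ₂ φ₃ (ballTruncate f n) z ^ p ≤ 2 ^ p * N * (Sp + C * e n) := by
      have e1 : ballTruncate f n = fun z => f z - (f z - ballTruncate f n z) := by funext z; ring
      calc ∫⁻ z, squareFunction φ₁ φ₂ φ₃ (ballTruncate f n) z ^ p
          ≤ ∫⁻ z, 2 ^ p * N * (squareFunction φ₁ φ₂ φ₃ f z ^ p +
              squareFunction φ₁ φ₂ φ₃ (fun z => f z - ballTruncate f n z) z ^ p) := by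
            refine lintegral_mono fun z => ?_
            have h := squareFunction_sub_le hp.le φ₁ φ₂ φ₃ hf hdm hfp hdp z
            rw [← e1] at h
            refine (ENNReal.rpow_le_rpow h hp0.le).trans ?_
            rw [ENNReal.mul_rpow_of_nonneg _ _ hp0.le, mul_assoc]
            exact mul_le_mul_right (hadd _ _) _
        _ = 2 ^ p * N * (Sp + ∫⁻ z, squareFunction φ₁ φ₂ φ₃ (fun z => f z - ballTruncate f n z) z ^ p) := by
            rw [lintegral_const_mul' _ _ (ENNReal.mul_ne_top h2t hNt), hSp, lintegral_add_left
              ((measurable_squareFunction (a φ₁) (a φ₂) (a φ₃) hf).pow_const p)]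
        _ ≤ 2 ^ p * N * (Sp + C * e n) := by
            rw [he]
            exact mul_le_mul_right (add_le_add_right (H _ hdm) _) _
    calc ∫⁻ z, ‖f z‖ₑ ^ p ≤ N * ((∫⁻ z, ‖ballTruncate f n z‖ₑ ^ p) + e n) := s1
      _ ≤ N * (C' * (2 ^ p * N * (Sp + C * e n)) + e n) := by
          refine mul_le_mul_right (add_le_add_left (s2.trans (mul_le_mul_right s3 _)) _) _
      _ = _ := by ring
  have hlim : Filter.Tendsto (fun n => N * (C' * (2 ^ p * N)) * Sp +
      (N * (C' * (2 ^ p * N)) * C + N) * e n) Filter.atTop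
      (nhds (N * (C' * (2 ^ p * N)) * Sp + (N * (C' * (2 ^ p * N)) * C + N) * 0)) := by
    refine tendsto_const_nhds.add (ENNReal.Tendsto.const_mul ?_ (Or.inr hK2))
    rw [funext he]
    exact tendsto_lintegral_sub_ballTruncate hp0 hf hfp
  rw [mul_zero, add_zero] at hlim
  rw [← hSp]
  exact ge_of_tendsto' hlim hmain

/-- The `L^p` norm is dominated by that of the twisted square function of nondegenerate
profiles. -/
theorem exists_eLpNorm_le_squareFunction (hm : 1 ≤ m) {p : ℝ≥0∞} (hp : 1 < p) (hp' : p < ∞)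
    (φ₁ φ₂ φ₃ : 𝓢(E m, ℂ)) (z₁ : ∫ x, φ₁ x = 0) (z₂ : ∫ x, φ₂ x = 0) (z₃ : ∫ x, φ₃ x = 0)
    (h₁ : Nondegenerate φ₁) (h₂ : Nondegenerate φ₂) (h₃ : Nondegenerate φ₃) :
    ∃ C : ℝ≥0, ∀ f : E m × E m → ℂ, MemLp f p volume →
      eLpNorm f p volume ≤ C * eLpNorm (squareFunction φ₁ φ₂ φ₃ f) p volume := by
  have hp1 : 1 < p.toReal := by
    rw [← ENNReal.toReal_one]; exact (ENNReal.toReal_lt_toReal (by simp) hp'.ne).2 hp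
  obtain ⟨C, hC, H⟩ := exists_lintegral_rpow_le_squareFunction hm hp1 φ₁ φ₂ φ₃ z₁ z₂ z₃ h₁ h₂ h₃
  have hs : (0:ℝ) < 1 / p.toReal := by positivity
  refine ⟨(C ^ (1 / p.toReal)).toNNReal, fun f hf => ?_⟩
  rw [ENNReal.coe_toNNReal (ENNReal.rpow_ne_top_of_nonneg hs.le hC)]
  have hfin := hf.2
  obtain ⟨g, hg, hfg⟩ := hf.1
  rw [eLpNorm_congr_ae hfg] at hfin
  rw [squareFunction_congr_ae hfg, eLpNorm_congr_ae hfg]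
  rw [eLpNorm_eq_lintegral _ hp hp'] at hfin ⊢
  rw [eLpNorm_eq_lintegral _ hp hp', ← ENNReal.mul_rpow_of_nonneg _ _ hs.le]
  simp only [enorm_eq_self]
  refine ENNReal.rpow_le_rpow (H g hg.measurable ?_) hs.le
  exact ((ENNReal.rpow_lt_top_iff_of_pos hs).1 hfin).ne

end TwistedLP
end

theorem theorem6999 (m : ℕ) (hm : 1 ≤ m) (p : ℝ≥0∞) (hp : 1 < p) (hp' : p < ∞)
    (φ₁ φ₂ φ₃ : 𝓢(TwistedLP.E m, ℂ))
    (h₁ : ∫ x, φ₁ x = 0) (h₂ : ∫ x, φ₂ x = 0) (h₃ : ∫ x, φ₃ x = 0) :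
    (∃ C : ℝ≥0, ∀ f : TwistedLP.E m × TwistedLP.E m → ℂ, MemLp f p volume →
      MemLp (TwistedLP.squareFunction φ₁ φ₂ φ₃ f) p volume ∧
      eLpNorm (TwistedLP.squareFunction φ₁ φ₂ φ₃ f) p volume ≤ C * eLpNorm f p volume) ∧
    (TwistedLP.Nondegenerate φ₁ → TwistedLP.Nondegenerate φ₂ → TwistedLP.Nondegenerate φ₃ →
      ∃ C : ℝ≥0, ∀ f : TwistedLP.E m × TwistedLP.E m → ℂ, MemLp f p volume →
        eLpNorm f p volume ≤ C * eLpNorm (TwistedLP.squareFunction φ₁ φ₂ φ₃ f) p volume) := by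
  refine ⟨TwistedLP.exists_eLpNorm_squareFunction_le hp hp' φ₁ φ₂ φ₃ h₁ h₂ h₃, fun n₁ n₂ n₃ => ?_⟩
  exact TwistedLP.exists_eLpNorm_le_squareFunction hm hp hp' φ₁ φ₂ φ₃ h₁ h₂ h₃ n₁ n₂ n₃
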